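/- Let $\mathbb{E}$ be a finite-dimensional real vector space with a Euclidean norm $\|x\|=\langle Bx,x\rangle^{1/2}$ ($B=B^*\succ 0$), let $\|\cdot\|_*$ be the dual norm on $\mathbb{E}^*$, and let multilinear forms carry the induced norm. Let $p\ge 1$ be an integer, let $f$ be a convex function with open domain $\mathrm{dom}\,f$ that is $p$ times continuously differentiable there and satisfies $\|D^pf(x)-D^pf(y)\|\le L_p(f)\|x-y\|$ for all $x,y\in\mathrm{dom}\,f$, with a constant $0<L_p(f)<\infty$. Let $\psi:\mathbb{E}\to\mathbb{R}\cup\{+\infty\}$ be proper, closed and convex with $\mathrm{dom}\,\psi\subset\mathrm{dom}\,f$, put $F=f+\psi$, and let $x^*\in\mathrm{dom}\,\psi$ be a minimizer of $F$, $F^*=F(x^*)$. Fix $x_0\in\mathrm{dom}\,\psi$, $\gamma_0>0$, $\varepsilon>0$; put $d(x)=\frac1{p+1}\|x-x_0\|^{p+1}$ and $\beta_d(x;y)=d(y)-d(x)-\langle\nabla d(x),y-x\rangle$. Assume that $\psi$ is strongly convex with respect to $d$ with constant $\sigma_d(\psi)>0$: $\psi(y)-\psi(x)-\langle s,y-x\rangle\ge\sigma_d(\psi)\beta_d(x;y)$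 for all $x,y\in\mathrm{dom}\,\psi$ and all $s\in\partial\psi(x)$. Put $$\omega=\min\Bigl\{\Bigl(\tfrac{\sigma_d(\psi)\,p!}{L_p(f)(p+1)2^{p-1}}\Bigr)^{\frac1{p+1}},\tfrac12\Bigr\},\qquad c=\frac{p!\,\gamma_0}{2^{p-1}(p+1)^{p+2}L_p(f)},$$ $$\delta=\Bigl(\frac{p!\,\varepsilon}{L_p(f)}\Bigr)^{\frac p{p+1}}\frac{\gamma_0\,p\,\omega}{2^p(p+1)^{((p+1)^2+1)/(p+1)}}.$$ For a function $h=g+\phi$ with $g$ smooth, a point $x$ and $M>0$, let $\Omega_p(g,x;\cdot)$ be the Taylor polynomial of $g$ of degree $p$ at $x$, let $$T_M(h;x)=\mathop{\rm argmin}_{y}\Bigl\{\Omega_p(g,x;y)+\tfrac{M}{(p+1)!}\|y-x\|^{p+1}+\phi(y)\Bigr\}$$ be the tensor step, and for $T=T_M(h;x)$ put $h'(T)=\nabla g(T)-\nabla_y\Omega_p(g,x;T)-\frac M{p!}\|T-x\|^{p-1}B(T-x)$. The contracting proximal tensor method sets $v_0=x_0$, $A_0=0$, and does the following for $k=0,1,2,\dots$: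 1. If $k=0$, it sets $a_{k+1}=c(p+1)(k+1)^p$, otherwise $a_{k+1}=\omega(1-\omega)^{-1}A_k$; then $A_{k+1}=A_k+a_{k+1}$. 2. It forms $h_{k+1}=g_{k+1}+\phi_{k+1}$ with $g_{k+1}(x)=A_{k+1}f\bigl(\frac{a_{k+1}x+A_kx_k}{A_{k+1}}\bigr)$ and $\phi_{k+1}(x)=a_{k+1}\psi(x)+\gamma_k\beta_d(v_k;x)$. 3. With $M=pL_p(f)\,a_{k+1}^{p+1}/A_{k+1}^p$ and $z_0=v_k$, it makes tensor steps $z_{t+1}=T_M(h_{k+1};z_t)$, at least one, until $\|h_{k+1}'(z_t)\|_*\le\delta$ holds for the first time; $t_k$ is the number of steps made, and $v_{k+1}=z_{t_k}$. 4. It sets $x_{k+1}=\frac{a_{k+1}v_{k+1}+A_kx_k}{A_{k+1}}$ and $\gamma_{k+1}=\gamma_k+a_{k+1}\sigma_d(\psi)$. Let $$\mathcal{L}=\log\Bigl(\max\Bigl\{\frac{(p+1)^p}{\omega^{p+1}},\ \frac{L_p(f)\,\beta_d(x_0;x^*)\,(p+1)^{p+1}\,2^{p+\frac1p}}{p!\,\varepsilon}\Bigr\}\Bigr),\qquad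 K=\Bigl\lfloor 2+\frac1\omega\mathcal{L}\Bigr\rfloor .$$ **Theorem (strongly convex case).** The first $K$ iterations of the method are well defined (every tensor step has a unique solution, and every inner loop stops after finitely many steps), the point $x_K\in\mathrm{dom}\,\psi$ satisfies $F(x_K)-F^*\le\varepsilon$, and the total number $N_K=\sum_{k=0}^{K-1}t_k$ of inner tensor steps in these $K$ iterations satisfies $$N_K\le K\cdot\Bigl(3+\bigl(1+\tfrac{e}{(e-1)p}\bigr)(1+\mathcal{L})+\log\Bigl(\max\Bigl\{1,\Bigl(\tfrac{4\sigma_d(\psi)\,p!}{(p+1)L_p(f)}\Bigr)^{\frac1p}\Bigr\}\cdot\Bigl(1+\frac1{\gamma_0}\Bigr)\cdot\frac{(p+1)^{\frac{p+2}p}}{p^{\frac{p+1}p}}\cdot 2^{\frac{2p^2+p+4}p}\Bigr)\Bigr).$$ -/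

import Mathlib

open scoped Nat BigOperators

noncomputable section

namespace ContractingTensor

variable {E : Type*} [NormedAddCommGroup E] [InnerProductSpace ℝ E]

/-- `s` is a subgradient at `x` of the extended-valued function that equals `ψ` on `D`
and `+∞` off `D`. -/
def IsSubgradient (D : Set E) (ψ : E → ℝ) (x : E) (s : E →L[ℝ] ℝ) : Prop :=
  x ∈ D ∧ ∀ y ∈ D, ψ x + s (y - x) ≤ ψ y

/-- The extended-valued function that equals `ψ` on `D` and `+∞` off `D` is proper, closed
(its epigraph is closed) and convex. -/
def ProperClosedConvex (D : Set E) (ψ : E → ℝ) : Prop :=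
  D.Nonempty ∧ ConvexOn ℝ D ψ ∧ IsClosed {q : E × ℝ | q.1 ∈ D ∧ ψ q.1 ≤ q.2}

/-- The Bregman divergence `β_d(x; y)` of a differentiable function, centered at `x`. -/
def bregman (d : E → ℝ) (x y : E) : ℝ := d y - d x - fderiv ℝ d x (y - x)

/-- The prox function `‖x - x₀‖ ^ (p + 1) / (p + 1)`. -/
def prox (p : ℕ) (x₀ x : E) : ℝ := ‖x - x₀‖ ^ (p + 1) / (p + 1)

/-- `ψ`, with domain `D`, is strongly convex with respect to `d` with constant `σ`. -/
def RelStronglyConvex (D : Set E) (ψ d : E → ℝ) (σ : ℝ) : Prop :=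
  ∀ x ∈ D, ∀ y ∈ D, ∀ s : E →L[ℝ] ℝ, IsSubgradient D ψ x s →
    σ * bregman d x y ≤ ψ y - ψ x - s (y - x)

/-- The Taylor polynomial `Ω_p(g, x; y)` of degree `p` of `g` around `x`. -/
def taylor (p : ℕ) (g : E → ℝ) (x y : E) : ℝ :=
  ∑ i ∈ Finset.range (p + 1), (1 / (i ! : ℝ)) * iteratedFDeriv ℝ i g x (fun _ => y - x)

/-- The objective of the tensor step from `x` for the composite function `g + phi`. -/
def tensorModel (p : ℕ) (M : ℝ) (g phi : E → ℝ) (x y : E) : ℝ :=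
  taylor p g x y + M / ((p + 1)! : ℝ) * ‖y - x‖ ^ (p + 1) + phi y

/-- `T = T_M(g + phi; x)`: the point `T` is the unique minimizer of the model over the domain `D`
of `phi`. -/
def IsTensorStep (D : Set E) (p : ℕ) (M : ℝ) (g phi : E → ℝ) (x T : E) : Prop :=
  T ∈ D ∧ ∀ y ∈ D, y ≠ T → tensorModel p M g phi x T < tensorModel p M g phi x y

/-- For `T = T_M(h; x)` with `h = g + phi`, the subgradient `h'(T) = ∇g(T) + phi'(T)` of `h`, where
`phi'(T) = -∇Ω_p(g, x; T) - (M / p!) ‖T - x‖ ^ (p - 1) B (T - x)` comes from the optimality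
condition of the tensor step. -/
def stepGrad (p : ℕ) (M : ℝ) (g : E → ℝ) (x T : E) : E →L[ℝ] ℝ :=
  fderiv ℝ g T - fderiv ℝ (taylor p g x) T
    - (M / (p ! : ℝ) * ‖T - x‖ ^ (p - 1)) • innerSL ℝ (T - x)

/-- The constant `c` of the algorithm. -/
def cConst (p : ℕ) (L γ₀ : ℝ) : ℝ :=
  (p ! : ℝ) * γ₀ / (2 ^ (p - 1) * ((p : ℝ) + 1) ^ (p + 2) * L)

/-- The condition number `ω`. -/
def omega (p : ℕ) (L σ : ℝ) : ℝ :=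
  min ((σ * (p ! : ℝ) / (L * ((p : ℝ) + 1) * 2 ^ (p - 1))) ^ (1 / ((p : ℝ) + 1))) (1 / 2)

/-- The coefficient `a_{k+1}`, as a function of `k` and of the value `A` of `A_k`. -/
def stepCoef (p : ℕ) (L σ γ₀ : ℝ) (k : ℕ) (A : ℝ) : ℝ :=
  open Classical in
  if k = 0 ∨ omega p L σ = 0 then cConst p L γ₀ * ((p : ℝ) + 1) * ((k : ℝ) + 1) ^ p
  else omega p L σ * (1 - omega p L σ)⁻¹ * A

/-- `A_k`. -/
def coefA (p : ℕ) (L σ γ₀ : ℝ) : ℕ → ℝ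
  | 0 => 0
  | k + 1 => coefA p L σ γ₀ k + stepCoef p L σ γ₀ k (coefA p L σ γ₀ k)

/-- `nextCoef p L σ γ₀ k` is `a_{k+1}`. -/
def nextCoef (p : ℕ) (L σ γ₀ : ℝ) (k : ℕ) : ℝ := stepCoef p L σ γ₀ k (coefA p L σ γ₀ k)

/-- `γ_k`. -/
def coefGamma (p : ℕ) (L σ γ₀ : ℝ) : ℕ → ℝ
  | 0 => γ₀
  | k + 1 => coefGamma p L σ γ₀ k + nextCoef p L σ γ₀ k * σ

/-- The contracted smooth part `g_{k+1}`, where `xk` is the current point `x_k`. -/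
def contracted (f : E → ℝ) (p : ℕ) (L σ γ₀ : ℝ) (k : ℕ) (xk : E) (y : E) : ℝ :=
  coefA p L σ γ₀ (k + 1) *
    f ((coefA p L σ γ₀ (k + 1))⁻¹ • (nextCoef p L σ γ₀ k • y + coefA p L σ γ₀ k • xk))

/-- The composite part `φ_{k+1}`, where `vk` is the current prox center `v_k`. -/
def compositePart (ψ : E → ℝ) (p : ℕ) (L σ γ₀ : ℝ) (x₀ : E) (k : ℕ) (vk : E) (y : E) : ℝ :=
  nextCoef p L σ γ₀ k * ψ y + coefGamma p L σ γ₀ k * bregman (prox p x₀) vk y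

/-- The regularization parameter `M = p L_p(f) a_{k+1} ^ (p + 1) / A_{k+1} ^ p` of the inner
tensor steps. -/
def stepM (p : ℕ) (L σ γ₀ : ℝ) (k : ℕ) : ℝ :=
  p * L * (nextCoef p L σ γ₀ k ^ (p + 1) / coefA p L σ γ₀ (k + 1) ^ p)

/-- `x`, `v`, `z`, `t` record the first `K` iterations (numbered `0, …, K - 1`) of the contracting
proximal tensor method for `f + ψ`, where `D` is the domain of `ψ`, with starting point `x₀`,
inner accuracy `δ` and parameters `p`, `L = L_p(f)`, `σ = σ_d(ψ)`, `γ₀`: the points `x k`, `v k`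
are `x_k`, `v_k`, the points `z k 0, …, z k (t k)` are those of the inner loop of iteration `k`,
and `t k` is its number of tensor steps. -/
structure IsRun (f : E → ℝ) (D : Set E) (ψ : E → ℝ) (p : ℕ) (L σ γ₀ δ : ℝ) (x₀ : E) (K : ℕ)
    (x v : ℕ → E) (z : ℕ → ℕ → E) (t : ℕ → ℕ) : Prop where
  x_zero : x 0 = x₀
  v_zero : v 0 = x₀
  /-- The inner loop starts from `v_k`. -/
  z_zero : ∀ k < K, z k 0 = v k
  /-- Each inner iteration is a tensor step for `h_{k+1} = g_{k+1} + φ_{k+1}`. -/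
  z_succ : ∀ k < K, ∀ s < t k,
    IsTensorStep D p (stepM p L σ γ₀ k) (contracted f p L σ γ₀ k (x k))
      (compositePart ψ p L σ γ₀ x₀ k (v k)) (z k s) (z k (s + 1))
  /-- The loop has a do-until form: at least one step is made, and the loop goes on while the
  test fails. -/
  earlier_tests : ∀ k < K, ∀ s, s + 1 < t k →
    δ < ‖stepGrad p (stepM p L σ γ₀ k) (contracted f p L σ γ₀ k (x k)) (z k s) (z k (s + 1))‖
  /-- The test `‖h'_{k+1}(z_{t_k})‖_* ≤ δ` succeeds after step number `t k`. -/
  last_test : ∀ k < K, ∃ s, t k = s + 1 ∧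
    ‖stepGrad p (stepM p L σ γ₀ k) (contracted f p L σ γ₀ k (x k)) (z k s) (z k (s + 1))‖ ≤ δ
  v_succ : ∀ k < K, v (k + 1) = z k (t k)
  x_succ : ∀ k < K, x (k + 1) = (coefA p L σ γ₀ (k + 1))⁻¹ •
    (nextCoef p L σ γ₀ k • v (k + 1) + coefA p L σ γ₀ k • x k)

/-- The inner accuracy `δ` prescribed for the target accuracy `ε`. -/
def innerAccuracy (p : ℕ) (L σ γ₀ ε : ℝ) : ℝ :=
  ((p ! : ℝ) * ε / L) ^ ((p : ℝ) / ((p : ℝ) + 1)) *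
    (γ₀ * p * omega p L σ /
      (2 ^ p * ((p : ℝ) + 1) ^ ((((p : ℝ) + 1) ^ 2 + 1) / ((p : ℝ) + 1))))

/-- The logarithmic factor `𝓛`, where `β` is the value `β_d(x₀; x*)`. -/
def logFactor (p : ℕ) (L σ ε β : ℝ) : ℝ :=
  Real.log (max (((p : ℝ) + 1) ^ p / omega p L σ ^ (p + 1))
    (L * β * ((p : ℝ) + 1) ^ (p + 1) * (2 : ℝ) ^ ((p : ℝ) + 1 / (p : ℝ)) / ((p ! : ℝ) * ε)))

/-- The number `K` of outer iterations. -/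
def outerIters (p : ℕ) (L σ ε β : ℝ) : ℕ :=
  ⌊2 + 1 / omega p L σ * logFactor p L σ ε β⌋₊

/-- The bound on the average number of inner steps per outer iteration. -/
def innerBound (p : ℕ) (L σ γ₀ ε β : ℝ) : ℝ :=
  3 + (1 + Real.exp 1 / ((Real.exp 1 - 1) * p)) * (1 + logFactor p L σ ε β)
    + Real.log (max 1 ((4 * σ * (p ! : ℝ) / (((p : ℝ) + 1) * L)) ^ (1 / (p : ℝ)))
      * (1 + 1 / γ₀)
      * (((p : ℝ) + 1) ^ (((p : ℝ) + 2) / (p : ℝ)) / (p : ℝ) ^ (((p : ℝ) + 1) / (p : ℝ)))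
      * (2 : ℝ) ^ ((2 * (p : ℝ) ^ 2 + p + 4) / (p : ℝ)))

end ContractingTensor

end

open ContractingTensor

/-! Two estimates are combined: one for the potential S_k = A_k (F(x_k) − F*) + γ_k β_d(v_k; x*) of
the outer method, one for tensor steps on a well-conditioned inner problem.

Outer loop. Convexity of f and ψ, the subgradient inequality at the inexact inner solution and the
three-point identity for β_d give S_{k+1} ≤ S_k + δ ‖x* − v_{k+1}‖. As d is uniformly convex of
degree p + 1, this distance is at most a constant times S_{k+1}^{1/(p+1)}, so S_k^{p/(p+1)} grows at
most linearly in k (`rpow_recursion`). The value of δ makes each increment ½ (A_1 ε)^{p/(p+1)} ·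
pω/(p+1), and 𝓛 controls S_0. Hence S_k ≤ A_1 ε e^𝓛 for k < K, and S_K ≤ A_1 ε e^{ω(K−1)} ≤ A_1 ε
(1−ω)^{−(K−1)} = A_K ε; dividing by A_K gives the accuracy.

Inner loop. Contraction turns L into M_k = L a_{k+1}^{p+1} / A_{k+1}^p, and c and ω are such that
M_k / p! is at most the modulus of uniform convexity of φ_{k+1} (`innerProblem`). With
regularization p M_k the tensor model is convex, so steps exist and are unique. The first step
brings the gap below (M_k / p!) ‖w − v_k‖^{p+1} ≤ 2 S_k, where w is the inner minimizer; each later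
step multiplies it by at most exp(−`rate p`) (`InnerProblem.gap_le`), while a failed test bounds the
gap before the step from below (`InnerProblem.le_gap`). So t_k ≤ 3 + `gapLog` / `rate p`.

Summation. `gapLog` contains k log(1/(1−ω)) / p. As ω(K−1) is between 𝓛 and ω + 𝓛, this costs on
average about (log 2) 𝓛 / p per iteration. The constants in `rate` fit: 0.7 exceeds log 2 and 1.58
is below e/(e−1), so dividing by the rate yields the factor 1 + e/((e−1)p). -/

noncomputable section

namespace ContractingTensor

universe u v

/-! ### Differentiation of Taylor polynomials, and Taylor's inequality for vector-valued maps. -/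

section Calculus

variable {E : Type u} [NormedAddCommGroup E] [NormedSpace ℝ E]
  {F : Type v} [NormedAddCommGroup F] [NormedSpace ℝ F]

/-- The second derivative stays symmetric after further differentiation. -/
theorem iteratedFDeriv_fderiv_fderiv_symm {n : ℕ} {G : E → F} {x : E}
    (hG : ContDiffAt ℝ (n + 2 : ℕ) G x) (m : Fin n → E) (v w : E) :
    iteratedFDeriv ℝ n (fun y => fderiv ℝ (fun z => fderiv ℝ G z) y) x m v w =
      iteratedFDeriv ℝ n (fun y => fderiv ℝ (fun z => fderiv ℝ G z) y) x m w v := by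
  have h1 : ContDiffAt ℝ (n + 1 : ℕ) (fun z => fderiv ℝ G z) x :=
    hG.fderiv_right (by norm_cast)
  have h2 : ContDiffAt ℝ (n : ℕ) (fun y => fderiv ℝ (fun z => fderiv ℝ G z) y) x :=
    h1.fderiv_right (by norm_cast)
  have hev : (fun y => fderiv ℝ (fun z => fderiv ℝ G z) y) =ᶠ[nhds x]
      (ContinuousLinearMap.flipₗᵢ ℝ E E F : (E →L[ℝ] E →L[ℝ] F) →L[ℝ] (E →L[ℝ] E →L[ℝ] F)) ∘
        (fun y => fderiv ℝ (fun z => fderiv ℝ G z) y) := by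
    have h3 : ContDiffAt ℝ (2 : ℕ) G x := hG.of_le (by norm_cast; omega)
    filter_upwards [h3.eventually (by simp)] with y hy
    have hs : IsSymmSndFDerivAt ℝ G y := hy.isSymmSndFDerivAt (by simp)
    ext a b
    exact hs a b
  have h4 := hev.iteratedFDeriv ℝ n
  have h5 := h4.eq_of_nhds
  rw [ContinuousLinearMap.iteratedFDeriv_comp_left _ h2 le_rfl] at h5
  conv_lhs => rw [h5]
  rfl

/-- The degree `p` Taylor polynomial of a vector-valued function. -/
def vtaylor (p : ℕ) (G : E → F) (x y : E) : F :=
  ∑ i ∈ Finset.range (p + 1), (1 / (i ! : ℝ)) • iteratedFDeriv ℝ i G x (fun _ => y - x)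

/-- With u = y − x, the form D^{n+2}G[u,…,u] is D^{n+1}G'[u,…,u] applied to u. The product rule and
`h` give n + 1 copies of a term in which the increment and u may be swapped by symmetry; the last
slot adds one more copy. -/
theorem hasFDerivAt_iteratedFDeriv_diag_step {n : ℕ} {G : E → F} {x : E}
    (hG : ContDiffAt ℝ (n + 2 : ℕ) G x)
    (h : ∀ y, HasFDerivAt
      (fun y => iteratedFDeriv ℝ (n + 1) (fun z => fderiv ℝ G z) x (fun _ => y - x))
      ((n + 1 : ℝ) • iteratedFDeriv ℝ n (fun y => fderiv ℝ (fun z => fderiv ℝ G z) y) x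
        (fun _ => y - x)) y) (y : E) :
    HasFDerivAt (fun y => iteratedFDeriv ℝ (n + 2) G x (fun _ => y - x))
      (((n + 1 : ℕ) + 1 : ℝ) • iteratedFDeriv ℝ (n + 1) (fun z => fderiv ℝ G z) x
        (fun _ => y - x)) y := by
  have e1 : (fun y => iteratedFDeriv ℝ (n + 2) G x (fun _ => y - x)) = fun y =>
      iteratedFDeriv ℝ (n + 1) (fun z => fderiv ℝ G z) x (fun _ => y - x) (y - x) := by
    funext y
    rw [iteratedFDeriv_succ_apply_right]
    rfl
  rw [e1]
  have h2 := (h y).clm_apply ((hasFDerivAt_id y).sub_const x)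
  refine h2.congr_fderiv ?_
  ext v
  have e2 : iteratedFDeriv ℝ (n + 1) (fun z => fderiv ℝ G z) x (fun _ => y - x) v =
      iteratedFDeriv ℝ n (fun y => fderiv ℝ (fun z => fderiv ℝ G z) y) x (fun _ => y - x)
        v (y - x) := by
    rw [iteratedFDeriv_succ_apply_right, iteratedFDeriv_fderiv_fderiv_symm hG]
    rfl
  simp only [add_apply, smul_apply,
    ContinuousLinearMap.comp_apply, ContinuousLinearMap.flip_apply, e2, id,
    ContinuousLinearMap.coe_id']
  push_cast
  module

theorem hasFDerivAt_iteratedFDeriv_diag_one {G : E → F} {x : E} (y : E) :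
    HasFDerivAt (fun y => iteratedFDeriv ℝ 1 G x (fun _ => y - x))
      (iteratedFDeriv ℝ 0 (fun z => fderiv ℝ G z) x (fun _ => y - x)) y := by
  simp only [iteratedFDeriv_one_apply, iteratedFDeriv_zero_apply]
  exact (fderiv ℝ G x).hasFDerivAt.comp y ((hasFDerivAt_id y).sub_const x)

end Calculus

/-- The induction replaces the codomain F by E →L[ℝ] F, so F is quantified inside the statement and
shares the universe of E. For real-valued functions one step is done by hand in
`hasFDerivAt_vtaylor_real`, after which the codomain E →L[ℝ] ℝ fits. -/
theorem hasFDerivAt_iteratedFDeriv_diag_aux {E : Type u} [NormedAddCommGroup E] [NormedSpace ℝ E]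
    (n : ℕ) : ∀ {F : Type u} [NormedAddCommGroup F] [NormedSpace ℝ F] {G : E → F} {x : E},
    ContDiffAt ℝ (n + 1 : ℕ) G x → ∀ y,
    HasFDerivAt (fun y => iteratedFDeriv ℝ (n + 1) G x (fun _ => y - x))
      ((n + 1 : ℝ) • iteratedFDeriv ℝ n (fun z => fderiv ℝ G z) x (fun _ => y - x)) y := by
  induction n with
  | zero =>
    intro F _ _ G x _ y
    simpa using hasFDerivAt_iteratedFDeriv_diag_one (G := G) (x := x) y
  | succ n ih =>
    intro F _ _ G x hG y
    exact hasFDerivAt_iteratedFDeriv_diag_step hG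
      (ih (hG.fderiv_right (m := (n + 1 : ℕ)) (by norm_cast))) y

section Calculus

variable {E : Type u} [NormedAddCommGroup E] [NormedSpace ℝ E]
  {F : Type v} [NormedAddCommGroup F] [NormedSpace ℝ F]

theorem hasFDerivAt_vtaylor_of {p : ℕ} {G : E → F} {x : E}
    (h : ∀ n ≤ p, ∀ y, HasFDerivAt (fun y => iteratedFDeriv ℝ (n + 1) G x (fun _ => y - x))
      ((n + 1 : ℝ) • iteratedFDeriv ℝ n (fun z => fderiv ℝ G z) x (fun _ => y - x)) y) (y : E) :
    HasFDerivAt (vtaylor (p + 1) G x) (vtaylor p (fun z => fderiv ℝ G z) x y) y := by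
  have e : vtaylor (p + 1) G x = fun y => (∑ i ∈ Finset.range (p + 1),
      (1 / ((i + 1)! : ℝ)) • iteratedFDeriv ℝ (i + 1) G x (fun _ => y - x)) + G x := by
    funext y
    simp [vtaylor, Finset.sum_range_succ' _ (p + 1)]
  rw [e]
  refine HasFDerivAt.add_const (G x) ?_
  refine HasFDerivAt.fun_sum fun i hi => ?_
  have hi' : i ≤ p := by simpa [Nat.lt_succ_iff] using hi
  refine ((h i hi' y).const_smul (1 / ((i + 1)! : ℝ))).congr_fderiv ?_
  rw [smul_smul]
  congr 1
  rw [Nat.factorial_succ]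
  push_cast
  field_simp

theorem vtaylor_self (p : ℕ) (G : E → F) (x : E) : vtaylor p G x x = G x := by
  rw [vtaylor, Finset.sum_range_succ']
  have : ∀ i ∈ Finset.range p, (1 / ((i + 1)! : ℝ)) •
      iteratedFDeriv ℝ (i + 1) G x (fun _ => x - x) = 0 := by
    intro i _
    rw [sub_self, ContinuousMultilinearMap.map_coord_zero _ (0 : Fin (i + 1)) rfl, smul_zero]
  rw [Finset.sum_eq_zero this]
  simp

/-- Integration of a bound on the derivative along segments from `x`. -/
theorem norm_le_of_norm_fderiv_le {U : Set E} (hU : Convex ℝ U) {R : E → F} {R' : E → E →L[ℝ] F}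
    {x : E} (hx : x ∈ U) (hR : ∀ y ∈ U, HasFDerivAt R (R' y) y) (hRx : R x = 0) {C : ℝ} {n : ℕ}
    (hb : ∀ y ∈ U, ‖R' y‖ ≤ C * ‖y - x‖ ^ n) {y : E} (hy : y ∈ U) :
    ‖R y‖ ≤ C / (n + 1) * ‖y - x‖ ^ (n + 1) := by
  have hmem : ∀ t ∈ Set.Icc (0 : ℝ) 1, x + t • (y - x) ∈ U := fun t ht =>
    hU.add_smul_sub_mem hx hy ht
  have hd : ∀ t ∈ Set.Icc (0 : ℝ) 1,
      HasDerivAt (fun t : ℝ => R (x + t • (y - x))) (R' (x + t • (y - x)) (y - x)) t := by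
    intro t ht
    have h1 : HasDerivAt (fun t : ℝ => x + t • (y - x)) (y - x) t := by
      simpa using ((hasDerivAt_id t).smul_const (y - x)).const_add x
    exact (hR _ (hmem t ht)).comp_hasDerivAt t h1
  have hB : ∀ t : ℝ, HasDerivAt (fun t : ℝ => C / (n + 1) * ‖y - x‖ ^ (n + 1) * t ^ (n + 1))
      (C * ‖y - x‖ ^ (n + 1) * t ^ n) t := by
    intro t
    refine ((hasDerivAt_pow (n + 1) t).const_mul (C / (n + 1) * ‖y - x‖ ^ (n + 1))).congr_deriv ?_
    push_cast
    field_simp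
  have := image_norm_le_of_norm_deriv_right_le_deriv_boundary
    (f := fun t : ℝ => R (x + t • (y - x))) (a := 0) (b := 1)
    (fun t ht => (hd t ht).continuousAt.continuousWithinAt)
    (fun t ht => (hd t ⟨ht.1, ht.2.le⟩).hasDerivWithinAt)
    (by simp [hRx]) hB (fun t ht => by
      refine (ContinuousLinearMap.le_opNorm _ _).trans ?_
      have h2 := hb _ (hmem t ⟨ht.1, ht.2.le⟩)
      rw [add_sub_cancel_left, norm_smul, Real.norm_of_nonneg ht.1] at h2
      calc _ ≤ C * (t * ‖y - x‖) ^ n * ‖y - x‖ := by gcongr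
        _ = _ := by ring)
    (x := 1) ⟨zero_le_one, le_rfl⟩
  simpa using this

/-- A Lipschitz bound for the `p + 1`-st derivative, read as one for the `p`-th derivative of the
derivative. -/
theorem lipschitz_iteratedFDeriv_fderiv {U : Set E} {L : ℝ} {p : ℕ} {g : E → F}
    (hL : ∀ x ∈ U, ∀ y ∈ U,
      ‖iteratedFDeriv ℝ (p + 1) g x - iteratedFDeriv ℝ (p + 1) g y‖ ≤ L * ‖x - y‖) :
    ∀ x ∈ U, ∀ y ∈ U, ‖iteratedFDeriv ℝ p (fun z => fderiv ℝ g z) x -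
        iteratedFDeriv ℝ p (fun z => fderiv ℝ g z) y‖ ≤ L * ‖x - y‖ := by
  intro x hx y hy
  have h := hL x hx y hy
  have e : iteratedFDeriv ℝ (p + 1) g x - iteratedFDeriv ℝ (p + 1) g y =
      (continuousMultilinearCurryRightEquiv' ℝ p E F).symm
        (iteratedFDeriv ℝ p (fun z => fderiv ℝ g z) x -
          iteratedFDeriv ℝ p (fun z => fderiv ℝ g z) y) := by
    rw [LinearIsometryEquiv.map_sub, iteratedFDeriv_succ_eq_comp_right,
      iteratedFDeriv_succ_eq_comp_right]
    rfl
  rwa [e, LinearIsometryEquiv.norm_map] at h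

end Calculus

/-- Taylor's inequality for functions with Lipschitz `p`-th derivative. -/
theorem norm_sub_vtaylor_le {E : Type u} [NormedAddCommGroup E] [NormedSpace ℝ E] {U : Set E}
    (hUo : IsOpen U) (hU : Convex ℝ U) (L : ℝ) (p : ℕ) :
    ∀ {F : Type u} [NormedAddCommGroup F] [NormedSpace ℝ F] {G : E → F},
    ContDiffOn ℝ p G U →
    (∀ x ∈ U, ∀ y ∈ U, ‖iteratedFDeriv ℝ p G x - iteratedFDeriv ℝ p G y‖ ≤ L * ‖x - y‖) →
    ∀ x ∈ U, ∀ y ∈ U, ‖G y - vtaylor p G x y‖ ≤ L / ((p + 1)! : ℝ) * ‖y - x‖ ^ (p + 1) := by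
  induction p with
  | zero =>
    intro F _ _ G _ hL x hx y hy
    have h := hL y hy x hx
    have e : iteratedFDeriv ℝ 0 G y - iteratedFDeriv ℝ 0 G x =
      (continuousMultilinearCurryFin0 ℝ E F).symm (G y - G x) := by
      rw [map_sub]; rfl
    rw [e, LinearIsometryEquiv.norm_map] at h
    simpa [vtaylor] using h
  | succ p ih =>
    intro F _ _ G hG hL x hx y hy
    have hat : ∀ z ∈ U, ContDiffAt ℝ (p + 1 : ℕ) G z := fun z hz =>
      hG.contDiffAt (hUo.mem_nhds hz)
    have hG' : ContDiffOn ℝ p (fun z => fderiv ℝ G z) U := fun z hz =>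
      ((hat z hz).fderiv_right (m := p) (by norm_cast)).contDiffWithinAt
    -- Induction is applied to the derivative of G; the resulting bound is then integrated along
    -- segments from x.
    have h1 := ih hG' (lipschitz_iteratedFDeriv_fderiv hL) x hx
    have h2 : ∀ y, HasFDerivAt (vtaylor (p + 1) G x) (vtaylor p (fun z => fderiv ℝ G z) x y) y :=
      hasFDerivAt_vtaylor_of fun n hn y =>
        hasFDerivAt_iteratedFDeriv_diag_aux n ((hat x hx).of_le (by norm_cast; omega)) y
    have h3 := norm_le_of_norm_fderiv_le hU (R := fun y => G y - vtaylor (p + 1) G x y) hx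
      (fun y hy => (((hat y hy).differentiableAt (by norm_cast)).hasFDerivAt).sub (h2 y))
      (by simp [vtaylor_self]) h1 hy
    refine h3.trans (le_of_eq ?_)
    rw [Nat.factorial_succ (p + 1)]
    push_cast
    rw [div_div, mul_comm ((p : ℝ) + 1 + 1)]

/-! ### Taylor's inequalities for real functions and their first two derivatives. -/

section Scalar

variable {E : Type u} [NormedAddCommGroup E] [NormedSpace ℝ E]

/-- The derivative of a Taylor polynomial. -/
theorem hasFDerivAt_vtaylor_real {p : ℕ} {g : E → ℝ} {x : E}
    (hg : ContDiffAt ℝ (p + 1 : ℕ) g x) (y : E) :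
    HasFDerivAt (vtaylor (p + 1) g x) (vtaylor p (fun z => fderiv ℝ g z) x y) y := by
  refine hasFDerivAt_vtaylor_of (fun n hn y => ?_) y
  have h : ContDiffAt ℝ (n + 1 : ℕ) g x := hg.of_le (by norm_cast; omega)
  cases n with
  | zero => simpa using hasFDerivAt_iteratedFDeriv_diag_one (G := g) (x := x) y
  | succ n =>
    exact hasFDerivAt_iteratedFDeriv_diag_step h
      (hasFDerivAt_iteratedFDeriv_diag_aux n (h.fderiv_right (m := (n + 1 : ℕ)) (by norm_cast))) y

variable {U : Set E} (hUo : IsOpen U) (hU : Convex ℝ U) {L : ℝ} {p : ℕ} {g : E → ℝ}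
  (hg : ContDiffOn ℝ (p + 1 : ℕ) g U)
  (hL : ∀ x ∈ U, ∀ y ∈ U,
    ‖iteratedFDeriv ℝ (p + 1) g x - iteratedFDeriv ℝ (p + 1) g y‖ ≤ L * ‖x - y‖)
include hUo hU hg hL

/-- Taylor's inequality for the gradient. -/
theorem norm_fderiv_sub_vtaylor_le {x y : E} (hx : x ∈ U) (hy : y ∈ U) :
    ‖fderiv ℝ g y - vtaylor p (fun z => fderiv ℝ g z) x y‖ ≤
      L / ((p + 1)! : ℝ) * ‖y - x‖ ^ (p + 1) :=
  norm_sub_vtaylor_le hUo hU L p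
    (fun z hz => ((hg.contDiffAt (hUo.mem_nhds hz)).fderiv_right (m := p)
      (by norm_cast)).contDiffWithinAt)
    (lipschitz_iteratedFDeriv_fderiv hL) x hx y hy

/-- Taylor's inequality for function values. -/
theorem abs_sub_vtaylor_le {x y : E} (hx : x ∈ U) (hy : y ∈ U) :
    |g y - vtaylor (p + 1) g x y| ≤ L / ((p + 2)! : ℝ) * ‖y - x‖ ^ (p + 2) := by
  have hat : ∀ z ∈ U, ContDiffAt ℝ (p + 1 : ℕ) g z := fun z hz => hg.contDiffAt (hUo.mem_nhds hz)
  have h3 := norm_le_of_norm_fderiv_le hU (R := fun y => g y - vtaylor (p + 1) g x y) hx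
    (fun y hy => (((hat y hy).differentiableAt (by norm_cast)).hasFDerivAt).sub
      (hasFDerivAt_vtaylor_real (hat x hx) y))
    (by simp [vtaylor_self])
    (fun y hy => norm_fderiv_sub_vtaylor_le hUo hU hg hL hx hy) hy
  refine h3.trans (le_of_eq ?_)
  rw [Nat.factorial_succ (p + 1)]
  push_cast
  rw [div_div, mul_comm ((p : ℝ) + 1 + 1)]

end Scalar

/-- Taylor's inequality for the Hessian. -/
theorem norm_fderiv_fderiv_sub_vtaylor_le {E : Type u} [NormedAddCommGroup E] [NormedSpace ℝ E]
    {U : Set E} (hUo : IsOpen U) (hU : Convex ℝ U) {L : ℝ} {p : ℕ} {g : E → ℝ}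
    (hg : ContDiffOn ℝ (p + 2 : ℕ) g U)
    (hL : ∀ x ∈ U, ∀ y ∈ U,
      ‖iteratedFDeriv ℝ (p + 2) g x - iteratedFDeriv ℝ (p + 2) g y‖ ≤ L * ‖x - y‖)
    {x : E} (hx : x ∈ U) :
    ∃ H : E → E →L[ℝ] E →L[ℝ] ℝ,
      (∀ y ∈ U, HasFDerivAt
        (fun y => fderiv ℝ g y - vtaylor (p + 1) (fun z => fderiv ℝ g z) x y) (H y) y) ∧
      ∀ y ∈ U, ‖H y‖ ≤ L / ((p + 1)! : ℝ) * ‖y - x‖ ^ (p + 1) := by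
  have hat : ∀ z ∈ U, ContDiffAt ℝ (p + 1 : ℕ) (fun z => fderiv ℝ g z) z := fun z hz =>
    (hg.contDiffAt (hUo.mem_nhds hz)).fderiv_right (m := (p + 1 : ℕ)) (by norm_cast)
  have hat2 : ∀ z ∈ U, ContDiffAt ℝ p (fun y => fderiv ℝ (fun z => fderiv ℝ g z) y) z :=
    fun z hz => (hat z hz).fderiv_right (m := p) (by norm_cast)
  refine ⟨fun y => fderiv ℝ (fun z => fderiv ℝ g z) y -
    vtaylor p (fun y => fderiv ℝ (fun z => fderiv ℝ g z) y) x y, fun y hy => ?_, fun y hy => ?_⟩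
  · exact ((hat y hy).differentiableAt (by norm_cast)).hasFDerivAt.sub
      (hasFDerivAt_vtaylor_of (fun n hn y =>
        hasFDerivAt_iteratedFDeriv_diag_aux n ((hat x hx).of_le (by norm_cast; omega)) y) y)
  · refine norm_sub_vtaylor_le hUo hU L p (fun z hz => (hat2 z hz).contDiffWithinAt)
      (lipschitz_iteratedFDeriv_fderiv (lipschitz_iteratedFDeriv_fderiv hL)) x hx y hy

/-! ### Convexity and optimality along segments. -/

section Segment

variable {E : Type*} [NormedAddCommGroup E] [NormedSpace ℝ E]

/-- First-order optimality condition for a sum of a differentiable and a convex function. -/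
theorem le_of_isMin_add_convex {D : Set E} {ψ q : E → ℝ} {q' : E →L[ℝ] ℝ} {T : E}
    (hψ : ConvexOn ℝ D ψ) (hT : T ∈ D) (hq : HasFDerivAt q q' T)
    (hmin : ∀ y ∈ D, q T + ψ T ≤ q y + ψ y) {y : E} (hy : y ∈ D) :
    ψ T - q' (y - T) ≤ ψ y := by
  have h1 : HasDerivAt (fun t : ℝ => T + t • (y - T)) (y - T) 0 := by
    simpa using ((hasDerivAt_id (0 : ℝ)).smul_const (y - T)).const_add T
  -- On the segment ψ is replaced by its chord, which dominates it and agrees with it at T, so ψ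
  -- needs no derivative.
  have h2 : HasDerivAt (fun t : ℝ => q (T + t • (y - T)) + t * (ψ y - ψ T))
      (q' (y - T) + (ψ y - ψ T)) 0 := by
    have hq0 : HasFDerivAt q q' (T + (0 : ℝ) • (y - T)) := by simpa using hq
    exact ((hq0.comp_hasDerivAt 0 h1).add ((hasDerivAt_id (0 : ℝ)).mul_const
      (ψ y - ψ T))).congr_deriv (by simp)
  have h3 := h2.tendsto_slope_zero_right
  have h4 : 0 ≤ q' (y - T) + (ψ y - ψ T) := by
    refine ge_of_tendsto h3 ?_
    have : Set.Ioo (0 : ℝ) 1 ∈ nhdsWithin (0 : ℝ) (Set.Ioi 0) := Ioo_mem_nhdsGT one_pos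
    filter_upwards [this] with t ht
    have hm := hmin _ (hψ.1.add_smul_sub_mem hT hy ⟨ht.1.le, ht.2.le⟩)
    have hc := hψ.2 hT hy (sub_nonneg.2 ht.2.le) ht.1.le (by ring)
    have e : (1 - t) • T + t • y = T + t • (y - T) := by module
    rw [e] at hc
    simp only [smul_eq_mul] at hc
    have hpos : 0 ≤ t⁻¹ := inv_nonneg.2 ht.1.le
    simp only [zero_add, zero_smul, add_zero, zero_mul, smul_eq_mul]
    exact mul_nonneg hpos (by nlinarith)
  linarith

/-- The gradient inequality for convex functions. -/
theorem add_fderiv_le_of_convexOn {U : Set E} {g : E → ℝ} {g' : E →L[ℝ] ℝ} {x y : E}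
    (hg : ConvexOn ℝ U g) (hx : x ∈ U) (hg' : HasFDerivAt g g' x) (hy : y ∈ U) :
    g x + g' (y - x) ≤ g y := by
  -- With q = −g and ψ = g the sum vanishes identically, so every point is a minimizer.
  have := le_of_isMin_add_convex (q := fun z => -g z) hg hx hg'.neg (by simp) hy
  rw [neg_apply] at this
  linarith

/-- Integration of a lower bound for the increments of the derivative along a segment. -/
theorem add_fderiv_add_le_of_segment {q : E → ℝ} {q' : E → E →L[ℝ] ℝ} {x w : E}
    (hq : ∀ t ∈ Set.Icc (0 : ℝ) 1, HasFDerivAt q (q' (x + t • w)) (x + t • w)) {κ : ℝ} {n : ℕ}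
    (hb : ∀ t ∈ Set.Ioo (0 : ℝ) 1, κ * t ^ n ≤ q' (x + t • w) w - q' x w) :
    q x + q' x w + κ / (n + 1) ≤ q (x + w) := by
  have hd : ∀ t ∈ Set.Icc (0 : ℝ) 1, HasDerivAt
      (fun t : ℝ => q (x + t • w) - t * q' x w - κ / (n + 1) * t ^ (n + 1))
      (q' (x + t • w) w - q' x w - κ * t ^ n) t := by
    intro t ht
    have h1 : HasDerivAt (fun t : ℝ => x + t • w) w t := by
      simpa using ((hasDerivAt_id t).smul_const w).const_add x
    have h2 := (hasDerivAt_pow (n + 1) t).const_mul (κ / (n + 1))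
    have h3 := (((hq t ht).comp_hasDerivAt t h1).sub
      ((hasDerivAt_id t).mul_const (q' x w))).sub h2
    refine h3.congr_deriv ?_
    push_cast
    field_simp
  have hmono := monotoneOn_of_deriv_nonneg (convex_Icc (0 : ℝ) 1)
    (fun t ht => (hd t ht).continuousAt.continuousWithinAt)
    (fun t ht => (hd t (interior_subset ht)).differentiableAt.differentiableWithinAt)
    (fun t ht => by
      rw [(hd t (interior_subset ht)).deriv]
      rw [interior_Icc] at ht
      linarith [hb t ht])
  have := hmono (Set.left_mem_Icc.2 zero_le_one) (Set.right_mem_Icc.2 zero_le_one) zero_le_one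
  simp at this
  linarith

end Segment

/-! ### Powers of the Euclidean norm and their Bregman divergence. -/

section NormPow

variable {E : Type*} [NormedAddCommGroup E] [InnerProductSpace ℝ E]

theorem hasFDerivAt_prox {p : ℕ} (hp : 1 ≤ p) (x₀ x : E) :
    HasFDerivAt (prox p x₀) (‖x - x₀‖ ^ (p - 1) • innerSL ℝ (x - x₀)) x := by
  have h1 : (1 : ℝ) < ((p + 1 : ℕ) : ℝ) := by norm_cast; omega
  have h2 := ((hasFDerivAt_norm_rpow (x - x₀) h1).comp x
    ((hasFDerivAt_id x).sub_const x₀)).mul_const (((p : ℝ) + 1)⁻¹)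
  have e : prox p x₀ = fun x => ‖x - x₀‖ ^ ((p + 1 : ℕ) : ℝ) * ((p : ℝ) + 1)⁻¹ := by
    funext y
    rw [prox, Real.rpow_natCast, div_eq_mul_inv]
  rw [e]
  refine h2.congr_fderiv ?_
  have e2 : ((p + 1 : ℕ) : ℝ) - 2 = ((p - 1 : ℕ) : ℝ) := by
    push_cast [Nat.cast_sub hp]; ring
  rw [e2, Real.rpow_natCast]
  ext v
  simp
  field_simp

/-- The two sides differ by half of (‖a‖^m − ‖b‖^m)(‖a‖² − ‖b‖²), whose factors have the same sign.
-/
theorem inner_norm_pow_smul_sub_ge (m : ℕ) (a b : E) :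
    (‖a‖ ^ m + ‖b‖ ^ m) / 2 * ‖a - b‖ ^ 2 ≤
      ‖a‖ ^ m * inner ℝ a (a - b) - ‖b‖ ^ m * inner ℝ b (a - b) := by
  have h1 : 0 ≤ (‖a‖ ^ m - ‖b‖ ^ m) * (‖a‖ ^ 2 - ‖b‖ ^ 2) := by
    rcases le_total ‖a‖ ‖b‖ with h | h
    · exact mul_nonneg_of_nonpos_of_nonpos (sub_nonpos.2 (by gcongr)) (sub_nonpos.2 (by gcongr))
    · exact mul_nonneg (sub_nonneg.2 (by gcongr)) (sub_nonneg.2 (by gcongr))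
  rw [@norm_sub_sq_real, inner_sub_right, inner_sub_right, real_inner_self_eq_norm_sq,
    real_inner_self_eq_norm_sq, real_inner_comm a b]
  nlinarith

omit [InnerProductSpace ℝ E] in
theorem norm_sub_pow_le_mean (m : ℕ) (a b : E) :
    ‖a - b‖ ^ m / 2 ^ m ≤ (‖a‖ ^ m + ‖b‖ ^ m) / 2 := by
  rcases m.eq_zero_or_pos with rfl | hm
  · norm_num
  have h1 : ‖a - b‖ ^ m ≤ (‖a‖ + ‖b‖) ^ m := by
    gcongr; exact norm_sub_le a b
  have h2 := add_pow_le (norm_nonneg a) (norm_nonneg b) m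
  rw [div_le_div_iff₀ (by positivity) two_pos]
  obtain ⟨n, rfl⟩ : ∃ n, m = n + 1 := ⟨m - 1, by omega⟩
  rw [Nat.add_sub_cancel] at h2
  calc _ ≤ 2 ^ n * (‖a‖ ^ (n + 1) + ‖b‖ ^ (n + 1)) * 2 := by gcongr; exact h1.trans h2
    _ = _ := by ring

/-- Uniform convexity of powers of the Euclidean norm. -/
theorem norm_pow_le_bregman_prox {p : ℕ} (hp : 1 ≤ p) (x₀ x y : E) :
    ‖y - x‖ ^ (p + 1) / (2 ^ (p - 1) * (p + 1)) ≤ bregman (prox p x₀) x y := by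
  obtain ⟨m, rfl⟩ : ∃ m, p = m + 1 := ⟨p - 1, by omega⟩
  -- The gradient increment at time t in direction y − x is at least κ t^(m+1); integration yields
  -- the factor 1/(m+2) = 1/(p+1).
  have h := add_fderiv_add_le_of_segment (q := prox (m + 1) x₀)
    (q' := fun z => ‖z - x₀‖ ^ m • innerSL ℝ (z - x₀)) (x := x) (w := y - x)
    (κ := ‖y - x‖ ^ (m + 2) / 2 ^ m) (n := m + 1) (fun t _ => hasFDerivAt_prox hp x₀ _) (by
      intro t ht
      set a := x + t • (y - x) - x₀
      set b := x - x₀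
      have hab : a - b = t • (y - x) := by simp only [a, b]; abel
      have h1 := inner_norm_pow_smul_sub_ge m a b
      have h2 := norm_sub_pow_le_mean m a b
      rw [hab, norm_smul, Real.norm_of_nonneg ht.1.le] at h1 h2
      simp only [inner_smul_right] at h1
      have h3 : (t * ‖y - x‖) ^ m / 2 ^ m * (t * ‖y - x‖) ^ 2 ≤
        t * (‖a‖ ^ m * inner ℝ a (y - x) - ‖b‖ ^ m * inner ℝ b (y - x)) := by
        calc _ ≤ (‖a‖ ^ m + ‖b‖ ^ m) / 2 * (t * ‖y - x‖) ^ 2 := by gcongr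
          _ ≤ _ := h1.trans (le_of_eq (by ring))
      simp only [smul_apply, innerSL_apply_apply, smul_eq_mul]
      refine le_of_mul_le_mul_left (le_trans (le_of_eq ?_) h3) ht.1
      ring)
  rw [bregman, (hasFDerivAt_prox hp x₀ x).fderiv]
  have e : x + (y - x) = y := by abel
  rw [e] at h
  have e2 : ‖y - x‖ ^ (m + 2) / 2 ^ m / (((m + 1 : ℕ) : ℝ) + 1) =
    ‖y - x‖ ^ (m + 1 + 1) / (2 ^ (m + 1 - 1) * (((m + 1 : ℕ) : ℝ) + 1)) := by
    rw [div_div, Nat.add_sub_cancel]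
  rw [← e2, Nat.add_sub_cancel]
  linarith

/-- Three-point identity: it moves the centre of the prox term from v to the new point T. -/
theorem bregman_add_bregman (d : E → ℝ) (v T y : E) :
    bregman d v y = bregman d v T + (fderiv ℝ d T - fderiv ℝ d v) (y - T) + bregman d T y := by
  have : y - v = (y - T) + (T - v) := by abel
  simp only [bregman, this, map_add, sub_apply]
  ring

theorem bregman_prox_nonneg {p : ℕ} (hp : 1 ≤ p) (x₀ x y : E) :
    0 ≤ bregman (prox p x₀) x y :=
  le_trans (by positivity) (norm_pow_le_bregman_prox hp x₀ x y)

theorem hasFDerivAt_bregman {d : E → ℝ} {T : E} (hd : DifferentiableAt ℝ d T) (v : E) :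
    HasFDerivAt (bregman d v) (fderiv ℝ d T - fderiv ℝ d v) T := by
  have h := (hd.hasFDerivAt.sub_const (d v)).sub
    ((fderiv ℝ d v).hasFDerivAt.comp T ((hasFDerivAt_id T).sub_const v))
  exact h

/-- The derivative is the Hessian of ‖·‖^(m+2)/(m+2) in direction w. Away from 0 it is ‖u‖^m ‖w‖²
plus a nonnegative rank-one term, which is dropped. -/
theorem exists_hasDerivAt_norm_pow_mul_inner {m : ℕ} (hm : 1 ≤ m) (a w : E) (t : ℝ) :
    ∃ N : ℝ, HasDerivAt (fun t : ℝ => ‖a + t • w‖ ^ m * inner ℝ (a + t • w) w) N t ∧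
      ‖a + t • w‖ ^ m * ‖w‖ ^ 2 ≤ N := by
  obtain ⟨n, rfl⟩ : ∃ n, m = n + 1 := ⟨m - 1, by omega⟩
  have h1 : HasDerivAt (fun t : ℝ => a + t • w) w t := by
    simpa using ((hasDerivAt_id t).smul_const w).const_add a
  by_cases hc : a + t • w = 0
  -- If the line passes through 0 at time t, the function is a constant times |s − t|^m (s − t),
  -- with derivative 0 there.
  · refine ⟨0, ?_, by simp [hc]⟩
    have e : (fun s : ℝ => ‖a + s • w‖ ^ (n + 1) * inner ℝ (a + s • w) w) = fun s =>
        (|s - t| ^ (n + 1) * (s - t)) * ‖w‖ ^ (n + 3) := by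
      funext s
      have : a + s • w = (s - t) • w := by
        rw [sub_smul, eq_neg_of_add_eq_zero_left hc]; abel
      rw [this, norm_smul, Real.norm_eq_abs, inner_smul_left, real_inner_self_eq_norm_sq]
      simp
      ring
    rw [e]
    rw [hasDerivAt_iff_tendsto_slope]
    have hlim : Filter.Tendsto (fun s : ℝ => |s - t| ^ (n + 1) * ‖w‖ ^ (n + 3))
        (nhdsWithin t {t}ᶜ) (nhds 0) := by
      have hcont : Continuous (fun s : ℝ => |s - t| ^ (n + 1) * ‖w‖ ^ (n + 3)) := by fun_prop
      have := hcont.tendsto t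
      simp at this
      exact this.mono_left nhdsWithin_le_nhds
    refine hlim.congr' ?_
    filter_upwards [self_mem_nhdsWithin] with s hs
    have hs' : s - t ≠ 0 := sub_ne_zero.2 hs
    rw [slope_def_field]
    simp
    field_simp
  · have hpos : 0 < ‖a + t • w‖ := norm_pos_iff.2 hc
    have h2 : HasDerivAt (fun t : ℝ => ‖a + t • w‖) (inner ℝ (a + t • w) w / ‖a + t • w‖) t := by
      have h3 := (h1.norm_sq.sqrt (by positivity))
      simp only [Real.sqrt_sq (norm_nonneg _)] at h3
      refine h3.congr_deriv ?_
      field_simp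
    have h4 := (h2.pow (n + 1)).mul (h1.inner ℝ (hasDerivAt_const t w))
    refine ⟨_, h4, ?_⟩
    simp only [inner_zero_right, real_inner_self_eq_norm_sq, zero_add, Nat.add_sub_cancel, Pi.pow_apply]
    have : 0 ≤ ((n + 1 : ℕ) : ℝ) * ‖a + t • w‖ ^ n * (inner ℝ (a + t • w) w / ‖a + t • w‖) *
      inner ℝ (a + t • w) w := by
      have e : ((n + 1 : ℕ) : ℝ) * ‖a + t • w‖ ^ n * (inner ℝ (a + t • w) w / ‖a + t • w‖) *
        inner ℝ (a + t • w) w =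
        ((n + 1 : ℕ) : ℝ) * ‖a + t • w‖ ^ n * ((inner ℝ (a + t • w) w) ^ 2 / ‖a + t • w‖) := by ring
      rw [e]
      positivity
    linarith

end NormPow

/-- The weighted arithmetic-geometric mean inequality with natural weights. -/
theorem add_mul_pow_mul_pow_le (a b : ℕ) {x y : ℝ} (hx : 0 ≤ x) (hy : 0 ≤ y) :
    ((a : ℝ) + b) * (x ^ a * y ^ b) ≤ a * x ^ (a + b) + b * y ^ (a + b) := by
  rcases Nat.eq_zero_or_pos (a + b) with h | h
  · obtain ⟨rfl, rfl⟩ : a = 0 ∧ b = 0 := by omega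
    simp
  have hpos : (0 : ℝ) < (a : ℝ) + b := by exact_mod_cast h
  have key := Real.geom_mean_le_arith_mean2_weighted (w₁ := a / ((a : ℝ) + b))
    (w₂ := b / ((a : ℝ) + b)) (by positivity) (by positivity) (pow_nonneg hx (a + b))
    (pow_nonneg hy (a + b)) (by field_simp)
  have e : ∀ (c : ℕ) {z : ℝ}, 0 ≤ z → (z ^ (a + b)) ^ ((c : ℝ) / ((a : ℝ) + b)) = z ^ c := by
    intro c z hz
    rw [← Real.rpow_natCast, ← Real.rpow_mul hz, ← Real.rpow_natCast]
    congr 1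
    push_cast
    field_simp
  rw [e a hx, e b hy] at key
  calc _ ≤ ((a : ℝ) + b) * (a / ((a : ℝ) + b) * x ^ (a + b) + b / ((a : ℝ) + b) * y ^ (a + b)) := by
        gcongr
    _ = _ := by field_simp

/-! ### Convexity of the regularized Taylor model. -/

section Model

variable {E : Type u} [NormedAddCommGroup E] [InnerProductSpace ℝ E]

theorem taylor_eq_vtaylor (p : ℕ) (g : E → ℝ) (x : E) : taylor p g x = vtaylor p g x := rfl

/-- The differentiable part of the objective of a tensor step. -/
def modelSmooth (p : ℕ) (M : ℝ) (g : E → ℝ) (x y : E) : ℝ :=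
  taylor p g x y + M / ((p + 1)! : ℝ) * ‖y - x‖ ^ (p + 1)

/-- The gradient of `modelSmooth`. -/
def modelGrad (p : ℕ) (M : ℝ) (g : E → ℝ) (x T : E) : E →L[ℝ] ℝ :=
  fderiv ℝ (taylor p g x) T + (M / (p ! : ℝ) * ‖T - x‖ ^ (p - 1)) • innerSL ℝ (T - x)

theorem stepGrad_eq (p : ℕ) (M : ℝ) (g : E → ℝ) (x T : E) :
    stepGrad p M g x T = fderiv ℝ g T - modelGrad p M g x T := by
  rw [stepGrad, modelGrad, sub_sub]

theorem modelSmooth_eq (p : ℕ) (M : ℝ) (g : E → ℝ) (x : E) :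
    modelSmooth p M g x = fun y => taylor p g x y + M / (p ! : ℝ) * prox p x y := by
  funext y
  rw [modelSmooth, prox, Nat.factorial_succ]
  push_cast
  field_simp

variable {p : ℕ} {g : E → ℝ} {x : E}

theorem differentiable_taylor (hp : 1 ≤ p) (hg : ContDiffAt ℝ p g x) (T : E) :
    HasFDerivAt (taylor p g x) (fderiv ℝ (taylor p g x) T) T := by
  obtain ⟨m, rfl⟩ : ∃ m, p = m + 1 := ⟨p - 1, by omega⟩
  rw [taylor_eq_vtaylor]
  exact (hasFDerivAt_vtaylor_real hg T).differentiableAt.hasFDerivAt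

theorem hasFDerivAt_modelSmooth (hp : 1 ≤ p) (hg : ContDiffAt ℝ p g x) (M : ℝ) (T : E) :
    HasFDerivAt (modelSmooth p M g x) (modelGrad p M g x T) T := by
  rw [modelSmooth_eq]
  refine ((differentiable_taylor hp hg T).add ((hasFDerivAt_prox hp x T).const_mul
    (M / (p ! : ℝ)))).congr_fderiv ?_
  rw [modelGrad, smul_smul]

/-- The derivative in t is at least K ‖·‖^(n+1) ‖w‖² − H(w, w), which the bound on ‖H‖ makes
nonnegative: the Hessian of the regularizer dominates the Hessian error. -/
theorem monotoneOn_sub_of_norm_le {R : E → E →L[ℝ] ℝ} {H : E → E →L[ℝ] E →L[ℝ] ℝ} {T x w : E}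
    (hR : ∀ t ∈ Set.Icc (0 : ℝ) 1, HasFDerivAt R (H (T + t • w)) (T + t • w)) {K : ℝ} {n : ℕ} (hK : 0 ≤ K)
    (hH : ∀ t ∈ Set.Icc (0 : ℝ) 1, ‖H (T + t • w)‖ ≤ K * ‖T + t • w - x‖ ^ (n + 1)) :
    MonotoneOn (fun t : ℝ => K * (‖(T - x) + t • w‖ ^ (n + 1) * inner ℝ ((T - x) + t • w) w) -
      R (T + t • w) w) (Set.Icc 0 1) := by
  have hd : ∀ t ∈ Set.Icc (0 : ℝ) 1, ∃ N : ℝ, 0 ≤ N ∧ HasDerivAt (fun t : ℝ =>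
      K * (‖(T - x) + t • w‖ ^ (n + 1) * inner ℝ ((T - x) + t • w) w) - R (T + t • w) w) N t := by
    intro t ht
    obtain ⟨N, hN, hNb⟩ := exists_hasDerivAt_norm_pow_mul_inner (m := n + 1) (by omega) (T - x) w t
    have h2 : HasDerivAt (fun t : ℝ => T + t • w) w t := by
      simpa using ((hasDerivAt_id t).smul_const w).const_add T
    have h3 : HasDerivAt (fun t : ℝ => R (T + t • w)) (H (T + t • w) w) t :=
      (hR t ht).comp_hasDerivAt t h2
    have h4 : HasDerivAt (fun t : ℝ => R (T + t • w) w) (H (T + t • w) w w) t := by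
      simpa using h3.clm_apply (hasDerivAt_const t w)
    refine ⟨_, ?_, (hN.const_mul K).sub h4⟩
    have h5 : H (T + t • w) w w ≤ K * ‖T + t • w - x‖ ^ (n + 1) * ‖w‖ * ‖w‖ := by
      refine (le_abs_self _).trans (((H (T + t • w)).le_opNorm₂ w w).trans ?_)
      have := hH t ht
      gcongr
    have h6 : T - x + t • w = T + t • w - x := by abel
    rw [h6] at hNb
    nlinarith [mul_le_mul_of_nonneg_left hNb hK]
  choose! N hN using hd
  refine monotoneOn_of_deriv_nonneg (convex_Icc (0 : ℝ) 1)
    (fun t ht => (hN t ht).2.continuousAt.continuousWithinAt)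
    (fun t ht => (hN t (interior_subset ht)).2.differentiableAt.differentiableWithinAt)
    (fun t ht => ?_)
  rw [(hN t (interior_subset ht)).2.deriv]
  exact (hN t (interior_subset ht)).1

/-- For large regularization parameters the smooth part of the model is convex. -/
theorem modelSmooth_add_modelGrad_le {U : Set E} (hp : 1 ≤ p) (hUo : IsOpen U)
    (hgc : ConvexOn ℝ U g) (hg : ContDiffOn ℝ p g U) {L M : ℝ} (hL0 : 0 ≤ L)
    (hL : ∀ x ∈ U, ∀ y ∈ U, ‖iteratedFDeriv ℝ p g x - iteratedFDeriv ℝ p g y‖ ≤ L * ‖x - y‖)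
    (hM : p * L ≤ M) (hx : x ∈ U) {T y : E} (hT : T ∈ U) (hy : y ∈ U) :
    modelSmooth p M g x T + modelGrad p M g x T (y - T) ≤ modelSmooth p M g x y := by
  have hat : ∀ z ∈ U, ContDiffAt ℝ p g z := fun z hz => hg.contDiffAt (hUo.mem_nhds hz)
  have hM0 : 0 ≤ M := le_trans (by positivity) hM
  obtain rfl | ⟨n, rfl⟩ : p = 1 ∨ ∃ n, p = n + 2 := by
    rcases p with _ | _ | n
    · omega
    · exact Or.inl rfl
    · exact Or.inr ⟨n, rfl⟩
  -- For p = 1 the Taylor polynomial is affine, and convexity of the prox term suffices.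
  · have h1 := bregman_prox_nonneg le_rfl x T y
    have h2 := (hasFDerivAt_vtaylor_real (p := 0) (g := g) (hat x hx) T).fderiv
    rw [modelSmooth_eq, modelGrad, taylor_eq_vtaylor, h2]
    rw [bregman, (hasFDerivAt_prox le_rfl x T).fderiv] at h1
    have h3 : 0 ≤ M / (1 ! : ℝ) := by positivity
    have h4 := mul_nonneg h3 h1
    simp [vtaylor, Finset.sum_range_succ] at h4 ⊢
    linarith
  -- The model is g plus a function with monotone gradient along the segment: the Hessian error is
  -- at most L/(p−1)! · ‖z − x‖^(p−1), the regularizer contributes at least M/p! · ‖z − x‖^(p−1),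
  -- and M ≥ pL.
  obtain ⟨H, hH, hHb⟩ := norm_fderiv_fderiv_sub_vtaylor_le hUo hgc.1 hg hL hx
  have h1 := add_fderiv_le_of_convexOn hgc hT
    ((hat T hT).differentiableAt (by norm_cast)).hasFDerivAt hy
  have hmem : ∀ t ∈ Set.Icc (0 : ℝ) 1, T + t • (y - T) ∈ U := fun t ht =>
    hgc.1.add_smul_sub_mem hT hy ht
  have hgrad : ∀ z, modelGrad (n + 2) M g x z =
      vtaylor (n + 1) (fun z => fderiv ℝ g z) x z +
        (M / ((n + 2)! : ℝ) * ‖z - x‖ ^ (n + 1)) • innerSL ℝ (z - x) := by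
    intro z
    rw [modelGrad, taylor_eq_vtaylor, (hasFDerivAt_vtaylor_real (hat x hx) z).fderiv]
    rfl
  set w := y - T with hw
  have hK : L / ((n + 1)! : ℝ) ≤ M / ((n + 2)! : ℝ) := by
    rw [Nat.factorial_succ (n + 1), div_le_div_iff₀ (by positivity) (by positivity)]
    push_cast at hM ⊢
    have : (0 : ℝ) < ((n + 1)! : ℝ) := by positivity
    nlinarith
  have hmono := monotoneOn_sub_of_norm_le (T := T) (x := x) (w := w)
    (R := fun z => fderiv ℝ g z - vtaylor (n + 1) (fun z => fderiv ℝ g z) x z)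
    (fun t ht => hH _ (hmem t ht)) (K := M / ((n + 2)! : ℝ)) (by positivity) (fun t ht => (hHb _ (hmem t ht)).trans
      (mul_le_mul_of_nonneg_right hK (by positivity)))
  have h8 := add_fderiv_add_le_of_segment (q := fun z => modelSmooth (n + 2) M g x z - g z)
    (q' := fun z => modelGrad (n + 2) M g x z - fderiv ℝ g z) (x := T) (w := w) (κ := 0) (n := 0)
    (fun t ht => (hasFDerivAt_modelSmooth hp (hat x hx) M _).sub
      ((hat _ (hmem t ht)).differentiableAt (by norm_cast)).hasFDerivAt)
    (fun t ht => by
      have h9 := hmono (Set.left_mem_Icc.2 zero_le_one) ⟨ht.1.le, ht.2.le⟩ ht.1.le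
      have e : T - x + t • w = T + t • w - x := by abel
      simp only [zero_smul, add_zero, sub_apply, e] at h9
      simp only [hgrad, sub_apply, add_apply, smul_apply, innerSL_apply_apply, smul_eq_mul]
      nlinarith)
  have e : T + w = y := by rw [hw]; abel
  rw [e] at h8
  simp only [sub_apply] at h8
  linarith

end Model

/-! ### Well-conditioned composite problems and a single tensor step. -/

/-- A composite problem `g + phi` over `D` with condition number at least one: the `p`-th derivative
of `g` is `L`-Lipschitz, and `phi` is `s`-uniformly convex of degree `p + 1` at its stationary
points, where `L / p! ≤ s`. -/
structure InnerProblem {E : Type u} [NormedAddCommGroup E] [InnerProductSpace ℝ E]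
    (U D : Set E) (p : ℕ) (L s : ℝ) (g phi : E → ℝ) : Prop where
  one_le : 1 ≤ p
  isOpen : IsOpen U
  convex_g : ConvexOn ℝ U g
  contDiff_g : ContDiffOn ℝ p g U
  L_pos : 0 < L
  lipschitz : ∀ x ∈ U, ∀ y ∈ U,
    ‖iteratedFDeriv ℝ p g x - iteratedFDeriv ℝ p g y‖ ≤ L * ‖x - y‖
  subset : D ⊆ U
  nonempty : D.Nonempty
  convex_phi : ConvexOn ℝ D phi
  -- Subgradients of `phi` occur only as −q', from the optimality of T for q + `phi`.
  uniformly_convex : ∀ (q : E → ℝ) (q' : E →L[ℝ] ℝ) (T : E), T ∈ D → HasFDerivAt q q' T →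
    (∀ y ∈ D, q T + phi T ≤ q y + phi y) →
    ∀ y ∈ D, phi T - q' (y - T) + s * ‖y - T‖ ^ (p + 1) ≤ phi y
  exists_min : ∀ q : E → ℝ, ContinuousOn q D →
    (∃ (l : E →L[ℝ] ℝ) (b : ℝ), ∀ y ∈ D, l y + b ≤ q y) →
    ∃ T ∈ D, ∀ y ∈ D, q T + phi T ≤ q y + phi y
  cond : L / (p ! : ℝ) ≤ s

namespace InnerProblem

variable {E : Type u} [NormedAddCommGroup E] [InnerProductSpace ℝ E]
  {U D : Set E} {p : ℕ} {L s : ℝ} {g phi : E → ℝ}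

theorem contDiffAt (h : InnerProblem U D p L s g phi) {x : E} (hx : x ∈ D) :
    ContDiffAt ℝ p g x :=
  h.contDiff_g.contDiffAt (h.isOpen.mem_nhds (h.subset hx))

theorem hasFDerivAt (h : InnerProblem U D p L s g phi) {x : E} (hx : x ∈ D) :
    HasFDerivAt g (fderiv ℝ g x) x :=
  ((h.contDiffAt hx).differentiableAt (by have := h.one_le; norm_cast; omega)).hasFDerivAt

theorem s_pos (h : InnerProblem U D p L s g phi) : 0 < s :=
  lt_of_lt_of_le (div_pos h.L_pos (by positivity)) h.cond

/-- The convex smooth part lies above its tangent plane at x, so `exists_min` applies; the term with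
s makes the minimizer strict. -/
theorem exists_isTensorStep (h : InnerProblem U D p L s g phi) {x : E} (hx : x ∈ D) :
    ∃ T, IsTensorStep D p (p * L) g phi x T := by
  have hd := hasFDerivAt_modelSmooth (M := p * L) h.one_le (h.contDiffAt hx)
  obtain ⟨T, hT, hmin⟩ := h.exists_min (modelSmooth p (p * L) g x)
    (fun y _ => (hd y).continuousAt.continuousWithinAt)
    ⟨modelGrad p (p * L) g x x, modelSmooth p (p * L) g x x - modelGrad p (p * L) g x x x,
      fun y hy => by
        have := modelSmooth_add_modelGrad_le h.one_le h.isOpen h.convex_g h.contDiff_g h.L_pos.le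
          h.lipschitz le_rfl (h.subset hx) (h.subset hx) (h.subset hy)
        rw [map_sub] at this
        linarith⟩
  refine ⟨T, hT, fun y hy hne => ?_⟩
  have h1 := h.uniformly_convex _ _ T hT (hd T) hmin y hy
  have h2 := modelSmooth_add_modelGrad_le h.one_le h.isOpen h.convex_g h.contDiff_g h.L_pos.le
    h.lipschitz le_rfl (h.subset hx) (h.subset hT) (h.subset hy)
  have h3 : 0 < s * ‖y - T‖ ^ (p + 1) :=
    mul_pos h.s_pos (pow_pos (norm_pos_iff.2 (sub_ne_zero.2 hne)) _)
  change modelSmooth p (p * L) g x T + phi T < modelSmooth p (p * L) g x y + phi y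
  linarith

theorem step_min {x T : E} (hT : IsTensorStep D p (p * L) g phi x T) {y : E} (hy : y ∈ D) :
    modelSmooth p (p * L) g x T + phi T ≤ modelSmooth p (p * L) g x y + phi y := by
  by_cases hyT : y = T
  · rw [hyT]
  · exact (hT.2 y hy hyT).le

theorem phi_step_le (h : InnerProblem U D p L s g phi) {x T : E} (hx : x ∈ D)
    (hT : IsTensorStep D p (p * L) g phi x T) {y : E} (hy : y ∈ D) :
    phi T - modelGrad p (p * L) g x T (y - T) + s * ‖y - T‖ ^ (p + 1) ≤ phi y :=
  h.uniformly_convex _ _ T hT.1 (hasFDerivAt_modelSmooth h.one_le (h.contDiffAt hx) (p * L) T)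
    (fun _ hz => step_min hT hz) y hy

/-- `stepGrad` is a subgradient at the new point, with uniform convexity. -/
theorem add_stepGrad_le (h : InnerProblem U D p L s g phi) {x T : E} (hx : x ∈ D)
    (hT : IsTensorStep D p (p * L) g phi x T) {y : E} (hy : y ∈ D) :
    g T + phi T + stepGrad p (p * L) g x T (y - T) + s * ‖y - T‖ ^ (p + 1) ≤ g y + phi y := by
  have h1 := add_fderiv_le_of_convexOn h.convex_g (h.subset hT.1) (h.hasFDerivAt hT.1) (h.subset hy)
  have h2 := h.phi_step_le hx hT hy
  rw [stepGrad_eq, sub_apply]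
  linarith

theorem abs_sub_taylor_le (h : InnerProblem U D p L s g phi) {x y : E} (hx : x ∈ D) (hy : y ∈ D) :
    |g y - taylor p g x y| ≤ L / ((p + 1)! : ℝ) * ‖y - x‖ ^ (p + 1) := by
  obtain ⟨m, rfl⟩ : ∃ m, p = m + 1 := ⟨p - 1, by have := h.one_le; omega⟩
  exact abs_sub_vtaylor_le h.isOpen h.convex_g.1 h.contDiff_g h.lipschitz (h.subset hx) (h.subset hy)

theorem norm_fderiv_sub_le (h : InnerProblem U D p L s g phi) {x y : E} (hx : x ∈ D) (hy : y ∈ D) :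
    ‖fderiv ℝ g y - fderiv ℝ (taylor p g x) y‖ ≤ L / (p ! : ℝ) * ‖y - x‖ ^ p := by
  obtain ⟨m, rfl⟩ : ∃ m, p = m + 1 := ⟨p - 1, by have := h.one_le; omega⟩
  rw [taylor_eq_vtaylor, (hasFDerivAt_vtaylor_real (h.contDiffAt hx) y).fderiv]
  exact norm_fderiv_sub_vtaylor_le h.isOpen h.convex_g.1 h.contDiff_g h.lipschitz
    (h.subset hx) (h.subset hy)

/-- A tensor step decreases a regularized objective. -/
theorem step_le (h : InnerProblem U D p L s g phi) {x T : E} (hx : x ∈ D)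
    (hT : IsTensorStep D p (p * L) g phi x T) {y : E} (hy : y ∈ D) :
    g T + phi T ≤ g y + phi y + L / (p ! : ℝ) * ‖y - x‖ ^ (p + 1) := by
  have h1 := step_min hT hy
  have h2 := abs_le.1 (h.abs_sub_taylor_le hx hT.1)
  have h3 := abs_le.1 (h.abs_sub_taylor_le hx hy)
  have hp : (1 : ℝ) ≤ p := by exact_mod_cast h.one_le
  have hL := h.L_pos
  rw [modelSmooth, modelSmooth] at h1
  -- The Taylor error at T is absorbed by the regularizer because p ≥ 1; at y the two add up: L + pL
  -- = (p + 1) L.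
  have h4 : L / ((p + 1)! : ℝ) * ‖T - x‖ ^ (p + 1) ≤ p * L / ((p + 1)! : ℝ) * ‖T - x‖ ^ (p + 1) := by
    gcongr
    nlinarith
  have h5 : L / (p ! : ℝ) * ‖y - x‖ ^ (p + 1) = L / ((p + 1)! : ℝ) * ‖y - x‖ ^ (p + 1) +
      p * L / ((p + 1)! : ℝ) * ‖y - x‖ ^ (p + 1) := by
    rw [Nat.factorial_succ]
    push_cast
    field_simp
    ring
  linarith [h2.2, h3.1]

/-- The minimizer of the composite problem, with uniform growth. -/
theorem exists_growth (h : InnerProblem U D p L s g phi) :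
    ∃ w ∈ D, ∀ y ∈ D, g w + phi w + s * ‖y - w‖ ^ (p + 1) ≤ g y + phi y := by
  obtain ⟨x, hx⟩ := h.nonempty
  obtain ⟨w, hw, hmin⟩ := h.exists_min g
    (fun y hy => (h.hasFDerivAt hy).continuousAt.continuousWithinAt)
    ⟨fderiv ℝ g x, g x - fderiv ℝ g x x, fun y hy => by
      have := add_fderiv_le_of_convexOn h.convex_g (h.subset hx) (h.hasFDerivAt hx) (h.subset hy)
      rw [map_sub] at this
      linarith⟩
  refine ⟨w, hw, fun y hy => ?_⟩
  have h1 := add_fderiv_le_of_convexOn h.convex_g (h.subset hw) (h.hasFDerivAt hw) (h.subset hy)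
  have h2 := h.uniformly_convex g _ w hw (h.hasFDerivAt hw) hmin y hy
  linarith

variable [FiniteDimensional ℝ E]

/-- The subgradient produced by a tensor step is well aligned with the step. -/
theorem exists_stepGrad_eq (h : InnerProblem U D p L s g phi) {x T : E} (hx : x ∈ D)
    (hT : IsTensorStep D p (p * L) g phi x T) :
    ∃ q, 0 ≤ q ∧ q ≤ ‖T - x‖ ∧
      ‖stepGrad p (p * L) g x T‖ = (p + 1) * (L / (p ! : ℝ)) * q ^ p ∧
      ‖stepGrad p (p * L) g x T‖ * q ≤ stepGrad p (p * L) g x T (x - T) := by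
  have hp0 : p ≠ 0 := by have := h.one_le; omega
  have he := h.norm_fderiv_sub_le hx hT.1
  set ε := L / (p ! : ℝ) with hε
  have hε0 : 0 < ε := div_pos h.L_pos (by positivity)
  set r := ‖T - x‖ with hr
  have hr0 : 0 ≤ r := norm_nonneg _
  -- The subgradient is e − c (T − x): a Taylor error of norm at most ε r^p, minus the regularizer's
  -- gradient, of norm exactly p ε r^p.
  set e := (InnerProductSpace.toDual ℝ E).symm (fderiv ℝ g T - fderiv ℝ (taylor p g x) T) with hedef
  have hen : ‖e‖ ≤ ε * r ^ p := by rwa [hedef, LinearIsometryEquiv.norm_map]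
  set c := p * ε * r ^ (p - 1) with hc
  have hc0 : 0 ≤ c := by positivity
  have hG : stepGrad p (p * L) g x T = InnerProductSpace.toDual ℝ E (e - c • (T - x)) := by
    rw [stepGrad, LinearIsometryEquiv.map_sub, hedef, LinearIsometryEquiv.apply_symm_apply]
    congr 1
    rw [LinearIsometryEquiv.map_smulₛₗ, hc, hε, mul_div_assoc]
    rfl
  have hn : ‖stepGrad p (p * L) g x T‖ = ‖e - c • (T - x)‖ := by
    rw [hG, LinearIsometryEquiv.norm_map]
  have happ : stepGrad p (p * L) g x T (x - T) = c * r ^ 2 - inner ℝ e (T - x) := by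
    rw [hG, InnerProductSpace.toDual_apply_apply, ← neg_sub T x, inner_neg_right, inner_sub_left,
      inner_smul_left, real_inner_self_eq_norm_sq]
    simp [hr]
  set n := ‖stepGrad p (p * L) g x T‖ with hndef
  have hsq : n ^ 2 = ‖e‖ ^ 2 - 2 * (c * inner ℝ e (T - x)) + c ^ 2 * r ^ 2 := by
    rw [hn, @norm_sub_sq_real, inner_smul_right, norm_smul, mul_pow, Real.norm_of_nonneg hc0]
  have hpow : r ^ (p - 1) * r = r ^ p := by rw [← pow_succ]; congr 1; omega
  have hnle : n ≤ (p + 1) * ε * r ^ p := by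
    rw [hn]
    refine (norm_sub_le _ _).trans ?_
    rw [norm_smul, Real.norm_of_nonneg hc0]
    calc ‖e‖ + c * ‖T - x‖ ≤ ε * r ^ p + p * ε * (r ^ (p - 1) * r) := by
          rw [hc, ← hr, mul_assoc _ (r ^ (p - 1)) r]; gcongr
      _ = _ := by rw [hpow]; ring
  have hn0 : 0 ≤ n := norm_nonneg _
  -- q is an effective step length: r would equal q if the bound n ≤ (p + 1) ε r^p were sharp.
  refine ⟨(n / ((p + 1) * ε)) ^ ((p : ℝ)⁻¹), by positivity, ?_, ?_, ?_⟩
  all_goals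
    have hq : ((n / ((p + 1) * ε)) ^ ((p : ℝ)⁻¹)) ^ p = n / ((p + 1) * ε) :=
      Real.rpow_inv_natCast_pow (by positivity) hp0
    set q := (n / ((p + 1) * ε)) ^ ((p : ℝ)⁻¹)
    have hq0 : 0 ≤ q := by positivity
    have hnq : n = (p + 1) * ε * q ^ p := by rw [hq]; field_simp
    have hqr : q ≤ r := by
      rw [← pow_le_pow_iff_left₀ hq0 hr0 hp0, hq, div_le_iff₀ (by positivity)]
      linarith
  · exact hqr
  · exact hnq
  · rw [happ]
    rcases hr0.eq_or_lt with hr00 | hrpos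
    · have hq00 : q = 0 := le_antisymm (hr00 ▸ hqr) hq0
      have : T - x = 0 := norm_eq_zero.1 (hr.symm.trans hr00.symm)
      simp [hq00, this, ← hr00]
    · have hcpos : 0 < c := by have := h.one_le; positivity
      have key := add_mul_pow_mul_pow_le (p + 1) (p - 1) hq0 hr0
      have e1 : p + 1 + (p - 1) = 2 * p := by have := h.one_le; omega
      have e2 : ((p - 1 : ℕ) : ℝ) = p - 1 := by
        rw [Nat.cast_sub h.one_le]; simp
      rw [e1, e2] at key
      push_cast at key
      have hcr : c * r = p * ε * r ^ p := by rw [hc, mul_assoc, hpow]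
      have hen2 : ‖e‖ ^ 2 ≤ (ε * r ^ p) ^ 2 := by gcongr
      -- The right side equals n² + c²r² − ‖e‖², with c r = p ε r^p. The mean inequality with
      -- weights p + 1 and p − 1 then bounds n² + (p² − 1)(ε r^p)² below by 2 c n q.
      have h1 : n ^ 2 + (p ^ 2 - 1) * (ε * r ^ p) ^ 2 ≤ 2 * c * (c * r ^ 2 - inner ℝ e (T - x)) := by
        have : c ^ 2 * r ^ 2 = (p : ℝ) ^ 2 * (ε * r ^ p) ^ 2 := by
          rw [← mul_pow, hcr]; ring
        nlinarith
      have h2 : 2 * c * (n * q) ≤ n ^ 2 + (p ^ 2 - 1) * (ε * r ^ p) ^ 2 := by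
        have hfac : 0 ≤ (p + 1) * ε ^ 2 := by positivity
        have e3 : 2 * c * (n * q) =
            (p + 1) * ε ^ 2 * (((p : ℝ) + 1 + (p - 1)) * (q ^ (p + 1) * r ^ (p - 1))) := by
          rw [hnq, hc]; ring
        have e4 : n ^ 2 + (p ^ 2 - 1) * (ε * r ^ p) ^ 2 =
            (p + 1) * ε ^ 2 * ((p + 1) * q ^ (2 * p) + (p - 1) * r ^ (2 * p)) := by
          rw [hnq, mul_comm 2 p, pow_mul, pow_mul]; ring
        rw [e3, e4]
        exact mul_le_mul_of_nonneg_left key hfac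
      exact le_of_mul_le_mul_left (h2.trans h1) (by positivity)

end InnerProblem

/-! ### Linear rate of tensor steps and length of an inner loop. -/

/-- The exponent of the linear rate of tensor steps for problems with condition number one. -/
def rate (p : ℕ) : ℝ := ((p : ℝ) + 0.7) / (p + 1.58)

theorem rate_pos (p : ℕ) : 0 < rate p := by unfold rate; positivity

theorem rate_le_one (p : ℕ) : rate p ≤ 1 := by
  unfold rate
  rw [div_le_one (by positivity)]
  linarith

/-- Reduces a bound on an exponential to rational arithmetic, rounding x up to m/n and e up to nine
decimals or so. -/
theorem exp_le_of_pow_le {x a : ℝ} {m n : ℕ} (hn : n ≠ 0) (hx : x ≤ m / n) (ha : 0 ≤ a)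
    (h : (2.7182818286 : ℝ) ^ m ≤ a ^ n) : Real.exp x ≤ a := by
  rw [← pow_le_pow_iff_left₀ (Real.exp_pos x).le ha hn, ← Real.exp_nat_mul]
  refine le_trans ?_ h
  have h1 : (n : ℝ) * x ≤ m := by
    rw [le_div_iff₀ (by positivity)] at hx
    linarith
  calc Real.exp (n * x) ≤ Real.exp (m * 1) := Real.exp_le_exp.2 (by linarith)
    _ = Real.exp 1 ^ m := Real.exp_nat_mul 1 m
    _ ≤ _ := by
      gcongr
      exact Real.exp_one_lt_d9.le

/-- The subgradient estimate gives the factor p/(2p + 2), which tends to 1/2 > 1/e and so is good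
enough only for small p. -/
theorem exp_rate_le_of_le_five {p : ℕ} (hp : 1 ≤ p) (hp5 : p ≤ 5) :
    Real.exp (rate p) ≤ (2 * p + 2) / p := by
  interval_cases p
  · exact exp_le_of_pow_le (m := 1) (n := 1) one_ne_zero (by norm_num [rate]) (by norm_num)
      (by norm_num)
  · exact exp_le_of_pow_le (m := 1) (n := 1) one_ne_zero (by norm_num [rate]) (by norm_num)
      (by norm_num)
  · exact exp_le_of_pow_le (m := 9) (n := 10) (by norm_num) (by norm_num [rate]) (by norm_num)
      (by norm_num)
  · exact exp_le_of_pow_le (m := 9) (n := 10) (by norm_num) (by norm_num [rate]) (by norm_num)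
      (by norm_num)
  · exact exp_le_of_pow_le (m := 7) (n := 8) (by norm_num) (by norm_num [rate]) (by norm_num)
      (by norm_num)

/-- For large p the step is compared with the point 0.72 of the way to the minimizer; the resulting
factor tends to 0.28 < 1/e, while `rate p` ≤ 1. -/
theorem segment_rate_le {p : ℕ} (hp : 6 ≤ p) :
    (0.28 : ℝ) + 0.72 ^ (p + 1) ≤ Real.exp (-rate p) := by
  rw [Real.exp_neg]
  rcases hp.eq_or_lt with rfl | h
  · rw [le_inv_comm₀ (by positivity) (Real.exp_pos _)]
    exact exp_le_of_pow_le (m := 9) (n := 10) (by norm_num) (by norm_num [rate]) (by norm_num)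
      (by norm_num)
  · have h1 : (0.72 : ℝ) ^ (p + 1) ≤ 0.72 ^ 8 :=
      pow_le_pow_of_le_one (by norm_num) (by norm_num) (by omega)
    refine (add_le_add_right h1 _).trans ?_
    rw [le_inv_comm₀ (by positivity) (Real.exp_pos _)]
    exact exp_le_of_pow_le (m := 1) (n := 1) one_ne_zero (by simpa using rate_le_one p)
      (by norm_num) (by norm_num)

namespace InnerProblem

variable {E : Type u} [NormedAddCommGroup E] [InnerProductSpace ℝ E] [FiniteDimensional ℝ E]
  {U D : Set E} {p : ℕ} {L s : ℝ} {g phi : E → ℝ}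

/-- Progress of one tensor step in terms of the new subgradient. -/
theorem gap_le_of_stepGrad (h : InnerProblem U D p L s g phi) {x T w : E} (hx : x ∈ D)
    (hT : IsTensorStep D p (p * L) g phi x T) (hw : w ∈ D) :
    (2 * p + 2) * (g T + phi T - (g w + phi w)) ≤ p * (g x + phi x - (g w + phi w)) := by
  obtain ⟨q, hq0, hqr, hn, hal⟩ := h.exists_stepGrad_eq hx hT
  have hp0 : (0 : ℝ) < p := by have := h.one_le; positivity
  have h1 := h.add_stepGrad_le hx hT hx
  have h2 := h.add_stepGrad_le hx hT hw
  have hcond := h.cond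
  have hε0 : 0 < L / (p ! : ℝ) := div_pos h.L_pos (by positivity)
  set ε := L / (p ! : ℝ)
  set n := ‖stepGrad p (p * L) g x T‖
  have h3 : -(n * ‖w - T‖) ≤ stepGrad p (p * L) g x T (w - T) :=
    (abs_le.1 ((stepGrad p (p * L) g x T).le_opNorm (w - T))).1
  have h4 : ε * q ^ (p + 1) ≤ s * ‖x - T‖ ^ (p + 1) := by
    rw [norm_sub_rev x T]
    exact mul_le_mul hcond (by gcongr) (by positivity) h.s_pos.le
  have h5 : ε * ‖w - T‖ ^ (p + 1) ≤ s * ‖w - T‖ ^ (p + 1) := by gcongr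
  have h6 := add_mul_pow_mul_pow_le p 1 hq0 (norm_nonneg (w - T))
  have h7 : n * ‖w - T‖ = ε * ((p + 1) * (q ^ p * ‖w - T‖)) := by rw [hn]; ring
  have h8 : n * q = ε * ((p + 1) * q ^ (p + 1)) := by rw [hn]; ring
  push_cast at h6
  rw [pow_one, one_mul] at h6
  have h9 := mul_le_mul_of_nonneg_left h6 hε0.le
  -- With ρ = ‖w − T‖ the new gap is at most nρ − ε ρ^(p+1), hence at most ε p q^(p+1) by the mean
  -- inequality; the decrease is at least nq + ε q^(p+1) = ε (p + 2) q^(p+1). The ratio p : (p + 2)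
  -- gives the factor p/(2p + 2).
  have hG : g T + phi T - (g w + phi w) ≤ ε * (p * q ^ (p + 1)) := by nlinarith
  have hDG : ε * ((p + 2) * q ^ (p + 1)) ≤ g x + phi x - (g T + phi T) := by nlinarith
  nlinarith

/-- Linear convergence of tensor steps. -/
theorem gap_le (h : InnerProblem U D p L s g phi) {x T w : E} (hx : x ∈ D)
    (hT : IsTensorStep D p (p * L) g phi x T) (hw : w ∈ D)
    (hgrow : ∀ y ∈ D, g w + phi w + s * ‖y - w‖ ^ (p + 1) ≤ g y + phi y) :
    g T + phi T - (g w + phi w) ≤ Real.exp (-rate p) * (g x + phi x - (g w + phi w)) := by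
  have hD : 0 ≤ g x + phi x - (g w + phi w) := by
    have := hgrow x hx
    have := h.s_pos
    have : 0 ≤ s * ‖x - w‖ ^ (p + 1) := by positivity
    linarith
  rcases le_or_gt p 5 with hp | hp
  · have h1 := h.gap_le_of_stepGrad hx hT hw
    have h2 := exp_rate_le_of_le_five h.one_le hp
    have hp0 : (0 : ℝ) < p := by have := h.one_le; positivity
    have h3 : (p : ℝ) / (2 * p + 2) ≤ Real.exp (-rate p) := by
      rw [Real.exp_neg, le_inv_comm₀ (by positivity) (Real.exp_pos _), inv_div]
      exact h2
    refine le_trans ?_ (mul_le_mul_of_nonneg_right h3 hD)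
    rw [div_mul_eq_mul_div, le_div_iff₀ (by positivity)]
    linarith
  -- Growth at w turns the error (L/p!) ‖y − x‖^(p+1) at the comparison point into at most
  -- 0.72^(p+1) times the gap.
  · refine le_trans ?_ (mul_le_mul_of_nonneg_right (segment_rate_le hp) hD)
    have hconv : ConvexOn ℝ D (fun y => g y + phi y) :=
      (h.convex_g.subset h.subset h.convex_phi.1).add h.convex_phi
    have hy : x + (0.72 : ℝ) • (w - x) ∈ D :=
      hconv.1.add_smul_sub_mem hx hw ⟨by norm_num, by norm_num⟩
    have h1 := h.step_le hx hT hy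
    have h2 := hconv.2 hx hw (show (0 : ℝ) ≤ 0.28 by norm_num)
      (show (0 : ℝ) ≤ 0.72 by norm_num) (by norm_num)
    have e : (0.28 : ℝ) • x + (0.72 : ℝ) • w = x + (0.72 : ℝ) • (w - x) := by module
    rw [e] at h2
    simp only [smul_eq_mul] at h2
    rw [add_sub_cancel_left, norm_smul, mul_pow, Real.norm_of_nonneg (by norm_num : (0 : ℝ) ≤ 0.72)] at h1
    have h3 := hgrow x hx
    have h4 : L / (p ! : ℝ) * (0.72 ^ (p + 1) * ‖w - x‖ ^ (p + 1)) ≤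
        0.72 ^ (p + 1) * (g x + phi x - (g w + phi w)) := by
      rw [norm_sub_rev w x]
      calc _ ≤ s * (0.72 ^ (p + 1) * ‖x - w‖ ^ (p + 1)) := by have := h.cond; gcongr
        _ = 0.72 ^ (p + 1) * (s * ‖x - w‖ ^ (p + 1)) := by ring
        _ ≤ _ := by gcongr; linarith
    linarith

/-- Before a step that fails the test, the gap is bounded from below. -/
theorem le_gap (h : InnerProblem U D p L s g phi) {x T w : E} (hx : x ∈ D)
    (hT : IsTensorStep D p (p * L) g phi x T)
    (hmin : ∀ y ∈ D, g w + phi w ≤ g y + phi y) {δ : ℝ} (hδ : 0 ≤ δ)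
    (hn : δ < ‖stepGrad p (p * L) g x T‖) :
    δ * (δ / ((p + 1) * (L / (p ! : ℝ)))) ^ ((p : ℝ)⁻¹) ≤ g x + phi x - (g w + phi w) := by
  obtain ⟨q, hq0, hqr, hn', hal⟩ := h.exists_stepGrad_eq hx hT
  have h1 := h.add_stepGrad_le hx hT hx
  have h2 := hmin T hT.1
  have hε0 : 0 < L / (p ! : ℝ) := div_pos h.L_pos (by positivity)
  have hp0 : p ≠ 0 := by have := h.one_le; omega
  -- A large subgradient forces a large q, and the step from x to T lowers the objective by at least
  -- ‖subgradient‖ · q.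
  have h3 : (δ / ((p + 1) * (L / (p ! : ℝ)))) ^ ((p : ℝ)⁻¹) ≤ q := by
    rw [← Real.pow_rpow_inv_natCast hq0 hp0]
    refine Real.rpow_le_rpow (by positivity) ?_ (by positivity)
    rw [div_le_iff₀ (by positivity)]
    linarith
  have h4 : δ * (δ / ((p + 1) * (L / (p ! : ℝ)))) ^ ((p : ℝ)⁻¹) ≤
      ‖stepGrad p (p * L) g x T‖ * q := mul_le_mul hn.le h3 (by positivity) (norm_nonneg _)
  have h5 : 0 ≤ s * ‖x - T‖ ^ (p + 1) := by have := h.s_pos; positivity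
  linarith

section Iterates

variable {z : ℕ → E} {w : E} {t : ℕ}

omit [FiniteDimensional ℝ E] in
theorem iterate_mem (hz0 : z 0 ∈ D)
    (hz : ∀ j < t, IsTensorStep D p (p * L) g phi (z j) (z (j + 1))) :
    ∀ j ≤ t, z j ∈ D := by
  intro j hj
  cases j with
  | zero => exact hz0
  | succ j => exact (hz j (by omega)).1

/-- The first step is compared with w itself, which needs no bound on the initial gap; each of the j
later steps contributes the linear rate. -/
theorem gap_iterate_le (h : InnerProblem U D p L s g phi) (hz0 : z 0 ∈ D)
    (hz : ∀ j < t, IsTensorStep D p (p * L) g phi (z j) (z (j + 1))) (hw : w ∈ D)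
    (hgrow : ∀ y ∈ D, g w + phi w + s * ‖y - w‖ ^ (p + 1) ≤ g y + phi y) :
    ∀ j, j + 1 ≤ t → g (z (j + 1)) + phi (z (j + 1)) - (g w + phi w) ≤
      Real.exp (-rate p * j) * (L / (p ! : ℝ) * ‖w - z 0‖ ^ (p + 1)) := by
  intro j
  induction j with
  | zero =>
    intro hj
    have := h.step_le hz0 (hz 0 hj) hw
    simp
    linarith
  | succ j ih =>
    intro hj
    have h1 := h.gap_le (iterate_mem hz0 hz (j + 1) (by omega)) (hz (j + 1) hj) hw hgrow
    refine h1.trans ?_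
    have h2 := mul_le_mul_of_nonneg_left (ih (by omega)) (Real.exp_pos (-rate p)).le
    refine h2.trans (le_of_eq ?_)
    rw [← mul_assoc, ← Real.exp_add]
    push_cast
    congr 2
    ring

/-- The number of tensor steps, in terms of the initial distance to the solution. -/
theorem steps_le (h : InnerProblem U D p L s g phi) (hz0 : z 0 ∈ D)
    (hz : ∀ j < t, IsTensorStep D p (p * L) g phi (z j) (z (j + 1))) (hw : w ∈ D)
    (hgrow : ∀ y ∈ D, g w + phi w + s * ‖y - w‖ ^ (p + 1) ≤ g y + phi y) {δ : ℝ} (hδ : 0 < δ)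
    (htest : ∀ j, j + 1 < t → δ < ‖stepGrad p (p * L) g (z j) (z (j + 1))‖) {X : ℝ} (hX : 0 ≤ X)
    (hbound : L / (p ! : ℝ) * ‖w - z 0‖ ^ (p + 1) ≤
      Real.exp X * (δ * (δ / ((p + 1) * (L / (p ! : ℝ)))) ^ ((p : ℝ)⁻¹))) :
    (t : ℝ) ≤ 3 + X / rate p := by
  have hr := rate_pos p
  have hX' : 0 ≤ X / rate p := div_nonneg hX hr.le
  rcases le_or_gt t 3 with ht | ht
  · have : (t : ℝ) ≤ 3 := by exact_mod_cast ht
    linarith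
  -- The three extra steps: the first one, the one whose failed test bounds the gap at z (j + 1)
  -- from below, and the last one.
  obtain ⟨j, rfl⟩ : ∃ j, t = j + 3 := ⟨t - 3, by omega⟩
  have hε0 : 0 < L / (p ! : ℝ) := div_pos h.L_pos (by positivity)
  set B := δ * (δ / ((p + 1) * (L / (p ! : ℝ)))) ^ ((p : ℝ)⁻¹) with hB
  have hB0 : 0 < B := by positivity
  have h1 := h.gap_iterate_le hz0 hz hw hgrow j (by omega)
  have hmin : ∀ y ∈ D, g w + phi w ≤ g y + phi y := by
    intro y hy
    have := hgrow y hy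
    have := h.s_pos
    have : 0 ≤ s * ‖y - w‖ ^ (p + 1) := by positivity
    linarith
  have h2 := h.le_gap (iterate_mem hz0 hz (j + 1) (by omega)) (hz (j + 1) (by omega)) hmin hδ.le
    (htest (j + 1) (by omega))
  have h3 : B ≤ Real.exp (-rate p * j + X) * B := by
    rw [Real.exp_add, mul_assoc]
    exact h2.trans (h1.trans (by gcongr))
  have h4 : 1 ≤ Real.exp (-rate p * j + X) := by
    by_contra hlt
    nlinarith [not_le.1 hlt]
  have h5 := Real.one_le_exp_iff.1 h4
  push_cast
  have : (j : ℝ) ≤ X / rate p := by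
    rw [le_div_iff₀ hr]; linarith
  linarith

end Iterates

/-- The inner loop stops. -/
theorem exists_steps (h : InnerProblem U D p L s g phi) {v : E} (hv : v ∈ D) {δ : ℝ} (hδ : 0 < δ) :
    ∃ (z : ℕ → E) (t : ℕ), z 0 = v ∧
      (∀ j < t, IsTensorStep D p (p * L) g phi (z j) (z (j + 1))) ∧
      (∀ j, j + 1 < t → δ < ‖stepGrad p (p * L) g (z j) (z (j + 1))‖) ∧
      ∃ j, t = j + 1 ∧ ‖stepGrad p (p * L) g (z j) (z (j + 1))‖ ≤ δ := by
  classical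
  have hex : ∀ x : D, ∃ T : D, IsTensorStep D p (p * L) g phi x T := fun x => by
    obtain ⟨T, hT⟩ := h.exists_isTensorStep x.2
    exact ⟨⟨T, hT.1⟩, hT⟩
  choose step hstep using hex
  set z : ℕ → D := fun n => step^[n] ⟨v, hv⟩ with hzdef
  have hz : ∀ j, IsTensorStep D p (p * L) g phi (z j) (z (j + 1)) := fun j => by
    rw [hzdef]
    simp only [Function.iterate_succ_apply']
    exact hstep _
  -- If every test failed, `steps_le` would bound all t by the same number.
  have hsmall : ∃ j, ‖stepGrad p (p * L) g (z j : E) (z (j + 1))‖ ≤ δ := by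
    by_contra hcon
    push Not at hcon
    obtain ⟨w, hw, hgrow⟩ := h.exists_growth
    have hε0 : 0 < L / (p ! : ℝ) := div_pos h.L_pos (by positivity)
    set B := δ * (δ / ((p + 1) * (L / (p ! : ℝ)))) ^ ((p : ℝ)⁻¹) with hB
    have hB0 : 0 < B := by positivity
    set G := L / (p ! : ℝ) * ‖w - z 0‖ ^ (p + 1)
    obtain ⟨X, hX0, hX⟩ : ∃ X : ℝ, 0 ≤ X ∧ G ≤ Real.exp X * B := by
      refine ⟨max 0 (Real.log (max G B / B)), le_max_left _ _, ?_⟩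
      have h0 : 0 < max G B := lt_of_lt_of_le hB0 (le_max_right _ _)
      calc G ≤ max G B := le_max_left _ _
        _ = Real.exp (Real.log (max G B / B)) * B := by
          rw [Real.exp_log (by positivity)]; field_simp
        _ ≤ _ := by gcongr; exact le_max_right _ _
    obtain ⟨t, ht⟩ := exists_nat_gt (3 + X / rate p)
    have := h.steps_le (z := fun j => (z j : E)) (t := t) hv (fun j _ => hz j) hw hgrow hδ
      (fun j _ => hcon j) hX0 hX
    linarith
  refine ⟨fun j => z j, Nat.find hsmall + 1, rfl, fun j _ => hz j, fun j hj => ?_,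
    Nat.find hsmall, rfl, Nat.find_spec hsmall⟩
  exact not_le.1 (Nat.find_min hsmall (by omega))

end InnerProblem

/-! ### Composition with a contraction. -/

section Affine

variable {E : Type u} [NormedAddCommGroup E] [NormedSpace ℝ E] {U : Set E} {f : E → ℝ}
  (A c : ℝ) (e : E)

theorem isOpen_preimage_affine (hU : IsOpen U) : IsOpen ((fun y : E => c • y + e) ⁻¹' U) :=
  hU.preimage (by fun_prop)

theorem convexOn_comp_affine (hf : ConvexOn ℝ U f) (hA : 0 ≤ A) :
    ConvexOn ℝ ((fun y : E => c • y + e) ⁻¹' U) (fun y => A * f (c • y + e)) := by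
  have h := (hf.comp_affineMap ((c • LinearMap.id (R := ℝ) (M := E)).toAffineMap +
    AffineMap.const ℝ E e)).smul hA
  exact h

theorem contDiffOn_comp_affine {n : ℕ} (hf : ContDiffOn ℝ n f U) :
    ContDiffOn ℝ n (fun y => A * f (c • y + e)) ((fun y : E => c • y + e) ⁻¹' U) :=
  contDiffOn_const.mul (hf.comp (by fun_prop : ContDiff ℝ n fun y : E => c • y + e).contDiffOn
    (fun _ hy => hy))

theorem iteratedFDeriv_comp_affine (hU : IsOpen U) {n : ℕ} (hf : ContDiffOn ℝ n f U) {y : E}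
    (hy : c • y + e ∈ U) :
    iteratedFDeriv ℝ n (fun y => A * f (c • y + e)) y =
      (A * c ^ n) • iteratedFDeriv ℝ n f (c • y + e) := by
  have h0 : ContDiffAt ℝ n (fun y => f (c • y + e)) y :=
    (hf.contDiffAt (hU.mem_nhds hy)).comp y (by fun_prop)
  have h1 : iteratedFDeriv ℝ n (fun y => A * f (c • y + e)) y =
      A • iteratedFDeriv ℝ n (fun y => f (c • y + e)) y :=
    iteratedFDeriv_const_smul_apply (a := A) h0
  set V : Set E := (fun y : E => y + e) ⁻¹' U
  have hV : IsOpen V := hU.preimage (by fun_prop)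
  have hfV : ContDiffOn ℝ n (fun y => f (y + e)) V :=
    hf.comp (by fun_prop : ContDiff ℝ n fun y : E => y + e).contDiffOn (fun _ hy => hy)
  set l : E →L[ℝ] E := c • ContinuousLinearMap.id ℝ E
  have hlV : IsOpen (l ⁻¹' V) := hV.preimage l.continuous
  have h2 := l.iteratedFDerivWithin_comp_right hfV hV.uniqueDiffOn hlV.uniqueDiffOn
    (x := y) hy le_rfl
  rw [iteratedFDerivWithin_of_isOpen n hlV (show y ∈ l ⁻¹' V from hy),
    iteratedFDerivWithin_of_isOpen n hV (show l y ∈ V from hy), iteratedFDeriv_comp_add_right] at h2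
  have h3 : iteratedFDeriv ℝ n (fun y => f (c • y + e)) y =
      c ^ n • iteratedFDeriv ℝ n f (c • y + e) := by
    refine Eq.trans h2 ?_
    ext m
    have := (iteratedFDeriv ℝ n f (c • y + e)).map_smul_univ (fun _ => c) m
    simp only [Finset.prod_const, Finset.card_univ, Fintype.card_fin] at this
    exact this
  rw [h1, h3, smul_smul]

/-- The n derivatives and the distance give n + 1 factors c; with n = p, c = a/A and the prefactor A
this becomes L a^(p+1)/A^p. -/
theorem lipschitz_comp_affine (hU : IsOpen U) {n : ℕ} (hf : ContDiffOn ℝ n f U) {L : ℝ}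
    (hL : ∀ x ∈ U, ∀ y ∈ U, ‖iteratedFDeriv ℝ n f x - iteratedFDeriv ℝ n f y‖ ≤ L * ‖x - y‖)
    (hA : 0 ≤ A) (hc : 0 ≤ c) :
    ∀ x ∈ (fun y : E => c • y + e) ⁻¹' U, ∀ y ∈ (fun y : E => c • y + e) ⁻¹' U,
      ‖iteratedFDeriv ℝ n (fun y => A * f (c • y + e)) x -
        iteratedFDeriv ℝ n (fun y => A * f (c • y + e)) y‖ ≤ A * c ^ (n + 1) * L * ‖x - y‖ := by
  intro x hx y hy
  rw [iteratedFDeriv_comp_affine A c e hU hf hx, iteratedFDeriv_comp_affine A c e hU hf hy,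
    ← smul_sub, norm_smul, Real.norm_of_nonneg (by positivity)]
  refine (mul_le_mul_of_nonneg_left (hL _ hx _ hy) (by positivity)).trans (le_of_eq ?_)
  rw [add_sub_add_right_eq_sub, ← smul_sub, norm_smul, Real.norm_of_nonneg hc]
  ring

end Affine

/-! ### Existence of minimizers and relative strong convexity. -/

section Existence

variable {E : Type u} [NormedAddCommGroup E] [InnerProductSpace ℝ E]
  {D : Set E} {ψ : E → ℝ}

/-- A proper closed convex function has an affine minorant. -/
theorem ProperClosedConvex.exists_affine_le (hψ : ProperClosedConvex D ψ) :
    ∃ (l : E →L[ℝ] ℝ) (b : ℝ), ∀ y ∈ D, l y + b ≤ ψ y := by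
  obtain ⟨⟨x, hx⟩, hconv, hclosed⟩ := hψ
  have hnot : ((x, ψ x - 1) : E × ℝ) ∉ {q : E × ℝ | q.1 ∈ D ∧ ψ q.1 ≤ q.2} := by
    intro h
    have := h.2
    simp only at this
    linarith
  obtain ⟨F, u, h1, h2⟩ := geometric_hahn_banach_point_closed hconv.convex_epigraph hclosed hnot
  have hF : ∀ (y : E) (t : ℝ), F (y, t) = F (y, 0) + t * F (0, 1) := by
    intro y t
    have : ((y, t) : E × ℝ) = (y, 0) + t • (0, 1) := by simp
    rw [this, map_add, map_smul, smul_eq_mul]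
  have h3 := h2 (x, ψ x) ⟨hx, le_rfl⟩
  rw [hF] at h1 h3
  -- The separated point lies strictly below the graph, so the hyperplane is not vertical.
  have hκ : 0 < F (0, 1) := by nlinarith
  refine ⟨(-(F (0, 1))⁻¹) • F.comp (ContinuousLinearMap.inl ℝ E ℝ), u * (F (0, 1))⁻¹,
    fun y hy => ?_⟩
  have h4 := h2 (y, ψ y) ⟨hy, le_rfl⟩
  rw [hF] at h4
  simp only [smul_apply, ContinuousLinearMap.comp_apply, ContinuousLinearMap.inl_apply, smul_eq_mul]
  have h5 : -(F (0, 1))⁻¹ * F (y, 0) + u * (F (0, 1))⁻¹ = (u - F (y, 0)) / F (0, 1) := by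
    rw [div_eq_mul_inv]; ring
  rw [h5, div_le_iff₀ hκ]
  linarith

theorem le_of_pow_growth {p : ℕ} (hp : 1 ≤ p) {κ C₁ C₂ r : ℝ} (hκ : 0 < κ) (hC₁ : 0 ≤ C₁)
    (h : κ * r ^ (p + 1) ≤ C₁ * r + C₂) : r ≤ 1 + (C₁ + |C₂|) / κ := by
  by_contra hlt
  have hlt := not_le.1 hlt
  have h0 : 0 ≤ (C₁ + |C₂|) / κ := by positivity
  have hr : 1 ≤ r := by linarith
  have h1 : r ^ 2 ≤ r ^ (p + 1) := pow_le_pow_right₀ hr (by omega)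
  have h2 : (C₁ + |C₂|) < κ * (r - 1) := by
    rw [mul_comm, ← div_lt_iff₀ hκ]; linarith
  have h3 : κ * r ^ 2 ≤ κ * r ^ (p + 1) := by gcongr
  nlinarith [le_abs_self C₂, abs_nonneg C₂]

variable [FiniteDimensional ℝ E]

/-- Existence of minimizers for coercive perturbations of proper closed convex functions. -/
theorem ProperClosedConvex.exists_min (hψ : ProperClosedConvex D ψ) {a : ℝ} (ha : 0 < a)
    {Q : E → ℝ} (hQ : ContinuousOn Q D) {p : ℕ} (hp : 1 ≤ p) {l : E →L[ℝ] ℝ} {b κ : ℝ} {v : E}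
    (hκ : 0 < κ) (hlow : ∀ y ∈ D, l y + b + κ * ‖y - v‖ ^ (p + 1) ≤ Q y) :
    ∃ T ∈ D, ∀ y ∈ D, Q T + a * ψ T ≤ Q y + a * ψ y := by
  obtain ⟨l₂, b₂, hl₂⟩ := hψ.exists_affine_le
  obtain ⟨⟨x, hx⟩, hconv, hclosed⟩ := hψ
  -- Minimize over the epigraph, with the height in place of ψ: only the epigraph is known to be
  -- closed, D need not be, and ψ need not be continuous on it.
  set S : Set (E × ℝ) := {q : E × ℝ | q.1 ∈ D ∧ ψ q.1 ≤ q.2} with hS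
  set Φ : E × ℝ → ℝ := fun q => Q q.1 + a * q.2
  set c := Q x + a * ψ x
  have hΦ : ContinuousOn Φ S :=
    (hQ.comp continuous_fst.continuousOn (fun q hq => hq.1)).add (by fun_prop)
  have hKclosed : IsClosed (S ∩ Φ ⁻¹' Set.Iic c) :=
    hΦ.preimage_isClosed_of_isClosed hclosed isClosed_Iic
  have haff : ∀ (m : E →L[ℝ] ℝ) (y : E), m v - ‖m‖ * ‖y - v‖ ≤ m y := by
    intro m y
    have := (abs_le.1 (m.le_opNorm (y - v))).1
    rw [map_sub] at this
    linarith
  set C₁ := ‖l‖ + a * ‖l₂‖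
  set C₂ := c - (l v + b) - a * (l₂ v + b₂)
  set R := 1 + (C₁ + |C₂|) / κ
  have hball : ∀ q ∈ S ∩ Φ ⁻¹' Set.Iic c, ‖q.1 - v‖ ≤ R := by
    intro q hq
    have h1 := hlow q.1 hq.1.1
    have h2 := hl₂ q.1 hq.1.1
    have h3 : Q q.1 + a * q.2 ≤ c := hq.2
    have h4 : a * (l₂ q.1 + b₂) ≤ a * q.2 := by have := hq.1.2; gcongr; linarith
    have h5 := haff l q.1
    have h6 := mul_le_mul_of_nonneg_left (haff l₂ q.1) ha.le
    refine le_of_pow_growth hp hκ (by positivity) ?_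
    simp only [C₁, C₂]
    nlinarith
  have hK : IsCompact (S ∩ Φ ⁻¹' Set.Iic c) := by
    refine Metric.isCompact_of_isClosed_isBounded hKclosed ?_
    refine Bornology.IsBounded.subset ((Metric.isBounded_closedBall (x := v) (r := R)).prod
      (Metric.isBounded_Icc (l₂ v - ‖l₂‖ * R + b₂) ((c - (l v - ‖l‖ * R + b)) / a))) ?_
    intro q hq
    have hr := hball q hq
    refine ⟨by simpa [dist_eq_norm] using hr, ?_, ?_⟩
    · have h1 := haff l₂ q.1
      have h2 := hl₂ q.1 hq.1.1
      have h3 : ‖l₂‖ * ‖q.1 - v‖ ≤ ‖l₂‖ * R := by gcongr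
      have h4 := hq.1.2
      linarith
    · rw [le_div_iff₀ ha]
      have h1 := haff l q.1
      have h2 := hlow q.1 hq.1.1
      have h3 : ‖l‖ * ‖q.1 - v‖ ≤ ‖l‖ * R := by gcongr
      have h4 : Q q.1 + a * q.2 ≤ c := hq.2
      have h5 : 0 ≤ κ * ‖q.1 - v‖ ^ (p + 1) := by positivity
      linarith
  have hxK : (x, ψ x) ∈ S ∩ Φ ⁻¹' Set.Iic c := ⟨⟨hx, le_rfl⟩, le_refl c⟩
  obtain ⟨⟨T, t⟩, hT, hmin⟩ := hK.exists_isMinOn ⟨_, hxK⟩ (hΦ.mono Set.inter_subset_left)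
  refine ⟨T, hT.1.1, fun y hy => ?_⟩
  have h1 : Q T + a * ψ T ≤ Q T + a * t := by have := hT.1.2; gcongr
  refine h1.trans ?_
  by_cases hyc : Q y + a * ψ y ≤ c
  · exact hmin (show (y, ψ y) ∈ S ∩ Φ ⁻¹' Set.Iic c from ⟨⟨hy, le_rfl⟩, hyc⟩)
  · have h2 : Q T + a * t ≤ c := hT.2
    linarith

omit [FiniteDimensional ℝ E] in
/-- Uniform convexity of the composite part, relative to the prox function. -/
theorem relStronglyConvex_le {p : ℕ} (hp : 1 ≤ p) {x₀ v : E} {σ a γ : ℝ} (ha : 0 < a)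
    (hconv : ConvexOn ℝ D ψ) (hsc : RelStronglyConvex D ψ (prox p x₀) σ)
    {q : E → ℝ} {q' : E →L[ℝ] ℝ} {T : E} (hT : T ∈ D) (hq : HasFDerivAt q q' T)
    (hmin : ∀ y ∈ D, q T + (a * ψ T + γ * bregman (prox p x₀) v T) ≤
      q y + (a * ψ y + γ * bregman (prox p x₀) v y)) {y : E} (hy : y ∈ D) :
    a * ψ T + γ * bregman (prox p x₀) v T - q' (y - T) +
      (γ + a * σ) * bregman (prox p x₀) T y ≤ a * ψ y + γ * bregman (prox p x₀) v y := by
  have hd := hasFDerivAt_bregman (hasFDerivAt_prox hp x₀ T).differentiableAt v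
  set B := fderiv ℝ (prox p x₀) T - fderiv ℝ (prox p x₀) v with hB
  -- Optimality at T exhibits −(q' + γB)/a as a subgradient of ψ. Strong convexity contributes aσ,
  -- the three-point identity γ.
  have h1 : ∀ z ∈ D, a * ψ T - (q' + γ • B) (z - T) ≤ a * ψ z := fun z hz =>
    le_of_isMin_add_convex (hconv.smul ha.le) hT (hq.add (hd.const_mul γ))
      (fun w hw => by
        have := hmin w hw
        simp only [Pi.add_apply, smul_eq_mul]
        linarith) hz
  have hsub : IsSubgradient D ψ T (-(a⁻¹ • (q' + γ • B))) := by
    refine ⟨hT, fun z hz => ?_⟩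
    have := h1 z hz
    rw [neg_apply, smul_apply, smul_eq_mul]
    have h2 : a * (ψ T + -(a⁻¹ * (q' + γ • B) (z - T))) ≤ a * ψ z := by
      rw [mul_add, mul_neg, ← mul_assoc, mul_inv_cancel₀ ha.ne', one_mul]
      linarith
    exact le_of_mul_le_mul_left h2 ha
  have h3 := mul_le_mul_of_nonneg_left (hsc T hT y hy _ hsub) ha.le
  rw [neg_apply, smul_apply, smul_eq_mul, sub_neg_eq_add, mul_add, ← mul_assoc a a⁻¹,
    mul_inv_cancel₀ ha.ne', one_mul, add_apply, smul_apply, smul_eq_mul] at h3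
  have h4 := bregman_add_bregman (prox p x₀) v T y
  rw [← hB] at h4
  rw [h4]
  linarith

end Existence

/-! ### The sequences A, a, γ and the condition numbers. -/

section Coefficients

variable {p : ℕ} {L σ γ₀ : ℝ}

theorem omega_pos (hL : 0 < L) (hσ : 0 < σ) : 0 < omega p L σ :=
  lt_min (by positivity) (by norm_num)

theorem omega_le_half : omega p L σ ≤ 1 / 2 := min_le_right _ _

theorem omega_pow_le (hL : 0 < L) (hσ : 0 < σ) :
    omega p L σ ^ (p + 1) ≤ σ * (p ! : ℝ) / (L * ((p : ℝ) + 1) * 2 ^ (p - 1)) := by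
  have h0 : 0 ≤ σ * (p ! : ℝ) / (L * ((p : ℝ) + 1) * 2 ^ (p - 1)) := by positivity
  calc omega p L σ ^ (p + 1)
      ≤ ((σ * (p ! : ℝ) / (L * ((p : ℝ) + 1) * 2 ^ (p - 1))) ^ (((p + 1 : ℕ) : ℝ)⁻¹)) ^ (p + 1) := by
        refine pow_le_pow_left₀ (omega_pos hL hσ).le ?_ _
        push_cast
        rw [← one_div]
        exact min_le_left _ _
    _ = _ := Real.rpow_inv_natCast_pow h0 (by omega)

theorem coefA_one : coefA p L σ γ₀ 1 = cConst p L γ₀ * ((p : ℝ) + 1) := by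
  simp [coefA, stepCoef]

theorem nextCoef_zero : nextCoef p L σ γ₀ 0 = coefA p L σ γ₀ 1 := by
  simp [nextCoef, coefA]

theorem coefA_succ (k : ℕ) :
    coefA p L σ γ₀ (k + 1) = coefA p L σ γ₀ k + nextCoef p L σ γ₀ k := rfl

theorem nextCoef_succ (hL : 0 < L) (hσ : 0 < σ) (k : ℕ) :
    nextCoef p L σ γ₀ (k + 1) =
      omega p L σ * (1 - omega p L σ)⁻¹ * coefA p L σ γ₀ (k + 1) := by
  simp [nextCoef, stepCoef, (omega_pos (p := p) hL hσ).ne']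

theorem coefA_succ_succ (hL : 0 < L) (hσ : 0 < σ) (k : ℕ) :
    coefA p L σ γ₀ (k + 2) = (1 - omega p L σ)⁻¹ * coefA p L σ γ₀ (k + 1) := by
  have h : 1 - omega p L σ ≠ 0 := by
    have := omega_le_half (p := p) (L := L) (σ := σ)
    linarith
  rw [coefA_succ (k + 1), nextCoef_succ hL hσ]
  field_simp
  ring

theorem coefA_succ_eq (hL : 0 < L) (hσ : 0 < σ) (k : ℕ) :
    coefA p L σ γ₀ (k + 1) = coefA p L σ γ₀ 1 * (1 - omega p L σ)⁻¹ ^ k := by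
  induction k with
  | zero => simp
  | succ k ih => rw [coefA_succ_succ hL hσ, ih]; ring

/-- After the first iteration the contraction weight a/A is constantly ω. -/
theorem nextCoef_succ_eq (hL : 0 < L) (hσ : 0 < σ) (k : ℕ) :
    nextCoef p L σ γ₀ (k + 1) = omega p L σ * coefA p L σ γ₀ (k + 2) := by
  rw [coefA_succ_succ hL hσ, nextCoef_succ hL hσ, mul_assoc]

theorem coefA_one_pos (hL : 0 < L) (hγ₀ : 0 < γ₀) : 0 < coefA p L σ γ₀ 1 := by
  rw [coefA_one, cConst]
  positivity

theorem coefA_one_eq (hL : 0 < L) :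
    coefA p L σ γ₀ 1 = (p ! : ℝ) * γ₀ / (2 ^ (p - 1) * ((p : ℝ) + 1) ^ (p + 1) * L) := by
  rw [coefA_one, cConst]
  field_simp
  ring

theorem one_sub_omega_inv_pos : 0 < (1 - omega p L σ)⁻¹ := by
  have := omega_le_half (p := p) (L := L) (σ := σ)
  rw [inv_pos]
  linarith

theorem one_sub_omega_inv_le_two : (1 - omega p L σ)⁻¹ ≤ 2 := by
  have := omega_le_half (p := p) (L := L) (σ := σ)
  rw [inv_le_comm₀ (by linarith) two_pos]
  linarith

theorem coefA_succ_pos (hL : 0 < L) (hσ : 0 < σ) (hγ₀ : 0 < γ₀) (k : ℕ) :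
    0 < coefA p L σ γ₀ (k + 1) := by
  rw [coefA_succ_eq hL hσ]
  exact mul_pos (coefA_one_pos hL hγ₀) (pow_pos one_sub_omega_inv_pos _)

theorem coefA_nonneg (hL : 0 < L) (hσ : 0 < σ) (hγ₀ : 0 < γ₀) (k : ℕ) :
    0 ≤ coefA p L σ γ₀ k := by
  cases k with
  | zero => exact le_rfl
  | succ k => exact (coefA_succ_pos hL hσ hγ₀ k).le

theorem nextCoef_pos (hL : 0 < L) (hσ : 0 < σ) (hγ₀ : 0 < γ₀) (k : ℕ) :
    0 < nextCoef p L σ γ₀ k := by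
  cases k with
  | zero => rw [nextCoef_zero]; exact coefA_one_pos hL hγ₀
  | succ k =>
    rw [nextCoef_succ_eq hL hσ]
    exact mul_pos (omega_pos hL hσ) (coefA_succ_pos hL hσ hγ₀ _)

theorem coefGamma_eq (k : ℕ) : coefGamma p L σ γ₀ k = γ₀ + σ * coefA p L σ γ₀ k := by
  induction k with
  | zero => simp [coefGamma, coefA]
  | succ k ih => rw [coefGamma, ih, coefA_succ]; ring

theorem le_coefGamma (hL : 0 < L) (hσ : 0 < σ) (hγ₀ : 0 < γ₀) (k : ℕ) :
    γ₀ ≤ coefGamma p L σ γ₀ k := by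
  rw [coefGamma_eq]
  have := mul_nonneg hσ.le (coefA_nonneg (p := p) hL hσ hγ₀ k)
  linarith

theorem coefGamma_pos (hL : 0 < L) (hσ : 0 < σ) (hγ₀ : 0 < γ₀) (k : ℕ) :
    0 < coefGamma p L σ γ₀ k :=
  hγ₀.trans_le (le_coefGamma hL hσ hγ₀ k)

/-- The Lipschitz constant of the `p`-th derivative of the contracted function. -/
def contractedLip (p : ℕ) (L σ γ₀ : ℝ) (k : ℕ) : ℝ :=
  L * (nextCoef p L σ γ₀ k ^ (p + 1) / coefA p L σ γ₀ (k + 1) ^ p)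

theorem stepM_eq (k : ℕ) : stepM p L σ γ₀ k = p * contractedLip p L σ γ₀ k := by
  rw [stepM, contractedLip, mul_assoc]

theorem contractedLip_pos (hL : 0 < L) (hσ : 0 < σ) (hγ₀ : 0 < γ₀) (k : ℕ) :
    0 < contractedLip p L σ γ₀ k :=
  mul_pos hL (div_pos (pow_pos (nextCoef_pos hL hσ hγ₀ k) _)
    (pow_pos (coefA_succ_pos hL hσ hγ₀ k) _))

theorem contractedLip_zero (hL : 0 < L) (hγ₀ : 0 < γ₀) :
    contractedLip p L σ γ₀ 0 = L * coefA p L σ γ₀ 1 := by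
  have := coefA_one_pos (p := p) (σ := σ) hL hγ₀
  rw [contractedLip, nextCoef_zero, zero_add, pow_succ]
  field_simp

theorem contractedLip_succ (hL : 0 < L) (hσ : 0 < σ) (hγ₀ : 0 < γ₀) (k : ℕ) :
    contractedLip p L σ γ₀ (k + 1) = L * (omega p L σ ^ (p + 1) * coefA p L σ γ₀ (k + 2)) := by
  have := coefA_succ_pos (p := p) hL hσ hγ₀ (k + 1)
  rw [contractedLip, nextCoef_succ_eq hL hσ, mul_pow, pow_succ (coefA p L σ γ₀ (k + 2))]
  field_simp

/-- The condition number of the first inner problem. -/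
theorem contractedLip_zero_eq (hL : 0 < L) (hγ₀ : 0 < γ₀) :
    contractedLip p L σ γ₀ 0 / (p ! : ℝ) =
      γ₀ / (2 ^ (p - 1) * ((p : ℝ) + 1)) * (((p : ℝ) + 1) ^ p)⁻¹ := by
  rw [contractedLip_zero hL hγ₀, coefA_one_eq hL, pow_succ]
  field_simp

/-- The condition number of the later inner problems. -/
theorem contractedLip_succ_le (hL : 0 < L) (hσ : 0 < σ) (hγ₀ : 0 < γ₀) (k : ℕ) :
    contractedLip p L σ γ₀ (k + 1) / (p ! : ℝ) ≤
      σ * coefA p L σ γ₀ (k + 2) / (2 ^ (p - 1) * ((p : ℝ) + 1)) := by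
  rw [contractedLip_succ hL hσ hγ₀]
  have h1 := omega_pow_le (p := p) hL hσ
  have h2 := coefA_succ_pos (p := p) hL hσ hγ₀ (k + 1)
  calc _ ≤ L * (σ * (p ! : ℝ) / (L * ((p : ℝ) + 1) * 2 ^ (p - 1)) * coefA p L σ γ₀ (k + 2)) /
        (p ! : ℝ) := by gcongr
    _ = _ := by field_simp

/-- This supplies the field `cond` of the inner problems: the choice of c handles the first one
through γ₀, the choice of ω the others through the part σA of γ. -/
theorem contractedLip_div_le (hL : 0 < L) (hσ : 0 < σ) (hγ₀ : 0 < γ₀) (k : ℕ) :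
    contractedLip p L σ γ₀ k / (p ! : ℝ) ≤
      coefGamma p L σ γ₀ (k + 1) / (2 ^ (p - 1) * ((p : ℝ) + 1)) := by
  cases k with
  | zero =>
    rw [contractedLip_zero_eq hL hγ₀]
    have h1 : (1 : ℝ) ≤ ((p : ℝ) + 1) ^ p := one_le_pow₀ (by linarith [p.cast_nonneg (α := ℝ)])
    have h2 := le_coefGamma (p := p) hL hσ hγ₀ 1
    calc _ ≤ γ₀ / (2 ^ (p - 1) * ((p : ℝ) + 1)) * 1 := by gcongr; exact inv_le_one_of_one_le₀ h1
      _ ≤ _ := by rw [mul_one]; gcongr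
  | succ k =>
    refine (contractedLip_succ_le hL hσ hγ₀ k).trans ?_
    rw [coefGamma_eq]
    gcongr
    linarith

/-- The ratio that controls the first gap of an inner loop. -/
theorem contractedLip_div_le_two (hL : 0 < L) (hσ : 0 < σ) (hγ₀ : 0 < γ₀) (k : ℕ) :
    contractedLip p L σ γ₀ k / (p ! : ℝ) ≤
      2 * (coefGamma p L σ γ₀ k / (2 ^ (p - 1) * ((p : ℝ) + 1))) := by
  cases k with
  | zero =>
    rw [contractedLip_zero_eq hL hγ₀, coefGamma_eq]
    have h1 : (1 : ℝ) ≤ ((p : ℝ) + 1) ^ p := one_le_pow₀ (by linarith [p.cast_nonneg (α := ℝ)])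
    have h0 : 0 < γ₀ / (2 ^ (p - 1) * ((p : ℝ) + 1)) := by positivity
    have h2 := inv_le_one_of_one_le₀ h1
    simp only [coefA, mul_zero, add_zero]
    nlinarith
  | succ k =>
    refine (contractedLip_succ_le hL hσ hγ₀ k).trans ?_
    rw [coefGamma_eq, coefA_succ_succ hL hσ, ← mul_div_assoc]
    have h1 := one_sub_omega_inv_le_two (p := p) (L := L) (σ := σ)
    have h2 := coefA_succ_pos (p := p) hL hσ hγ₀ k
    refine div_le_div_of_nonneg_right ?_ (by positivity)
    -- The factor 2 pays for A at the next index, at most twice the present one because ω ≤ 1/2.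
    nlinarith [mul_pos hσ h2]

end Coefficients

/-! ### The inner problems of the outer method. -/

section Outer

variable {E : Type u} [NormedAddCommGroup E] [InnerProductSpace ℝ E]
  {U D : Set E} {f ψ : E → ℝ} {p : ℕ} {L σ γ₀ : ℝ} {x₀ : E}

theorem contracted_eq (k : ℕ) (xk : E) :
    contracted f p L σ γ₀ k xk = fun y => coefA p L σ γ₀ (k + 1) *
      f (((coefA p L σ γ₀ (k + 1))⁻¹ * nextCoef p L σ γ₀ k) • y +
        ((coefA p L σ γ₀ (k + 1))⁻¹ * coefA p L σ γ₀ k) • xk) := by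
  funext y
  rw [contracted, smul_add, smul_smul, smul_smul]

theorem contraction_mem (hL : 0 < L) (hσ : 0 < σ) (hγ₀ : 0 < γ₀) (hD : Convex ℝ D) (k : ℕ)
    {xk y : E} (hx : xk ∈ D) (hy : y ∈ D) :
    (coefA p L σ γ₀ (k + 1))⁻¹ • (nextCoef p L σ γ₀ k • y + coefA p L σ γ₀ k • xk) ∈ D := by
  have h1 := coefA_succ_pos (p := p) hL hσ hγ₀ k
  have h2 := nextCoef_pos (p := p) hL hσ hγ₀ k
  have h3 := coefA_nonneg (p := p) hL hσ hγ₀ k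
  rw [smul_add, smul_smul, smul_smul]
  refine hD hy hx (by positivity) (by positivity) ?_
  rw [← mul_add, add_comm (nextCoef p L σ γ₀ k), ← coefA_succ, inv_mul_cancel₀ h1.ne']

/-- Jensen's inequality with weights a_{k+1}/A_{k+1} and A_k/A_{k+1}. -/
theorem le_contraction (hL : 0 < L) (hσ : 0 < σ) (hγ₀ : 0 < γ₀) {h : E → ℝ} (hh : ConvexOn ℝ D h)
    (k : ℕ) {xk y : E} (hx : xk ∈ D) (hy : y ∈ D) :
    coefA p L σ γ₀ (k + 1) *
      h ((coefA p L σ γ₀ (k + 1))⁻¹ • (nextCoef p L σ γ₀ k • y + coefA p L σ γ₀ k • xk)) ≤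
      nextCoef p L σ γ₀ k * h y + coefA p L σ γ₀ k * h xk := by
  have h1 := coefA_succ_pos (p := p) hL hσ hγ₀ k
  have h2 := nextCoef_pos (p := p) hL hσ hγ₀ k
  have h3 := coefA_nonneg (p := p) hL hσ hγ₀ k
  have h4 := hh.2 hy hx (show 0 ≤ (coefA p L σ γ₀ (k + 1))⁻¹ * nextCoef p L σ γ₀ k by positivity)
    (show 0 ≤ (coefA p L σ γ₀ (k + 1))⁻¹ * coefA p L σ γ₀ k by positivity)
    (by rw [← mul_add, add_comm (nextCoef p L σ γ₀ k), ← coefA_succ, inv_mul_cancel₀ h1.ne'])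
  rw [smul_add, smul_smul, smul_smul]
  refine (mul_le_mul_of_nonneg_left h4 h1.le).trans (le_of_eq ?_)
  simp only [smul_eq_mul]
  field_simp

theorem compositePart_le (hL : 0 < L) (hσ : 0 < σ) (hγ₀ : 0 < γ₀) (hp : 1 ≤ p)
    (hψ : ProperClosedConvex D ψ) (hsc : RelStronglyConvex D ψ (prox p x₀) σ) (k : ℕ) {vk : E}
    {q : E → ℝ} {q' : E →L[ℝ] ℝ} {T : E} (hT : T ∈ D) (hq : HasFDerivAt q q' T)
    (hmin : ∀ y ∈ D, q T + compositePart ψ p L σ γ₀ x₀ k vk T ≤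
      q y + compositePart ψ p L σ γ₀ x₀ k vk y) {y : E} (hy : y ∈ D) :
    compositePart ψ p L σ γ₀ x₀ k vk T - q' (y - T) +
      coefGamma p L σ γ₀ (k + 1) * bregman (prox p x₀) T y ≤
      compositePart ψ p L σ γ₀ x₀ k vk y :=
  relStronglyConvex_le hp (nextCoef_pos hL hσ hγ₀ k) hψ.2.1 hsc hT hq hmin hy

theorem convexOn_prox {x₀ : E} (hD : Convex ℝ D) : ConvexOn ℝ D (prox p x₀) := by
  have h1 : ConvexOn ℝ D (fun x : E => ‖x - x₀‖) := by
    refine ⟨hD, fun x hx y hy a b ha hb hab => ?_⟩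
    have h2 : a • x + b • y - x₀ = a • (x - x₀) + b • (y - x₀) := by
      have : x₀ = (a + b) • x₀ := by rw [hab, one_smul]
      nth_rewrite 1 [this]
      module
    change ‖a • x + b • y - x₀‖ ≤ a * ‖x - x₀‖ + b * ‖y - x₀‖
    rw [h2]
    refine (norm_add_le _ _).trans ?_
    rw [norm_smul, norm_smul, Real.norm_of_nonneg ha, Real.norm_of_nonneg hb]
  have h2 := (h1.pow (fun x _ => norm_nonneg _) (p + 1)).smul (c := ((p : ℝ) + 1)⁻¹) (by positivity)
  refine h2.congr fun x _ => ?_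
  simp [prox, div_eq_inv_mul]

theorem convexOn_bregman_prox {x₀ v : E} (hD : Convex ℝ D) :
    ConvexOn ℝ D (bregman (prox p x₀) v) := by
  have h1 := (ConvexOn.sub (convexOn_prox (p := p) (x₀ := x₀) hD)
    ((fderiv ℝ (prox p x₀) v).toLinearMap.concaveOn hD)).add_const
      (fderiv ℝ (prox p x₀) v v - prox p x₀ v)
  refine h1.congr fun y _ => ?_
  simp [bregman]
  ring

variable [FiniteDimensional ℝ E]

/-- The inner problems are well conditioned. -/
theorem innerProblem (hL : 0 < L) (hσ : 0 < σ) (hγ₀ : 0 < γ₀) (hp : 1 ≤ p)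
    (hU : IsOpen U) (hf : ConvexOn ℝ U f) (hfp : ContDiffOn ℝ p f U)
    (hLip : ∀ x ∈ U, ∀ y ∈ U,
      ‖iteratedFDeriv ℝ p f x - iteratedFDeriv ℝ p f y‖ ≤ L * ‖x - y‖)
    (hψ : ProperClosedConvex D ψ) (hDU : D ⊆ U)
    (hsc : RelStronglyConvex D ψ (prox p x₀) σ) (k : ℕ) {xk : E} (hx : xk ∈ D) (vk : E) :
    InnerProblem
      ((fun y => ((coefA p L σ γ₀ (k + 1))⁻¹ * nextCoef p L σ γ₀ k) • y +
        ((coefA p L σ γ₀ (k + 1))⁻¹ * coefA p L σ γ₀ k) • xk) ⁻¹' U) D p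
      (contractedLip p L σ γ₀ k)
      (coefGamma p L σ γ₀ (k + 1) / (2 ^ (p - 1) * ((p : ℝ) + 1)))
      (contracted f p L σ γ₀ k xk) (compositePart ψ p L σ γ₀ x₀ k vk) := by
  have hA := coefA_succ_pos (p := p) hL hσ hγ₀ k
  have ha := nextCoef_pos (p := p) hL hσ hγ₀ k
  have hγ := coefGamma_pos (p := p) hL hσ hγ₀ k
  have hγ' := coefGamma_pos (p := p) hL hσ hγ₀ (k + 1)
  rw [contracted_eq]
  constructor
  · exact hp
  · exact isOpen_preimage_affine _ _ hU
  · exact convexOn_comp_affine _ _ _ hf hA.le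
  · exact contDiffOn_comp_affine _ _ _ hfp
  · exact contractedLip_pos hL hσ hγ₀ k
  · have h := lipschitz_comp_affine (coefA p L σ γ₀ (k + 1))
      ((coefA p L σ γ₀ (k + 1))⁻¹ * nextCoef p L σ γ₀ k)
      (((coefA p L σ γ₀ (k + 1))⁻¹ * coefA p L σ γ₀ k) • xk) hU hfp hLip hA.le (by positivity)
    have e : coefA p L σ γ₀ (k + 1) *
        ((coefA p L σ γ₀ (k + 1))⁻¹ * nextCoef p L σ γ₀ k) ^ (p + 1) * L =
        contractedLip p L σ γ₀ k := by
      rw [contractedLip, mul_pow, inv_pow, pow_succ (coefA p L σ γ₀ (k + 1))]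
      field_simp
    rwa [e] at h
  · intro y hy
    have := contraction_mem (p := p) hL hσ hγ₀ hψ.2.1.1 k hx hy
    rw [smul_add, smul_smul, smul_smul] at this
    exact hDU this
  · exact hψ.1
  · exact (hψ.2.1.smul ha.le).add ((convexOn_bregman_prox hψ.2.1.1).smul hγ.le)
  · intro q q' T hT hq hmin y hy
    have h1 := compositePart_le hL hσ hγ₀ hp hψ hsc k hT hq hmin hy
    have h2 := mul_le_mul_of_nonneg_left (norm_pow_le_bregman_prox hp x₀ T y) hγ'.le
    rw [div_mul_eq_mul_div, ← mul_div_assoc] at *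
    linarith
  · rintro q hq ⟨l, b, hlb⟩
    have hcont : Continuous (bregman (prox p x₀) vk) :=
      continuous_iff_continuousAt.2 fun y =>
        (hasFDerivAt_bregman (hasFDerivAt_prox hp x₀ y).differentiableAt vk).continuousAt
    obtain ⟨T, hT, hmin⟩ := hψ.exists_min ha
      (Q := fun y => q y + coefGamma p L σ γ₀ k * bregman (prox p x₀) vk y)
      (hq.add (continuous_const.mul hcont).continuousOn) hp (l := l) (b := b) (v := vk)
      (κ := coefGamma p L σ γ₀ k / (2 ^ (p - 1) * ((p : ℝ) + 1))) (by positivity)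
      (fun y hy => by
        have h1 := hlb y hy
        have h2 := mul_le_mul_of_nonneg_left (norm_pow_le_bregman_prox hp x₀ vk y) hγ.le
        rw [div_mul_eq_mul_div, ← mul_div_assoc] at *
        linarith)
    refine ⟨T, hT, fun y hy => ?_⟩
    have := hmin y hy
    simp only [compositePart]
    linarith
  · exact contractedLip_div_le hL hσ hγ₀ k

end Outer

/-- If S increases, then S_{k+1} ≤ S_k + δ r_k with r_k ≤ (S_{k+1}/κ)^(1/(p+1)) and S_k ≤
S_k^(p/(p+1)) S_{k+1}^(1/(p+1)); dividing by S_{k+1}^(1/(p+1)) makes the recursion additive. -/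
theorem rpow_recursion {p : ℕ} {S r : ℕ → ℝ} {δ κ : ℝ} {K : ℕ} (hδ : 0 ≤ δ) (hκ : 0 < κ)
    (hS : ∀ k ≤ K, 0 ≤ S k) (hr : ∀ k < K, 0 ≤ r k) (hstep : ∀ k < K, S (k + 1) ≤ S k + δ * r k)
    (hrS : ∀ k < K, κ * r k ^ (p + 1) ≤ S (k + 1)) :
    ∀ k ≤ K, S k ^ ((p : ℝ) / (p + 1)) ≤
      S 0 ^ ((p : ℝ) / (p + 1)) + k * (δ * (κ⁻¹) ^ (((p : ℝ) + 1)⁻¹)) := by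
  intro k
  induction k with
  | zero => intro _; simp
  | succ k ih =>
    intro hk
    have ih := ih (by omega)
    have h0 := hS k (by omega)
    have h1 := hS (k + 1) hk
    set c := δ * (κ⁻¹) ^ (((p : ℝ) + 1)⁻¹) with hc
    have hc0 : 0 ≤ c := by positivity
    have hgoal : S (k + 1) ^ ((p : ℝ) / (p + 1)) ≤ S k ^ ((p : ℝ) / (p + 1)) + c := by
      rcases le_or_gt (S (k + 1)) (S k) with hle | hlt
      · have := Real.rpow_le_rpow h1 hle (show 0 ≤ (p : ℝ) / (p + 1) by positivity)
        linarith
      · have hpos : 0 < S (k + 1) := lt_of_le_of_lt h0 hlt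
        set m := S (k + 1) ^ (((p : ℝ) + 1)⁻¹) with hm
        have hm0 : 0 < m := by positivity
        have hsplit : ∀ a : ℝ, 0 ≤ a → a ^ ((p : ℝ) / (p + 1)) * a ^ (((p : ℝ) + 1)⁻¹) = a := by
          intro a ha
          rw [← Real.rpow_add_of_nonneg ha (by positivity) (by positivity)]
          have : (p : ℝ) / (p + 1) + ((p : ℝ) + 1)⁻¹ = 1 := by field_simp
          rw [this, Real.rpow_one]
        have hrle : r k ≤ (κ⁻¹) ^ (((p : ℝ) + 1)⁻¹) * m := by
          rw [hm, ← Real.mul_rpow (by positivity) h1]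
          have e := Real.pow_rpow_inv_natCast (hr k (by omega)) (show p + 1 ≠ 0 by omega)
          push_cast at e
          rw [← e]
          refine Real.rpow_le_rpow (pow_nonneg (hr k (by omega)) _) ?_ (by positivity)
          rw [← div_eq_inv_mul, le_div_iff₀ hκ, mul_comm]
          exact hrS k (by omega)
        have h2 : S k ^ (((p : ℝ) + 1)⁻¹) ≤ m := Real.rpow_le_rpow h0 hlt.le (by positivity)
        have h3 : S k ≤ S k ^ ((p : ℝ) / (p + 1)) * m := by
          conv_lhs => rw [← hsplit (S k) h0]
          gcongr
        have h4 := hstep k (by omega)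
        have h5 : δ * r k ≤ c * m := by
          rw [hc, mul_assoc]; gcongr
        have h6 := hsplit (S (k + 1)) h1
        rw [← hm] at h6
        refine le_of_mul_le_mul_right ?_ hm0
        rw [h6]
        linarith
    push_cast
    linarith

/-- Each of the two summands is at most exp(pX/(p+1)); the factor 1/2 compensates for there being
two. -/
theorem le_mul_exp_of_rpow_le {p : ℕ} (hp : 1 ≤ p) {S Y u l X k : ℝ} (hS : 0 ≤ S) (hY : 0 < Y)
    (h : S ^ ((p : ℝ) / (p + 1)) ≤
      1 / 2 * Y ^ ((p : ℝ) / (p + 1)) * (Real.exp ((p : ℝ) / (p + 1) * l) + u * k))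
    (hl : l ≤ X) (hu : u * k ≤ Real.exp ((p : ℝ) / (p + 1) * X)) : S ≤ Y * Real.exp X := by
  have hp0 : (0 : ℝ) < p := by exact_mod_cast hp
  have hθ : 0 < (p : ℝ) / (p + 1) := by positivity
  rw [← Real.rpow_le_rpow_iff hS (by positivity) hθ, Real.mul_rpow hY.le (Real.exp_pos _).le,
    ← Real.exp_mul, mul_comm X]
  have h1 : Real.exp ((p : ℝ) / (p + 1) * l) ≤ Real.exp ((p : ℝ) / (p + 1) * X) := by gcongr
  have h2 : 0 < Y ^ ((p : ℝ) / (p + 1)) := by positivity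
  nlinarith

/-! ### Effect of the choices of δ, 𝓛 and K on the potential and the gap ratio. -/

section Parameters

variable {p : ℕ} {L σ γ₀ ε β : ℝ}

theorem log_coefA_one (hL : 0 < L) (hγ₀ : 0 < γ₀) (hp : 1 ≤ p) :
    Real.log (coefA p L σ γ₀ 1) = Real.log (p ! : ℝ) + Real.log γ₀ -
      (((p : ℝ) - 1) * Real.log 2 + ((p : ℝ) + 1) * Real.log ((p : ℝ) + 1) + Real.log L) := by
  rw [coefA_one_eq hL, Real.log_div (by positivity) (by positivity),
    Real.log_mul (by positivity) (by positivity), Real.log_mul (by positivity) (by positivity),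
    Real.log_mul (by positivity) (by positivity), Real.log_pow, Real.log_pow, Nat.cast_sub hp]
  push_cast
  ring

theorem innerAccuracy_pos (hp : 1 ≤ p) (hL : 0 < L) (hσ : 0 < σ) (hγ₀ : 0 < γ₀) (hε : 0 < ε) :
    0 < innerAccuracy p L σ γ₀ ε := by
  have := omega_pos (p := p) hL hσ
  unfold innerAccuracy
  positivity

theorem log_innerAccuracy (hp : 1 ≤ p) (hL : 0 < L) (hσ : 0 < σ) (hγ₀ : 0 < γ₀) (hε : 0 < ε) :
    Real.log (innerAccuracy p L σ γ₀ ε) =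
      (p : ℝ) / (p + 1) * (Real.log (p ! : ℝ) + Real.log ε - Real.log L) +
      (Real.log γ₀ + Real.log p + Real.log (omega p L σ) - (p * Real.log 2 +
        (((p : ℝ) + 1) ^ 2 + 1) / ((p : ℝ) + 1) * Real.log ((p : ℝ) + 1))) := by
  have := omega_pos (p := p) hL hσ
  have hp0 : (0 : ℝ) < p := by exact_mod_cast hp
  rw [innerAccuracy, Real.log_mul (by positivity) (by positivity), Real.log_rpow (by positivity),
    Real.log_div (by positivity) (by positivity), Real.log_mul (by positivity) (by positivity),
    Real.log_div (by positivity) (by positivity), Real.log_mul (by positivity) (by positivity),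
    Real.log_mul (by positivity) (by positivity), Real.log_mul (by positivity) (by positivity),
    Real.log_pow, Real.log_rpow (by positivity)]

/-- The increment in the recursion for the potential. -/
theorem innerAccuracy_mul (hp : 1 ≤ p) (hL : 0 < L) (hσ : 0 < σ) (hγ₀ : 0 < γ₀) (hε : 0 < ε) :
    innerAccuracy p L σ γ₀ ε * ((γ₀ / (2 ^ (p - 1) * ((p : ℝ) + 1)))⁻¹) ^ (((p : ℝ) + 1)⁻¹) =
      1 / 2 * (coefA p L σ γ₀ 1 * ε) ^ ((p : ℝ) / (p + 1)) *
        ((p : ℝ) / (p + 1) * omega p L σ) := by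
  have hω := omega_pos (p := p) hL hσ
  have hA := coefA_one_pos (p := p) (σ := σ) hL hγ₀
  have hδ := innerAccuracy_pos hp hL hσ hγ₀ hε
  have hp0 : (0 : ℝ) < p := by exact_mod_cast hp
  -- Both sides are products of powers, so the identity is linear in logarithms.
  refine Real.log_injOn_pos (by simp only [Set.mem_Ioi]; positivity)
    (by simp only [Set.mem_Ioi]; positivity) ?_
  rw [Real.log_mul (by positivity) (by positivity), log_innerAccuracy hp hL hσ hγ₀ hε,
    Real.log_rpow (by positivity), Real.log_inv, Real.log_div (by positivity) (by positivity),
    Real.log_mul (by positivity) (by positivity), Real.log_pow, Nat.cast_sub hp,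
    Real.log_mul (by positivity) (by positivity), Real.log_mul (by positivity) (by positivity),
    Real.log_rpow (by positivity), Real.log_mul hA.ne' hε.ne', log_coefA_one hL hγ₀ hp,
    Real.log_mul (by positivity) (by positivity), Real.log_div (by positivity) (by positivity),
    Real.log_div (by positivity) (by positivity), Real.log_one]
  push_cast
  field_simp
  ring

theorem logFactor_arg_pos (hL : 0 < L) (hσ : 0 < σ) :
    0 < ((p : ℝ) + 1) ^ p / omega p L σ ^ (p + 1) := by
  have := omega_pos (p := p) hL hσ
  positivity

theorem le_exp_logFactor (hL : 0 < L) (hσ : 0 < σ) :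
    L * β * ((p : ℝ) + 1) ^ (p + 1) * (2 : ℝ) ^ ((p : ℝ) + 1 / (p : ℝ)) / ((p ! : ℝ) * ε) ≤
      Real.exp (logFactor p L σ ε β) := by
  rw [logFactor, Real.exp_log (lt_of_lt_of_le (logFactor_arg_pos hL hσ) (le_max_left _ _))]
  exact le_max_right _ _

theorem le_logFactor (hL : 0 < L) (hσ : 0 < σ) :
    p * Real.log ((p : ℝ) + 1) - (p + 1) * Real.log (omega p L σ) ≤ logFactor p L σ ε β := by
  have h0 := omega_pos (p := p) hL hσ
  have h1 := Real.log_le_log (logFactor_arg_pos (p := p) hL hσ) (le_max_left _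
    (L * β * ((p : ℝ) + 1) ^ (p + 1) * (2 : ℝ) ^ ((p : ℝ) + 1 / (p : ℝ)) / ((p ! : ℝ) * ε)))
  refine le_trans (le_of_eq ?_) h1
  rw [Real.log_div (by positivity) (by positivity), Real.log_pow, Real.log_pow]
  push_cast
  ring

theorem log_omega_le (hL : 0 < L) (hσ : 0 < σ) : Real.log (omega p L σ) ≤ -Real.log 2 := by
  rw [← Real.log_inv, ← one_div]
  exact Real.log_le_log (omega_pos hL hσ) omega_le_half

theorem log_two_le_logFactor (hL : 0 < L) (hσ : 0 < σ) :
    p * Real.log ((p : ℝ) + 1) + (p + 1) * Real.log 2 ≤ logFactor p L σ ε β := by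
  have h1 := le_logFactor (p := p) (ε := ε) (β := β) hL hσ
  have h2 := log_omega_le (p := p) hL hσ
  have h3 : (0 : ℝ) < (p : ℝ) + 1 := by positivity
  nlinarith

theorem logFactor_nonneg (hL : 0 < L) (hσ : 0 < σ) : 0 ≤ logFactor p L σ ε β := by
  refine le_trans ?_ (log_two_le_logFactor (p := p) hL hσ)
  have h1 := Real.log_nonneg (show (1 : ℝ) ≤ (p : ℝ) + 1 by linarith [p.cast_nonneg (α := ℝ)])
  have h2 := Real.log_nonneg (show (1 : ℝ) ≤ 2 by norm_num)
  positivity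

/-- The initial value of the potential. -/
theorem potential_zero_le (hp : 1 ≤ p) (hL : 0 < L) (hσ : 0 < σ) (hγ₀ : 0 < γ₀) (hε : 0 < ε)
    (hβ : 0 ≤ β) :
    (γ₀ * β) ^ ((p : ℝ) / (p + 1)) ≤ 1 / 2 * (coefA p L σ γ₀ 1 * ε) ^ ((p : ℝ) / (p + 1)) *
      Real.exp ((p : ℝ) / (p + 1) * logFactor p L σ ε β) := by
  have hA := coefA_one_pos (p := p) (σ := σ) hL hγ₀
  have hp0 : (0 : ℝ) < p := by exact_mod_cast hp
  have h1 := le_exp_logFactor (p := p) (ε := ε) (β := β) hL hσ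
  -- The power p/(p+1) turns 2^(−(1+1/p)) into the factor 1/2; this explains 2^(p+1/p) in 𝓛.
  have h2 : γ₀ * β ≤ (2 : ℝ) ^ (-(1 + 1 / (p : ℝ))) *
      (coefA p L σ γ₀ 1 * ε * Real.exp (logFactor p L σ ε β)) := by
    calc γ₀ * β = (2 : ℝ) ^ (-(1 + 1 / (p : ℝ))) * (coefA p L σ γ₀ 1 * ε *
        (L * β * ((p : ℝ) + 1) ^ (p + 1) * (2 : ℝ) ^ ((p : ℝ) + 1 / (p : ℝ)) /
          ((p ! : ℝ) * ε))) := by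
          have e : (2 : ℝ) ^ (-(1 + 1 / (p : ℝ))) * (2 : ℝ) ^ ((p : ℝ) + 1 / (p : ℝ)) =
              2 ^ (p - 1) := by
            rw [← Real.rpow_add two_pos, ← Real.rpow_natCast, Nat.cast_sub hp]
            congr 1
            push_cast
            ring
          rw [coefA_one_eq hL]
          have e2 : (2 : ℝ) ^ (-(1 + 1 / (p : ℝ))) * ((p ! : ℝ) * γ₀ /
              (2 ^ (p - 1) * ((p : ℝ) + 1) ^ (p + 1) * L) * ε *
              (L * β * ((p : ℝ) + 1) ^ (p + 1) * (2 : ℝ) ^ ((p : ℝ) + 1 / (p : ℝ)) /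
                ((p ! : ℝ) * ε))) =
              ((2 : ℝ) ^ (-(1 + 1 / (p : ℝ))) * (2 : ℝ) ^ ((p : ℝ) + 1 / (p : ℝ))) *
                (γ₀ * β / 2 ^ (p - 1)) := by
            field_simp
          rw [e2, e]
          field_simp
      _ ≤ _ := by gcongr
  refine (Real.rpow_le_rpow (by positivity) h2 (by positivity)).trans (le_of_eq ?_)
  rw [Real.mul_rpow (by positivity) (by positivity), Real.mul_rpow (by positivity) (by positivity),
    ← Real.exp_mul, ← Real.rpow_mul two_pos.le, mul_comm (logFactor p L σ ε β), ← mul_assoc]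
  have : -(1 + 1 / (p : ℝ)) * ((p : ℝ) / (p + 1)) = -1 := by field_simp
  rw [this, Real.rpow_neg_one]
  norm_num

/-- The 2 inside the floor leaves room for K − 1, the exponent of 1/(1−ω) in A_K. -/
theorem lt_outerIters : logFactor p L σ ε β / omega p L σ < outerIters p L σ ε β - 1 := by
  have := Nat.lt_floor_add_one (2 + 1 / omega p L σ * logFactor p L σ ε β)
  unfold outerIters
  rw [one_div, ← div_eq_inv_mul] at *
  linarith

theorem outerIters_le (hL : 0 < L) (hσ : 0 < σ) :
    (outerIters p L σ ε β : ℝ) ≤ 2 + logFactor p L σ ε β / omega p L σ := by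
  have h0 := logFactor_nonneg (p := p) (ε := ε) (β := β) hL hσ
  have h1 := omega_pos (p := p) hL hσ
  have := Nat.floor_le (show 0 ≤ 2 + 1 / omega p L σ * logFactor p L σ ε β by positivity)
  unfold outerIters
  rw [one_div, ← div_eq_inv_mul] at *
  exact this

theorem logFactor_le (hL : 0 < L) (hσ : 0 < σ) :
    logFactor p L σ ε β ≤ omega p L σ * (outerIters p L σ ε β - 1) := by
  have h1 := omega_pos (p := p) hL hσ
  have := lt_outerIters (p := p) (L := L) (σ := σ) (ε := ε) (β := β)
  rw [div_lt_iff₀ h1] at this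
  linarith

theorem le_logFactor_add (hL : 0 < L) (hσ : 0 < σ) :
    omega p L σ * (outerIters p L σ ε β - 1) ≤ omega p L σ + logFactor p L σ ε β := by
  have h1 := omega_pos (p := p) hL hσ
  have h2 := outerIters_le (p := p) (ε := ε) (β := β) hL hσ
  calc _ ≤ omega p L σ * (1 + logFactor p L σ ε β / omega p L σ) := by gcongr; linarith
    _ = _ := by field_simp

theorem one_le_outerIters (hL : 0 < L) (hσ : 0 < σ) : 1 ≤ outerIters p L σ ε β := by
  have h0 := logFactor_nonneg (p := p) (ε := ε) (β := β) hL hσ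
  have h1 := omega_pos (p := p) hL hσ
  have h2 := lt_outerIters (p := p) (L := L) (σ := σ) (ε := ε) (β := β)
  have h3 : 0 ≤ logFactor p L σ ε β / omega p L σ := by positivity
  have : (1 : ℝ) < outerIters p L σ ε β := by linarith
  exact_mod_cast this.le

theorem exp_omega_le : Real.exp (omega p L σ) ≤ (1 - omega p L σ)⁻¹ := by
  have h1 := omega_le_half (p := p) (L := L) (σ := σ)
  have h2 := Real.add_one_le_exp (-omega p L σ)
  rw [le_inv_comm₀ (Real.exp_pos _) (by linarith), ← Real.exp_neg]
  linarith

section Potential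

variable {S r : ℕ → ℝ}

theorem potential_rpow_le (hp : 1 ≤ p) (hL : 0 < L) (hσ : 0 < σ) (hγ₀ : 0 < γ₀) (hε : 0 < ε)
    (hβ : 0 ≤ β) {K : ℕ} (hS : ∀ k ≤ K, 0 ≤ S k) (hr : ∀ k < K, 0 ≤ r k) (hS0 : S 0 = γ₀ * β)
    (hstep : ∀ k < K, S (k + 1) ≤ S k + innerAccuracy p L σ γ₀ ε * r k)
    (hrS : ∀ k < K, γ₀ / (2 ^ (p - 1) * ((p : ℝ) + 1)) * r k ^ (p + 1) ≤ S (k + 1))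
    {k : ℕ} (hk : k ≤ K) :
    S k ^ ((p : ℝ) / (p + 1)) ≤ 1 / 2 * (coefA p L σ γ₀ 1 * ε) ^ ((p : ℝ) / (p + 1)) *
      (Real.exp ((p : ℝ) / (p + 1) * logFactor p L σ ε β) +
        ((p : ℝ) / (p + 1) * omega p L σ) * k) := by
  have h1 := rpow_recursion (innerAccuracy_pos hp hL hσ hγ₀ hε).le (by positivity)
    hS hr hstep hrS k hk
  rw [innerAccuracy_mul hp hL hσ hγ₀ hε, hS0] at h1
  have h2 := potential_zero_le hp hL hσ hγ₀ hε hβ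
  refine h1.trans ((add_le_add_left h2 _).trans (le_of_eq ?_))
  ring

/-- The potential stays bounded. -/
theorem potential_le_exp (hp : 1 ≤ p) (hL : 0 < L) (hσ : 0 < σ) (hγ₀ : 0 < γ₀) (hε : 0 < ε)
    (hβ : 0 ≤ β) (hS : ∀ k ≤ outerIters p L σ ε β, 0 ≤ S k)
    (hr : ∀ k < outerIters p L σ ε β, 0 ≤ r k) (hS0 : S 0 = γ₀ * β)
    (hstep : ∀ k < outerIters p L σ ε β, S (k + 1) ≤ S k + innerAccuracy p L σ γ₀ ε * r k)
    (hrS : ∀ k < outerIters p L σ ε β,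
      γ₀ / (2 ^ (p - 1) * ((p : ℝ) + 1)) * r k ^ (p + 1) ≤ S (k + 1))
    {k : ℕ} (hk : k < outerIters p L σ ε β) :
    S k ≤ coefA p L σ γ₀ 1 * ε * Real.exp (logFactor p L σ ε β) := by
  have hA := coefA_one_pos (p := p) (σ := σ) hL hγ₀
  have hω := omega_pos (p := p) hL hσ
  have hω2 := omega_le_half (p := p) (L := L) (σ := σ)
  have hp0 : (0 : ℝ) < p := by exact_mod_cast hp
  refine le_mul_exp_of_rpow_le hp (hS k hk.le) (by positivity)
    (potential_rpow_le hp hL hσ hγ₀ hε hβ hS hr hS0 hstep hrS hk.le) le_rfl ?_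
  have h1 := le_logFactor_add (p := p) (ε := ε) (β := β) hL hσ
  have h2 : (k : ℝ) ≤ outerIters p L σ ε β - 1 := by
    have : (k : ℝ) + 1 ≤ outerIters p L σ ε β := by exact_mod_cast hk
    linarith
  have h3 : (p : ℝ) / (p + 1) ≤ 1 := by rw [div_le_one (by positivity)]; linarith
  -- With θ = p/(p+1) and k ≤ K − 1: θωk ≤ θω + θ𝓛 ≤ 1 + θ𝓛 ≤ exp(θ𝓛).
  have h4 := Real.add_one_le_exp ((p : ℝ) / (p + 1) * logFactor p L σ ε β)
  have h5 : omega p L σ * k ≤ omega p L σ + logFactor p L σ ε β := by nlinarith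
  have h6 : (p : ℝ) / (p + 1) * (omega p L σ * k) ≤
      (p : ℝ) / (p + 1) * (omega p L σ + logFactor p L σ ε β) := by gcongr
  nlinarith

/-- The final value of the potential. -/
theorem potential_last_le (hp : 1 ≤ p) (hL : 0 < L) (hσ : 0 < σ) (hγ₀ : 0 < γ₀) (hε : 0 < ε)
    (hβ : 0 ≤ β) (hS : ∀ k ≤ outerIters p L σ ε β, 0 ≤ S k)
    (hr : ∀ k < outerIters p L σ ε β, 0 ≤ r k) (hS0 : S 0 = γ₀ * β)
    (hstep : ∀ k < outerIters p L σ ε β, S (k + 1) ≤ S k + innerAccuracy p L σ γ₀ ε * r k)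
    (hrS : ∀ k < outerIters p L σ ε β,
      γ₀ / (2 ^ (p - 1) * ((p : ℝ) + 1)) * r k ^ (p + 1) ≤ S (k + 1)) :
    S (outerIters p L σ ε β) ≤ coefA p L σ γ₀ (outerIters p L σ ε β) * ε := by
  have hA := coefA_one_pos (p := p) (σ := σ) hL hγ₀
  have hω := omega_pos (p := p) hL hσ
  have hω2 := omega_le_half (p := p) (L := L) (σ := σ)
  have hp0 : (0 : ℝ) < p := by exact_mod_cast hp
  have hK := one_le_outerIters (p := p) (ε := ε) (β := β) hL hσ
  -- Here X = ω(K−1), at least 𝓛 by the choice of K, and e^X is at most A_K/A_1.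
  have h1 := le_mul_exp_of_rpow_le hp (hS _ le_rfl) (by positivity)
    (potential_rpow_le hp hL hσ hγ₀ hε hβ hS hr hS0 hstep hrS le_rfl)
    (logFactor_le hL hσ) (by
      have h3 : (p : ℝ) / (p + 1) ≤ 1 := by rw [div_le_one (by positivity)]; linarith
      have h4 := Real.add_one_le_exp ((p : ℝ) / (p + 1) *
        (omega p L σ * (outerIters p L σ ε β - 1)))
      have h5 : (p : ℝ) / (p + 1) * omega p L σ ≤ 1 := by nlinarith
      nlinarith)
  refine h1.trans ?_
  obtain ⟨n, hn⟩ : ∃ n, outerIters p L σ ε β = n + 1 := ⟨outerIters p L σ ε β - 1, by omega⟩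
  rw [hn, coefA_succ_eq hL hσ n]
  have h2 : Real.exp (omega p L σ * (((n + 1 : ℕ) : ℝ) - 1)) ≤ (1 - omega p L σ)⁻¹ ^ n := by
    push_cast
    rw [add_sub_cancel_right, mul_comm, Real.exp_nat_mul]
    exact pow_le_pow_left₀ (Real.exp_pos _).le exp_omega_le n
  calc _ ≤ coefA p L σ γ₀ 1 * ε * (1 - omega p L σ)⁻¹ ^ n := by gcongr
    _ = _ := by ring

end Potential

/-- The constant in the bound for the logarithm of the ratio of gaps in an inner loop. -/
def gapConst (p : ℕ) : ℝ :=
  Real.log 2 + ((p : ℝ) + 1) / p * (Real.log 2 + Real.log ((p : ℝ) + 1) - Real.log p) -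
    ((p : ℝ) - 1) / p * Real.log ((p : ℝ) + 1)

/-- A bound for the logarithm of the ratio of gaps in the inner loop of iteration `k`. -/
def gapLog (p : ℕ) (L σ ε β : ℝ) (k : ℕ) : ℝ :=
  logFactor p L σ ε β + gapConst p + 1 / p * (k * Real.log (1 - omega p L σ)⁻¹ +
    if k = 0 then logFactor p L σ ε β else 0)

theorem log_contractedLip_le (hp : 1 ≤ p) (hL : 0 < L) (hσ : 0 < σ) (hγ₀ : 0 < γ₀) (k : ℕ) :
    Real.log (contractedLip p L σ γ₀ k) ≤ Real.log L + (p + 1) * Real.log (omega p L σ) +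
      Real.log (coefA p L σ γ₀ 1) + k * Real.log (1 - omega p L σ)⁻¹ +
      if k = 0 then logFactor p L σ ε β else 0 := by
  have hω := omega_pos (p := p) hL hσ
  have hA := coefA_one_pos (p := p) (σ := σ) hL hγ₀
  cases k with
  | zero =>
    rw [contractedLip_zero hL hγ₀, Real.log_mul hL.ne' hA.ne']
    -- The first Lipschitz constant L A_1 lacks the factor ω^(p+1); one extra 𝓛 makes up for it, by
    -- the first entry of the maximum in 𝓛.
    have h1 := le_logFactor (p := p) (ε := ε) (β := β) hL hσ
    have h2 := Real.log_nonneg (show (1 : ℝ) ≤ (p : ℝ) + 1 by linarith [p.cast_nonneg (α := ℝ)])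
    have h3 : 0 ≤ p * Real.log ((p : ℝ) + 1) := by positivity
    simp
    linarith
  | succ k =>
    have hν := one_sub_omega_inv_pos (p := p) (L := L) (σ := σ)
    rw [contractedLip_succ hL hσ hγ₀, coefA_succ_eq hL hσ, Real.log_mul hL.ne' (by positivity),
      Real.log_mul (by positivity) (by positivity), Real.log_mul (by positivity) (by positivity),
      Real.log_pow, Real.log_pow]
    simp only [Nat.succ_ne_zero, if_false]
    push_cast
    linarith

theorem gap_ratio_le (hp : 1 ≤ p) (hL : 0 < L) (hσ : 0 < σ) (hγ₀ : 0 < γ₀) (hε : 0 < ε) (k : ℕ) :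
    2 * (coefA p L σ γ₀ 1 * ε * Real.exp (logFactor p L σ ε β)) ≤
      Real.exp (gapLog p L σ ε β k) * (innerAccuracy p L σ γ₀ ε * (innerAccuracy p L σ γ₀ ε /
        ((p + 1) * (contractedLip p L σ γ₀ k / (p ! : ℝ)))) ^ ((p : ℝ)⁻¹)) := by
  have hω := omega_pos (p := p) hL hσ
  have hA := coefA_one_pos (p := p) (σ := σ) hL hγ₀
  have hδ := innerAccuracy_pos hp hL hσ hγ₀ hε
  have hM := contractedLip_pos (p := p) hL hσ hγ₀ k
  have hp0 : (0 : ℝ) < p := by exact_mod_cast hp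
  rw [← Real.log_le_log_iff (by positivity) (by positivity),
    Real.log_mul two_ne_zero (by positivity), Real.log_mul (by positivity) (by positivity),
    Real.log_mul hA.ne' hε.ne', Real.log_exp, Real.log_mul (by positivity) (by positivity),
    Real.log_exp, Real.log_mul hδ.ne' (by positivity), Real.log_rpow (by positivity),
    Real.log_div hδ.ne' (by positivity), Real.log_mul (by positivity) (by positivity),
    Real.log_div hM.ne' (by positivity), gapLog, gapConst]
  -- After taking logarithms the claim is 1/p times this bound: the powers of ω cancel because
  -- δ^((p+1)/p) carries ω^((p+1)/p).
  have h1 := log_contractedLip_le (ε := ε) (β := β) hp hL hσ hγ₀ k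
  have h2 := mul_le_mul_of_nonneg_left h1 (inv_nonneg.2 hp0.le)
  have h3 := log_innerAccuracy hp hL hσ hγ₀ hε
  rw [log_coefA_one hL hγ₀ hp] at h2 ⊢
  rw [h3]
  generalize (if k = 0 then logFactor p L σ ε β else 0) = J at *
  generalize Real.log (contractedLip p L σ γ₀ k) = M at *
  generalize Real.log (1 - omega p L σ)⁻¹ = N at *
  rw [← sub_nonneg] at h2 ⊢
  refine h2.trans (le_of_eq ?_)
  field_simp
  ring

end Parameters

/-! ### Summation of the inner steps and the numerical comparison. -/

section Counting

variable {p : ℕ} {L σ γ₀ ε β : ℝ}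

theorem gapConst_eq (hp : 1 ≤ p) : gapConst p = (2 + 1 / (p : ℝ)) * Real.log 2 +
    2 / p * Real.log ((p : ℝ) + 1) - (1 + 1 / (p : ℝ)) * Real.log p := by
  have hp0 : (0 : ℝ) < p := by exact_mod_cast hp
  rw [gapConst]
  field_simp
  ring

/-- `InnerProblem.steps_le` asks for X ≥ 0. The negative term −(1+1/p) log p is outweighed by the
multiples of log(p+1) in 𝓛 and `gapConst`. -/
theorem logFactor_add_gapConst_nonneg (hp : 1 ≤ p) (hL : 0 < L) (hσ : 0 < σ) :
    0 ≤ logFactor p L σ ε β + gapConst p := by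
  have hp1 : (1 : ℝ) ≤ p := by exact_mod_cast hp
  have hp0 : (0 : ℝ) < p := by linarith
  have h1 := log_two_le_logFactor (p := p) (ε := ε) (β := β) hL hσ
  have h2 := Real.log_nonneg hp1
  have h3 : Real.log p ≤ Real.log ((p : ℝ) + 1) := Real.log_le_log hp0 (by linarith)
  have h4 := Real.log_pos (show (1 : ℝ) < 2 by norm_num)
  have h5 : 0 ≤ ((p : ℝ) + 1 + (2 + 1 / (p : ℝ))) * Real.log 2 := by positivity
  have h6 : (1 + 1 / (p : ℝ)) * Real.log p ≤ (p + 2 / p) * Real.log ((p : ℝ) + 1) := by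
    refine mul_le_mul ?_ h3 h2 (by positivity)
    have : (2 : ℝ) / p = 1 / p + 1 / p := by ring
    have : 0 ≤ 1 / (p : ℝ) := by positivity
    linarith
  rw [gapConst_eq hp]
  nlinarith

theorem log_one_sub_omega_inv_nonneg (hL : 0 < L) (hσ : 0 < σ) :
    0 ≤ Real.log (1 - omega p L σ)⁻¹ := by
  have h1 := (Real.add_one_le_exp (omega p L σ)).trans exp_omega_le
  have h2 := omega_pos (p := p) hL hσ
  exact Real.log_nonneg (by linarith)

theorem gapLog_nonneg (hp : 1 ≤ p) (hL : 0 < L) (hσ : 0 < σ) (k : ℕ) :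
    0 ≤ gapLog p L σ ε β k := by
  have h1 := logFactor_add_gapConst_nonneg (ε := ε) (β := β) hp hL hσ
  have h2 := log_one_sub_omega_inv_nonneg (p := p) hL hσ
  have h3 := logFactor_nonneg (p := p) (ε := ε) (β := β) hL hσ
  have h4 : 0 ≤ if k = 0 then logFactor p L σ ε β else 0 := by split_ifs <;> simp [h3]
  unfold gapLog
  positivity

/-- The convex function exp lies below its chord between −log 2 and 0, so exp(−2ω log 2) ≤ 1 − ω. -/
theorem log_one_sub_omega_inv_le (hL : 0 < L) (hσ : 0 < σ) :
    Real.log (1 - omega p L σ)⁻¹ ≤ 2 * omega p L σ * Real.log 2 := by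
  have h1 := omega_le_half (p := p) (L := L) (σ := σ)
  have h2 := omega_pos (p := p) hL hσ
  have h3 := convexOn_exp.2 (Set.mem_univ 0) (Set.mem_univ (-Real.log 2))
    (show 0 ≤ 1 - 2 * omega p L σ by linarith) (show 0 ≤ 2 * omega p L σ by linarith) (by ring)
  rw [Real.exp_neg, Real.exp_log two_pos, Real.exp_zero] at h3
  simp only [smul_eq_mul, mul_zero, zero_add, mul_one] at h3
  rw [Real.log_inv, neg_le, ← Real.log_exp (-(2 * omega p L σ * Real.log 2))]
  refine Real.log_le_log (Real.exp_pos _) ?_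
  rw [← mul_neg]
  linarith

theorem sum_gapLog (K : ℕ) (hK : 1 ≤ K) :
    ∑ k ∈ Finset.range K, gapLog p L σ ε β k = K * (logFactor p L σ ε β + gapConst p) +
      1 / p * (K * ((K : ℝ) - 1) / 2 * Real.log (1 - omega p L σ)⁻¹ + logFactor p L σ ε β) := by
  have h1 : ∑ k ∈ Finset.range K, (k : ℝ) = K * ((K : ℝ) - 1) / 2 := by
    induction K, hK using Nat.le_induction with
    | base => simp
    | succ n _ ih => rw [Finset.sum_range_succ, ih]; push_cast; ring
  have h2 : ∑ k ∈ Finset.range K, (if k = 0 then logFactor p L σ ε β else 0) =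
      logFactor p L σ ε β := by
    rw [Finset.sum_ite_eq' (Finset.range K) 0, if_pos (Finset.mem_range.2 hK)]
  simp only [gapLog, Finset.sum_add_distrib, ← Finset.mul_sum, ← Finset.sum_mul, h1, h2]
  simp
  ring

theorem one_div_exp_le : (1.58 : ℝ) ≤ Real.exp 1 / (Real.exp 1 - 1) := by
  have h1 := Real.exp_one_lt_d9
  have h2 := Real.exp_one_gt_d9
  rw [le_div_iff₀ (by linarith)]
  linarith

/-- The maximum and 1 + 1/γ₀ are at least 1 and can be dropped; what the final constant holds beyond
`gapConst` is the last bracket, the slack for `average_le`. -/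
theorem le_innerBound (hp : 1 ≤ p) (hL : 0 < L) (hσ : 0 < σ) (hγ₀ : 0 < γ₀) :
    3 + (1 + 1.58 / (p : ℝ)) * (1 + logFactor p L σ ε β) + gapConst p +
      (Real.log ((p : ℝ) + 1) + (2 * p - 1 + 3 / p) * Real.log 2) ≤ innerBound p L σ γ₀ ε β := by
  have hp0 : (0 : ℝ) < p := by exact_mod_cast hp
  have h1 : (1 + 1.58 / (p : ℝ)) * (1 + logFactor p L σ ε β) ≤
      (1 + Real.exp 1 / ((Real.exp 1 - 1) * p)) * (1 + logFactor p L σ ε β) := by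
    have := logFactor_nonneg (p := p) (ε := ε) (β := β) hL hσ
    have := one_div_exp_le
    rw [← div_div]
    gcongr
  set m := max 1 ((4 * σ * (p ! : ℝ) / (((p : ℝ) + 1) * L)) ^ (1 / (p : ℝ)))
  have hm : 1 ≤ m * (1 + 1 / γ₀) :=
    one_le_mul_of_one_le_of_one_le (le_max_left _ _) (by
      have : 0 ≤ 1 / γ₀ := by positivity
      linarith)
  have hm0 : 0 < m := lt_of_lt_of_le one_pos (le_max_left _ _)
  have h2 : gapConst p + (Real.log ((p : ℝ) + 1) + (2 * p - 1 + 3 / p) * Real.log 2) ≤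
      Real.log (m * (1 + 1 / γ₀)
        * (((p : ℝ) + 1) ^ (((p : ℝ) + 2) / (p : ℝ)) / (p : ℝ) ^ (((p : ℝ) + 1) / (p : ℝ)))
        * (2 : ℝ) ^ ((2 * (p : ℝ) ^ 2 + p + 4) / (p : ℝ))) := by
    rw [Real.log_mul (by positivity) (by positivity), Real.log_mul (by positivity) (by positivity),
      Real.log_div (by positivity) (by positivity), Real.log_rpow (by positivity),
      Real.log_rpow hp0, Real.log_rpow two_pos, gapConst_eq hp]
    have h3 := Real.log_nonneg hm
    refine le_trans (le_of_eq ?_) (add_le_add_left (add_le_add_left h3 _) _)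
    field_simp
    ring
  unfold innerBound
  linarith

theorem log_add_one_le (p : ℕ) : Real.log ((p : ℝ) + 1) ≤ p * Real.log 2 := by
  rw [← Real.log_pow]
  refine Real.log_le_log (by positivity) ?_
  have : p + 1 ≤ 2 ^ p := Nat.lt_two_pow_self
  exact_mod_cast this

/-- The numerical comparison behind the bound for the average number of inner steps. -/
theorem average_le (hp : 1 ≤ p) {l C : ℝ} (hl : 0 ≤ l)
    (hC : C ≤ (4 + 1 / (p : ℝ)) * Real.log 2) :
    (l + C + 1 / p * ((1 / 2 + l) * Real.log 2 + 1 / 2)) / rate p ≤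
      (1 + 1.58 / (p : ℝ)) * (1 + l) + C +
        (Real.log ((p : ℝ) + 1) + (2 * p - 1 + 3 / p) * Real.log 2) := by
  have hp1 : (1 : ℝ) ≤ p := by exact_mod_cast hp
  have hp0 : (0 : ℝ) < p := by linarith
  have hb1 := Real.log_two_gt_d9
  have hb2 := Real.log_two_lt_d9
  have hlog : Real.log 2 ≤ Real.log ((p : ℝ) + 1) := Real.log_le_log two_pos (by linarith)
  set b := Real.log 2
  set x : ℝ := (p : ℝ)
  have hrate : ∀ y : ℝ, y / rate p = y * (x + 1.58) / (x + 0.7) := by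
    intro y
    change y / ((x + 0.7) / (x + 1.58)) = _
    rw [div_div_eq_mul_div]
  rw [hrate]
  have hx : 0 < x + 0.7 := by linarith
  -- The numerator x + 0.7 of the rate cancels x + log 2, leaving (x + 1.58)/x.
  have h1 : l * (1 + b / x) * (x + 1.58) / (x + 0.7) ≤ (1 + 1.58 / x) * l := by
    rw [div_le_iff₀ hx]
    have e : (1 + b / x) * (x + 1.58) ≤ (1 + 1.58 / x) * (x + 0.7) := by
      have e1 : (1 + b / x) * (x + 1.58) = (x + b) * (x + 1.58) / x := by field_simp
      have e2 : (1 + 1.58 / x) * (x + 0.7) = (x + 0.7) * (x + 1.58) / x := by field_simp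
      rw [e1, e2]
      gcongr
      linarith
    nlinarith
  -- The excess 0.88 C/(x + 0.7) is largest at x = 1, where C ≤ 5 log 2; the 1.8 is later paid from
  -- the slack.
  have h2 : C * (x + 1.58) / (x + 0.7) ≤ C + 1.8 := by
    rw [div_le_iff₀ hx]
    have h3 : 1 / x ≤ 1 := by rw [div_le_one hp0]; exact hp1
    have h4 : C ≤ 5 * b := by nlinarith
    nlinarith
  have h3 : 1 / x * (1 / 2 * b + 1 / 2) * (x + 1.58) / (x + 0.7) ≤ 1.58 / x := by
    rw [div_le_iff₀ hx]
    have e : (1 / 2 * b + 1 / 2) * (x + 1.58) ≤ 1.58 * (x + 0.7) := by nlinarith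
    calc _ = (1 / 2 * b + 1 / 2) * (x + 1.58) / x := by ring
      _ ≤ 1.58 * (x + 0.7) / x := by gcongr
      _ = _ := by ring
  have h4 : 1.8 ≤ 1 + (Real.log (x + 1) + (2 * x - 1 + 3 / x) * b) := by
    have h5 : 0 ≤ 3 / x * b := by positivity
    nlinarith
  have e : (l + C + 1 / x * ((1 / 2 + l) * b + 1 / 2)) * (x + 1.58) / (x + 0.7) =
      l * (1 + b / x) * (x + 1.58) / (x + 0.7) + C * (x + 1.58) / (x + 0.7) +
        1 / x * (1 / 2 * b + 1 / 2) * (x + 1.58) / (x + 0.7) := by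
    field_simp
    ring
  rw [e]
  nlinarith

theorem gapConst_le (hp : 1 ≤ p) : gapConst p ≤ (4 + 1 / (p : ℝ)) * Real.log 2 := by
  have hp1 : (1 : ℝ) ≤ p := by exact_mod_cast hp
  have hp0 : (0 : ℝ) < p := by linarith
  have h1 := log_add_one_le p
  have h2 := Real.log_nonneg hp1
  have h3 : 2 / (p : ℝ) * Real.log ((p : ℝ) + 1) ≤ 2 / (p : ℝ) * (p * Real.log 2) := by gcongr
  have h4 : 2 / (p : ℝ) * (p * Real.log 2) = 2 * Real.log 2 := by field_simp
  have h5 : 0 ≤ (1 + 1 / (p : ℝ)) * Real.log p := by positivity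
  rw [gapConst_eq hp]
  linarith

/-- The bound for the total number of inner steps. -/
theorem sum_le_innerBound (hp : 1 ≤ p) (hL : 0 < L) (hσ : 0 < σ) (hγ₀ : 0 < γ₀) {t : ℕ → ℕ}
    (ht : ∀ k < outerIters p L σ ε β, (t k : ℝ) ≤ 3 + gapLog p L σ ε β k / rate p) :
    ∑ k ∈ Finset.range (outerIters p L σ ε β), (t k : ℝ) ≤
      outerIters p L σ ε β * innerBound p L σ γ₀ ε β := by
  have hK1 := one_le_outerIters (p := p) (ε := ε) (β := β) hL hσ
  have hl0 := logFactor_nonneg (p := p) (ε := ε) (β := β) hL hσ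
  have hω := omega_pos (p := p) hL hσ
  have hω2 := omega_le_half (p := p) (L := L) (σ := σ)
  have hK2 := logFactor_le (p := p) (ε := ε) (β := β) hL hσ
  have hK3 := le_logFactor_add (p := p) (ε := ε) (β := β) hL hσ
  have hsum := sum_gapLog (p := p) (L := L) (σ := σ) (ε := ε) (β := β) _ hK1
  have hbound := le_innerBound (ε := ε) (β := β) hp hL hσ hγ₀
  have havg := average_le hp hl0 (gapConst_le hp)
  have hN := log_one_sub_omega_inv_le (p := p) hL hσ
  have hb := Real.log_pos (show (1 : ℝ) < 2 by norm_num)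
  have hr := rate_pos p
  have hp0 : (0 : ℝ) < p := by exact_mod_cast hp
  set K := outerIters p L σ ε β
  set l := logFactor p L σ ε β
  have hK : (1 : ℝ) ≤ K := by exact_mod_cast hK1
  calc ∑ k ∈ Finset.range K, (t k : ℝ)
      ≤ ∑ k ∈ Finset.range K, (3 + gapLog p L σ ε β k / rate p) :=
        Finset.sum_le_sum fun k hk => ht k (Finset.mem_range.1 hk)
    _ = K * 3 + (∑ k ∈ Finset.range K, gapLog p L σ ε β k) / rate p := by
        rw [Finset.sum_add_distrib, ← Finset.sum_div]; simp
    _ ≤ K * 3 + (K * (l + gapConst p + 1 / p * ((1 / 2 + l) * Real.log 2 + 1 / 2))) / rate p := by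
        rw [hsum]
        have h1 : K * ((K : ℝ) - 1) / 2 * Real.log (1 - omega p L σ)⁻¹ ≤
            K * ((1 / 2 + l) * Real.log 2) := by
          have h2 : ((K : ℝ) - 1) * Real.log (1 - omega p L σ)⁻¹ ≤
              2 * ((1 / 2 + l) * Real.log 2) := by
            calc _ ≤ ((K : ℝ) - 1) * (2 * omega p L σ * Real.log 2) := by
                  gcongr
              _ = 2 * ((omega p L σ * (K - 1)) * Real.log 2) := by ring
              _ ≤ _ := by gcongr; linarith
          calc _ = K / 2 * (((K : ℝ) - 1) * Real.log (1 - omega p L σ)⁻¹) := by ring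
            _ ≤ K / 2 * (2 * ((1 / 2 + l) * Real.log 2)) := by gcongr
            _ = _ := by ring
        -- The extra 𝓛 of iteration 0 costs at most 1/2 on average, since 𝓛 ≤ ω(K−1) and ω ≤ 1/2.
        have h3 : l ≤ K * (1 / 2) := by nlinarith
        have h4 : 1 / (p : ℝ) * (K * ((K : ℝ) - 1) / 2 * Real.log (1 - omega p L σ)⁻¹ + l) ≤
            1 / (p : ℝ) * (K * ((1 / 2 + l) * Real.log 2) + K * (1 / 2)) := by gcongr
        gcongr
        linarith
    _ = K * (3 + (l + gapConst p + 1 / p * ((1 / 2 + l) * Real.log 2 + 1 / 2)) / rate p) := by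
        ring
    _ ≤ _ := by gcongr; linarith

end Counting

/-! ### The potential, existence of runs, and the theorem. -/

section Main

variable {E : Type u} [NormedAddCommGroup E] [InnerProductSpace ℝ E]
  {U D : Set E} {f ψ : E → ℝ} {p : ℕ} {L σ γ₀ : ℝ} {x₀ xstar : E}

/-- The potential of the outer method. -/
def potential (f ψ : E → ℝ) (p : ℕ) (L σ γ₀ : ℝ) (x₀ xstar : E) (k : ℕ) (x v : E) : ℝ :=
  coefA p L σ γ₀ k * (f x + ψ x - (f xstar + ψ xstar)) +
    coefGamma p L σ γ₀ k * bregman (prox p x₀) v xstar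

/-- One contracted step, in terms of an approximate solution `T` of the inner problem. -/
theorem contraction_potential_le (hL : 0 < L) (hσ : 0 < σ) (hγ₀ : 0 < γ₀)
    (hf : ConvexOn ℝ U f) (hψ : ConvexOn ℝ D ψ) (hDU : D ⊆ U) (hxstar : xstar ∈ D) {k : ℕ}
    {xk vk T : E} (hx : xk ∈ D) (hT : T ∈ D) {R c : ℝ}
    (h : contracted f p L σ γ₀ k xk T + compositePart ψ p L σ γ₀ x₀ k vk T + R ≤
      contracted f p L σ γ₀ k xk xstar + compositePart ψ p L σ γ₀ x₀ k vk xstar + c) :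
    coefA p L σ γ₀ (k + 1) *
        (f ((coefA p L σ γ₀ (k + 1))⁻¹ • (nextCoef p L σ γ₀ k • T + coefA p L σ γ₀ k • xk)) +
          ψ ((coefA p L σ γ₀ (k + 1))⁻¹ • (nextCoef p L σ γ₀ k • T + coefA p L σ γ₀ k • xk)) -
          (f xstar + ψ xstar)) + R + coefGamma p L σ γ₀ k * bregman (prox p x₀) vk T ≤
      potential f ψ p L σ γ₀ x₀ xstar k xk vk + c := by
  -- Jensen is needed for f at x* and for ψ at T. The slacks R and c let one lemma serve both
  -- inexact solutions and exact minimizers.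
  have h1 := le_contraction (p := p) hL hσ hγ₀ hf k (hDU hx) (hDU hxstar)
  have h2 := le_contraction (p := p) hL hσ hγ₀ hψ k hx hT
  have h3 := coefA_succ (p := p) (L := L) (σ := σ) (γ₀ := γ₀) k
  simp only [contracted, compositePart] at h
  have h4 : coefA p L σ γ₀ (k + 1) * (f xstar + ψ xstar) =
      coefA p L σ γ₀ k * (f xstar + ψ xstar) + nextCoef p L σ γ₀ k * (f xstar + ψ xstar) := by
    rw [h3]; ring
  rw [potential]
  linarith

variable [FiniteDimensional ℝ E]

omit [FiniteDimensional ℝ E] in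
/-- The subgradient inequality for the result of a tensor step. -/
theorem add_stepGrad_add_bregman_le (hL : 0 < L) (hσ : 0 < σ) (hγ₀ : 0 < γ₀) (hp : 1 ≤ p)
    (hψ : ProperClosedConvex D ψ) (hsc : RelStronglyConvex D ψ (prox p x₀) σ) {k : ℕ}
    {xk vk x T y : E} {V : Set E} {s : ℝ}
    (hI : InnerProblem V D p (contractedLip p L σ γ₀ k) s (contracted f p L σ γ₀ k xk)
      (compositePart ψ p L σ γ₀ x₀ k vk)) (hx : x ∈ D)
    (hT : IsTensorStep D p (p * contractedLip p L σ γ₀ k) (contracted f p L σ γ₀ k xk)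
      (compositePart ψ p L σ γ₀ x₀ k vk) x T) (hy : y ∈ D) :
    contracted f p L σ γ₀ k xk T + compositePart ψ p L σ γ₀ x₀ k vk T +
      stepGrad p (p * contractedLip p L σ γ₀ k) (contracted f p L σ γ₀ k xk) x T (y - T) +
      coefGamma p L σ γ₀ (k + 1) * bregman (prox p x₀) T y ≤
      contracted f p L σ γ₀ k xk y + compositePart ψ p L σ γ₀ x₀ k vk y := by
  have h1 := add_fderiv_le_of_convexOn hI.convex_g (hI.subset hT.1) (hI.hasFDerivAt hT.1)
    (hI.subset hy)
  have h2 := compositePart_le hL hσ hγ₀ hp hψ hsc k hT.1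
    (hasFDerivAt_modelSmooth hI.one_le (hI.contDiffAt hx) (p * contractedLip p L σ γ₀ k) T)
    (fun _ hz => InnerProblem.step_min hT hz) hy
  rw [stepGrad_eq, sub_apply]
  linarith

/-- Existence of the first iterations of the method. -/
theorem exists_isRun (hL : 0 < L) (hσ : 0 < σ) (hγ₀ : 0 < γ₀) (hp : 1 ≤ p)
    (hU : IsOpen U) (hf : ConvexOn ℝ U f) (hfp : ContDiffOn ℝ p f U)
    (hLip : ∀ x ∈ U, ∀ y ∈ U,
      ‖iteratedFDeriv ℝ p f x - iteratedFDeriv ℝ p f y‖ ≤ L * ‖x - y‖)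
    (hψ : ProperClosedConvex D ψ) (hDU : D ⊆ U)
    (hsc : RelStronglyConvex D ψ (prox p x₀) σ) (hx₀ : x₀ ∈ D) {δ : ℝ} (hδ : 0 < δ) (K : ℕ) :
    ∃ (x v : ℕ → E) (z : ℕ → ℕ → E) (t : ℕ → ℕ), IsRun f D ψ p L σ γ₀ δ x₀ K x v z t := by
  have hloop : ∀ (k : ℕ) (q : D × D), ∃ (z : ℕ → E) (t : ℕ), z 0 = q.2 ∧ z t ∈ D ∧
      (∀ j < t, IsTensorStep D p (stepM p L σ γ₀ k) (contracted f p L σ γ₀ k q.1)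
        (compositePart ψ p L σ γ₀ x₀ k q.2) (z j) (z (j + 1))) ∧
      (∀ j, j + 1 < t → δ < ‖stepGrad p (stepM p L σ γ₀ k) (contracted f p L σ γ₀ k q.1)
        (z j) (z (j + 1))‖) ∧
      ∃ j, t = j + 1 ∧ ‖stepGrad p (stepM p L σ γ₀ k) (contracted f p L σ γ₀ k q.1)
        (z j) (z (j + 1))‖ ≤ δ := by
    intro k q
    rw [stepM_eq]
    obtain ⟨z, t, h1, h2, h3, h4⟩ := (innerProblem hL hσ hγ₀ hp hU hf hfp hLip hψ hDU hsc k
      q.1.2 q.2).exists_steps q.2.2 hδ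
    refine ⟨z, t, h1, ?_, h2, h3, h4⟩
    exact InnerProblem.iterate_mem (by rw [h1]; exact q.2.2) h2 t le_rfl
  choose z t hz0 hzD hz htest hlast using hloop
  -- The recursion runs on D × D because an inner problem is well posed only when its data lie in D.
  let next : ℕ → D × D → D × D := fun k q =>
    (⟨_, contraction_mem (p := p) hL hσ hγ₀ hψ.2.1.1 k q.1.2 (hzD k q)⟩, ⟨_, hzD k q⟩)
  let state : ℕ → D × D := fun k => Nat.rec (⟨x₀, hx₀⟩, ⟨x₀, hx₀⟩) next k
  have hstate : ∀ k, state (k + 1) = next k (state k) := fun _ => rfl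
  refine ⟨fun k => (state k).1, fun k => (state k).2, fun k => z k (state k),
    fun k => t k (state k), ?_⟩
  constructor
  · rfl
  · rfl
  · exact fun k _ => hz0 k _
  · exact fun k _ => hz k _
  · exact fun k _ => htest k _
  · exact fun k _ => hlast k _
  · exact fun k _ => rfl
  · exact fun k _ => rfl

omit [FiniteDimensional ℝ E] in
theorem IsRun.mem (hL : 0 < L) (hσ : 0 < σ) (hγ₀ : 0 < γ₀) (hD : Convex ℝ D) (hx₀ : x₀ ∈ D)
    {δ : ℝ} {K : ℕ} {x v : ℕ → E} {z : ℕ → ℕ → E} {t : ℕ → ℕ}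
    (h : IsRun f D ψ p L σ γ₀ δ x₀ K x v z t) : ∀ k ≤ K, x k ∈ D ∧ v k ∈ D := by
  intro k
  induction k with
  | zero => intro _; rw [h.x_zero, h.v_zero]; exact ⟨hx₀, hx₀⟩
  | succ k ih =>
    intro hk
    obtain ⟨hx, hv⟩ := ih (by omega)
    have hv' : v (k + 1) ∈ D := by
      obtain ⟨j, hj, _⟩ := h.last_test k hk
      rw [h.v_succ k hk, hj]
      exact (h.z_succ k hk j (by omega)).1
    refine ⟨?_, hv'⟩
    rw [h.x_succ k hk]
    exact contraction_mem hL hσ hγ₀ hD k hx hv'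

end Main
end ContractingTensor
end

theorem theorem4p6 {E : Type*} [NormedAddCommGroup E] [InnerProductSpace ℝ E]
    [FiniteDimensional ℝ E]
    -- the smooth part `f` with its domain `U`, and the composite part `ψ` with its domain `D`
    (U : Set E) (f : E → ℝ) (D : Set E) (ψ : E → ℝ)
    (p : ℕ) (hp : 1 ≤ p) (L σ γ₀ ε : ℝ) (x₀ xstar : E)
    (hU : IsOpen U) (hf : ConvexOn ℝ U f) (hfp : ContDiffOn ℝ p f U)
    (hL : 0 < L)
    (hLip : ∀ x ∈ U, ∀ y ∈ U,
      ‖iteratedFDeriv ℝ p f x - iteratedFDeriv ℝ p f y‖ ≤ L * ‖x - y‖)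
    (hψ : ProperClosedConvex D ψ) (hDU : D ⊆ U)
    (hxstar : xstar ∈ D) (hmin : ∀ y ∈ D, f xstar + ψ xstar ≤ f y + ψ y)
    (hx₀ : x₀ ∈ D) (hσ : 0 < σ) (hsc : RelStronglyConvex D ψ (prox p x₀) σ)
    (hγ₀ : 0 < γ₀) (hε : 0 < ε)
    (δ β : ℝ) (K : ℕ)
    (hδ : δ = innerAccuracy p L σ γ₀ ε)
    (hβ : β = bregman (prox p x₀) x₀ xstar)
    (hK : K = outerIters p L σ ε β) :
    (∃ (x v : ℕ → E) (z : ℕ → ℕ → E) (t : ℕ → ℕ), IsRun f D ψ p L σ γ₀ δ x₀ K x v z t) ∧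
    ∀ (x v : ℕ → E) (z : ℕ → ℕ → E) (t : ℕ → ℕ), IsRun f D ψ p L σ γ₀ δ x₀ K x v z t →
      x K ∈ D ∧
      (f (x K) + ψ (x K)) - (f xstar + ψ xstar) ≤ ε ∧
      ∑ k ∈ Finset.range K, (t k : ℝ) ≤ K * innerBound p L σ γ₀ ε β := by
  have hδ0 : 0 < δ := hδ ▸ innerAccuracy_pos hp hL hσ hγ₀ hε
  have hβ0 : 0 ≤ β := hβ ▸ bregman_prox_nonneg hp x₀ x₀ xstar
  refine ⟨exists_isRun hL hσ hγ₀ hp hU hf hfp hLip hψ hDU hsc hx₀ hδ0 K, ?_⟩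
  intro x v z t h
  have hmem := h.mem hL hσ hγ₀ hψ.2.1.1 hx₀
  have hI : ∀ k < K, _ := fun k hk =>
    innerProblem hL hσ hγ₀ hp hU hf hfp hLip hψ hDU hsc k (hmem k hk.le).1 (v k)
  have hz : ∀ k < K, ∀ j < t k, IsTensorStep D p (p * contractedLip p L σ γ₀ k)
      (contracted f p L σ γ₀ k (x k)) (compositePart ψ p L σ γ₀ x₀ k (v k)) (z k j)
      (z k (j + 1)) := fun k hk j hj => by
    rw [← stepM_eq]; exact h.z_succ k hk j hj
  have hz0 : ∀ k < K, z k 0 ∈ D := fun k hk => by rw [h.z_zero k hk]; exact (hmem k hk.le).2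
  have hgap : ∀ k ≤ K, 0 ≤ coefA p L σ γ₀ k * (f (x k) + ψ (x k) - (f xstar + ψ xstar)) :=
    fun k hk => mul_nonneg (coefA_nonneg hL hσ hγ₀ k)
      (sub_nonneg.2 (hmin _ (hmem k hk).1))
  have hγpos := fun k => coefGamma_pos (p := p) hL hσ hγ₀ k
  set S : ℕ → ℝ := fun k => potential f ψ p L σ γ₀ x₀ xstar k (x k) (v k) with hS
  have hSbreg : ∀ k ≤ K, coefGamma p L σ γ₀ k * bregman (prox p x₀) (v k) xstar ≤ S k := by
    intro k hk
    have := hgap k hk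
    simp only [hS, potential]
    linarith
  have hS0 : ∀ k ≤ K, 0 ≤ S k := fun k hk =>
    (mul_nonneg (hγpos k).le (bregman_prox_nonneg hp x₀ _ _)).trans (hSbreg k hk)
  have hSzero : S 0 = γ₀ * β := by
    simp [hS, potential, coefA, coefGamma, h.v_zero, hβ]
  have hstep : ∀ k < K, S (k + 1) ≤ S k + innerAccuracy p L σ γ₀ ε * ‖xstar - v (k + 1)‖ := by
    intro k hk
    obtain ⟨j, hj, hlast⟩ := h.last_test k hk
    have hT := hz k hk j (by omega)
    have hv : v (k + 1) = z k (j + 1) := by rw [h.v_succ k hk, hj]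
    have h1 := add_stepGrad_add_bregman_le hL hσ hγ₀ hp hψ hsc (hI k hk)
      (InnerProblem.iterate_mem (hz0 k hk) (hz k hk) j (by omega)) hT hxstar
    rw [stepM_eq] at hlast
    -- The passed test bounds the linear term by δ times the distance to x*; the term with γ_{k+1}
    -- becomes the new prox part of the potential.
    have h2 := (abs_le.1 ((stepGrad p (p * contractedLip p L σ γ₀ k)
      (contracted f p L σ γ₀ k (x k)) (z k j) (z k (j + 1))).le_opNorm
        (xstar - z k (j + 1)))).1
    have h3 := mul_le_mul_of_nonneg_right hlast (norm_nonneg (xstar - z k (j + 1)))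
    have h4 := contraction_potential_le (R := coefGamma p L σ γ₀ (k + 1) *
      bregman (prox p x₀) (z k (j + 1)) xstar) (c := δ * ‖xstar - z k (j + 1)‖)
      (vk := v k) (x₀ := x₀) hL hσ hγ₀ hf hψ.2.1 hDU hxstar (hmem k hk.le).1 hT.1 (by linarith)
    have h5 := mul_nonneg (hγpos k).le (bregman_prox_nonneg hp x₀ (v k) (z k (j + 1)))
    simp only [hS]
    rw [potential, h.x_succ k hk, hv, ← hδ]
    linarith
  have hrS : ∀ k < K, γ₀ / (2 ^ (p - 1) * ((p : ℝ) + 1)) * ‖xstar - v (k + 1)‖ ^ (p + 1) ≤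
      S (k + 1) := by
    intro k hk
    refine le_trans ?_ (hSbreg (k + 1) hk)
    have h1 := norm_pow_le_bregman_prox hp x₀ (v (k + 1)) xstar
    have h2 := le_coefGamma (p := p) hL hσ hγ₀ (k + 1)
    calc _ = γ₀ * (‖xstar - v (k + 1)‖ ^ (p + 1) / (2 ^ (p - 1) * ((p : ℝ) + 1))) := by ring
      _ ≤ _ := mul_le_mul h2 h1 (by positivity) (hγpos _).le
  subst hK
  have hSlast := potential_last_le hp hL hσ hγ₀ hε hβ0 hS0 (fun k _ => norm_nonneg _) hSzero hstep
    hrS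
  refine ⟨(hmem _ le_rfl).1, ?_, ?_⟩
  -- K ≥ 1 makes A_K positive, so it can be cancelled after dropping the prox part.
  · obtain ⟨n, hn⟩ : ∃ n, outerIters p L σ ε β = n + 1 :=
      ⟨_, (Nat.sub_add_cancel (one_le_outerIters hL hσ)).symm⟩
    have hA : 0 < coefA p L σ γ₀ (outerIters p L σ ε β) := by
      rw [hn]; exact coefA_succ_pos hL hσ hγ₀ n
    have h1 := mul_nonneg (hγpos (outerIters p L σ ε β)).le
      (bregman_prox_nonneg hp x₀ (v (outerIters p L σ ε β)) xstar)
    refine le_of_mul_le_mul_left (le_trans ?_ hSlast) hA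
    simp only [hS, potential]
    linarith
  · refine sum_le_innerBound hp hL hσ hγ₀ fun k hk => ?_
    obtain ⟨w, hw, hgrow⟩ := (hI k hk).exists_growth
    refine (hI k hk).steps_le (hz0 k hk) (hz k hk) hw hgrow hδ0
      (fun j hj => by rw [← stepM_eq]; exact h.earlier_tests k hk j hj)
      (gapLog_nonneg hp hL hσ k) ?_
    have hSk := potential_le_exp hp hL hσ hγ₀ hε hβ0 hS0 (fun k _ => norm_nonneg _) hSzero hstep
      hrS hk
    rw [hδ]
    refine le_trans ?_ (gap_ratio_le hp hL hσ hγ₀ hε k)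
    refine le_trans ?_ (mul_le_mul_of_nonneg_left hSk two_pos.le)
    have h1 : 0 ≤ coefGamma p L σ γ₀ (k + 1) / (2 ^ (p - 1) * ((p : ℝ) + 1)) *
        ‖xstar - w‖ ^ (p + 1) := by have := hγpos (k + 1); positivity
    -- For the exact inner minimizer w, F ≥ F* leaves γ_k β_d(v_k; w) ≤ S_k, which bounds ‖w − v_k‖
    -- and hence the first inner gap by 2 S_k.
    have h2 := contraction_potential_le (R := 0) (c := 0) (vk := v k) (x₀ := x₀) hL hσ hγ₀ hf
      hψ.2.1 hDU hxstar (hmem k hk.le).1 hw (by have := hgrow xstar hxstar; linarith)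
    have h3 : 0 ≤ coefA p L σ γ₀ (k + 1) * _ := mul_nonneg (coefA_nonneg hL hσ hγ₀ (k + 1))
      (sub_nonneg.2 (hmin _ (contraction_mem (p := p) hL hσ hγ₀ hψ.2.1.1 k (hmem k hk.le).1 hw)))
    have h4 : coefGamma p L σ γ₀ k * bregman (prox p x₀) (v k) w ≤ S k := by
      simp only [hS]
      linarith
    have h5 := mul_le_mul_of_nonneg_left (norm_pow_le_bregman_prox hp x₀ (v k) w) (hγpos k).le
    rw [h.z_zero k hk]
    calc _ ≤ 2 * (coefGamma p L σ γ₀ k / (2 ^ (p - 1) * ((p : ℝ) + 1))) *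
          ‖w - v k‖ ^ (p + 1) := by gcongr; exact contractedLip_div_le_two hL hσ hγ₀ k
      _ = 2 * (coefGamma p L σ γ₀ k * (‖w - v k‖ ^ (p + 1) / (2 ^ (p - 1) * ((p : ℝ) + 1)))) := by
          ring
      _ ≤ _ := by gcongr; exact h5.trans h4
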